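/- Let $M$ be a non-empty smooth $7$-manifold (Hausdorff, second countable, without boundary). A $\mathrm{G}_2$ structure on $M$ is a smooth $3$-form $\varphi$ such that for each $x\in M$ there is a linear isomorphism $u:T_xM\to\mathbb R^7$ with $\varphi_x=u^*(e^{123}+e^{145}+e^{167}+e^{246}-e^{257}-e^{347}-e^{356})$. It determines a unique Riemannian metric $g$ and orientation by $g(u,v)\,\mathrm{vol}_g=\frac16(u\lrcorner\varphi)\wedge(v\lrcorner\varphi)\wedge\varphi$; let $*_\varphi$ be the Hodge star, $\psi=*_\varphi\varphi$, and $\Delta_\varphi\varphi=dd^*\varphi+d^*d\varphi$ the Hodge Laplacian of $\varphi$. Call $\varphi$ torsion-free if $\nabla\varphi=0$ for the Levi-Civita connection $\nabla$ of $g$. If $d\varphi=0$, the torsion form of $\varphi$ is the unique smooth $2$-form $\tau$ with $\tau\wedge\varphi=-*_\varphi\tau$ and $d\psi=\tau\wedge\varphi$. A Laplacian soliton is a triple $(\varphi,X,\lambda)$ with $\varphi$ a closed $\mathrm{G}_2$ structure, $X$ a smooth vector field and $\lambda\in\mathbb R$ such that $\Delta_\varphi\varphi=\lambda\varphi+\mathcal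 L_X\varphi$; it is an expander if $\lambda>0$. The Laplacian flow of closed $\mathrm{G}_2$ structures is $\partial_t\varphi=\Delta_\varphi\varphi$, $d\varphi=0$, and a $3$-form $\varphi$ is a stationary point of it if the constant family $\varphi(t)=\varphi$, $t\ge 0$, is a solution. (a) Let $(\varphi,0,\lambda)$ be a Laplacian soliton on $M$. Then the torsion form $\tau$ of $\varphi$ exists and is unique, $\lambda=\frac17|\tau|^2$ at every point of $M$, so $\lambda\ge 0$; and $\lambda=0$ if and only if $\varphi$ is torsion-free. In particular $(\varphi,0,\lambda)$ is an expander or $\varphi$ is torsion-free. Moreover, a $3$-form on $M$ is a stationary point of the Laplacian flow if and only if it is a torsion-free $\mathrm{G}_2$ structure. (b) If $M$ is compact and $(\varphi,0,\lambda)$ is a Laplacian soliton on $M$, then $\varphi$ is torsion-free. -/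

import Mathlib

open scoped Manifold ContDiff

namespace G2

noncomputable section

/-! ## Linear algebra of alternating forms on `ℝ⁷` -/

/-- The model space `ℝ⁷` with its Euclidean structure. -/
abbrev E7 : Type := EuclideanSpace ℝ (Fin 7)

/-- Alternating `k`-forms on `ℝ⁷`. -/
abbrev AltForm (k : ℕ) : Type := E7 [⋀^Fin k]→L[ℝ] ℝ

/-- The standard basis vectors of `ℝ⁷`, indexed by `0, …, 6`. -/
def stdVec (i : Fin 7) : E7 := EuclideanSpace.single i 1

/-- The dual basis `eⁱ`, as `1`-forms. -/
def stdCovec (i : Fin 7) : AltForm 1 :=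
  ContinuousAlternatingMap.ofSubsingleton ℝ E7 ℝ (0 : Fin 1) (EuclideanSpace.proj i)

/-- The tensor product `α ⊗ β`, as a continuous multilinear map. -/
def tensor {k l : ℕ} (α : AltForm k) (β : AltForm l) :
    ContinuousMultilinearMap ℝ (fun _ : Fin (k + l) => E7) ℝ where
  toMultilinearMap :=
    ((LinearMap.mul' ℝ ℝ).compMultilinearMap
      (MultilinearMap.domCoprod α.toMultilinearMap β.toMultilinearMap)).domDomCongr finSumFinEquiv
  cont := by
    have h : Continuous fun v : Fin (k + l) → E7 =>
        α (fun i => v (Fin.castAdd l i)) * β (fun j => v (Fin.natAdd k j)) := by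
      refine (α.cont.comp ?_).mul (β.cont.comp ?_) <;> fun_prop
    refine h.congr fun v => ?_
    simp [MultilinearMap.domCoprod]

/-- The wedge product, normalised so that
`(α ∧ β)(v) = 1 / (k! l!) ∑ σ, sign σ α(v_{σ 1}, …, v_{σ k}) β(v_{σ (k+1)}, …, v_{σ (k+l)})`;
in particular `e¹ ∧ ⋯ ∧ eᵏ` takes the value `1` on `(e₁, …, e_k)`. -/
def wedge {k l : ℕ} (α : AltForm k) (β : AltForm l) : AltForm (k + l) :=
  ((k.factorial : ℝ) * (l.factorial : ℝ))⁻¹ •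
    ContinuousMultilinearMap.alternatization (tensor α β)

/-- The interior product `u ⌟ α`. -/
def intProd {k : ℕ} (u : E7) (α : AltForm (k + 1)) : AltForm k := α.curryLeft u

/-- `eⁱ ∧ eʲ ∧ eᵏ`. -/
def stdTriple (i j k : Fin 7) : AltForm 3 :=
  wedge (wedge (stdCovec i) (stdCovec j)) (stdCovec k)

/-- The model `3`-form
`e¹²³ + e¹⁴⁵ + e¹⁶⁷ + e²⁴⁶ - e²⁵⁷ - e³⁴⁷ - e³⁵⁶` on `ℝ⁷` (indices shifted by one). -/
def phi0 : AltForm 3 :=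
  stdTriple 0 1 2 + stdTriple 0 3 4 + stdTriple 0 5 6 + stdTriple 1 3 5
    - stdTriple 1 4 6 - stdTriple 2 3 6 - stdTriple 2 4 5

/-- A `3`-form is positive if it is the pullback of the model form by a linear isomorphism. -/
def IsPositive (ρ : AltForm 3) : Prop :=
  ∃ u : E7 ≃L[ℝ] E7, ρ = phi0.compContinuousLinearMap (u : E7 →L[ℝ] E7)

/-- The `Λ⁷`-valued bilinear form `B_ρ(u, v) = (1/6) (u ⌟ ρ) ∧ (v ⌟ ρ) ∧ ρ`. -/
def bForm (ρ : AltForm 3) (u v : E7) : AltForm 7 :=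
  (1 / 6 : ℝ) • wedge (k := 4) (wedge (intProd u ρ) (intProd v ρ)) ρ

/-- `g` is an inner product, `vol` is one of its two volume forms, and
`g(u, v) vol = B_ρ(u, v)`. -/
structure IsMetricOf (ρ : AltForm 3) (g : LinearMap.BilinForm ℝ E7) (vol : AltForm 7) : Prop where
  symm : ∀ u v, g u v = g v u
  pos : ∀ u, u ≠ 0 → 0 < g u u
  vol_sq : ∀ v : Fin 7 → E7, vol v ^ 2 = (Matrix.of fun i j => g (v i) (v j)).det
  eq_bForm : ∀ u v, g u v • vol = bForm ρ u v

open Classical in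
/-- The pair (metric, volume form) determined by `ρ`: the unique one with
`g(u, v) vol = B_ρ(u, v)`. It exists when `ρ` is positive (the value `0` is a default). -/
def metricVol (ρ : AltForm 3) : LinearMap.BilinForm ℝ E7 × AltForm 7 :=
  if h : ∃ p : LinearMap.BilinForm ℝ E7 × AltForm 7, IsMetricOf ρ p.1 p.2 then h.choose else 0

/-- The metric determined by a positive `3`-form. -/
def metric (ρ : AltForm 3) : LinearMap.BilinForm ℝ E7 := (metricVol ρ).1

/-- The (oriented) volume form determined by a positive `3`-form. -/
def volForm (ρ : AltForm 3) : AltForm 7 := (metricVol ρ).2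

/-- The components `g^{ij}` of the inverse metric in the standard basis. -/
def invMetric (ρ : AltForm 3) : Matrix (Fin 7) (Fin 7) ℝ :=
  (Matrix.of fun i j => metric ρ (stdVec i) (stdVec j))⁻¹

/-- The induced inner product on `k`-forms,
`⟨α, β⟩ = (1/k!) α_{i₁…i_k} β_{j₁…j_k} g^{i₁j₁} ⋯ g^{i_kj_k}`. -/
def formInner (ρ : AltForm 3) {k : ℕ} (α β : AltForm k) : ℝ :=
  (k.factorial : ℝ)⁻¹ * ∑ I : Fin k → Fin 7, ∑ J : Fin k → Fin 7,
    α (fun a => stdVec (I a)) * β (fun a => stdVec (J a)) * ∏ a, invMetric ρ (I a) (J a)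

theorem append_update {k l : ℕ} (w : Fin k → E7) (v : Fin l → E7) (i : Fin l) (x : E7) :
    Fin.append w (Function.update v i x) =
      Function.update (Fin.append w v) (Fin.natAdd k i) x := by
  funext a
  refine Fin.addCases (fun b => ?_) (fun b => ?_) a
  · have hne : Fin.castAdd l b ≠ Fin.natAdd k i := by
      intro h
      have h1 := congrArg Fin.val h
      simp only [Fin.val_castAdd, Fin.val_natAdd] at h1
      omega
    simp [Function.update_of_ne hne]
  · by_cases h : b = i
    · subst h
      simp
    · have hne : Fin.natAdd k b ≠ Fin.natAdd k i := by simpa using h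
      simp [Function.update_of_ne hne, Function.update_of_ne h]

/-- The `l`-form `v ↦ ν(w₁, …, w_k, v₁, …, v_l)` obtained from an `n`-form `ν`, `n = k + l`. -/
def contract {k l n : ℕ} (h : k + l = n) (ν : AltForm n) (w : Fin k → E7) : AltForm l where
  toFun v := ν (fun a => Fin.append w v (Fin.cast h.symm a))
  map_update_add' := by
    intro inst v i x y
    subst h
    have hi : inst = instDecidableEqFin l := Subsingleton.elim _ _
    subst hi
    simp only [append_update]
    exact ν.map_update_add _ _ _ _
  map_update_smul' := by
    intro inst v i c x
    subst h
    have hi : inst = instDecidableEqFin l := Subsingleton.elim _ _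
    subst hi
    simp only [append_update]
    exact ν.map_update_smul _ _ _ _
  map_eq_zero_of_eq' := by
    intro v i j hv hij
    subst h
    refine ν.map_eq_zero_of_eq (i := Fin.natAdd k i) (j := Fin.natAdd k j) _ ?_ ?_
    · simpa using hv
    · simpa using hij
  cont := by
    subst h
    refine ν.cont.comp (continuous_pi fun a => ?_)
    refine Fin.addCases (fun b => ?_) (fun b => ?_) a
    · simpa using continuous_const
    · simpa using continuous_apply b

/-- The Hodge star of the metric and orientation determined by `ρ`, from `k`-forms to `l`-forms
with `k + l = 7`:
`(*α)(v) = (1/k!) α_{i₁…i_k} g^{i₁j₁} ⋯ g^{i_kj_k} vol(e_{j₁}, …, e_{j_k}, v₁, …, v_l)`,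
which is the `l`-form with `β ∧ *α = ⟨β, α⟩ vol` for all `k`-forms `β`. -/
def hodgeStar (ρ : AltForm 3) {k l : ℕ} (h : k + l = 7) (α : AltForm k) : AltForm l :=
  (k.factorial : ℝ)⁻¹ • ∑ I : Fin k → Fin 7, ∑ J : Fin k → Fin 7,
    (α (fun a => stdVec (I a)) * ∏ a, invMetric ρ (I a) (J a)) •
      contract h (volForm ρ) (fun a => stdVec (J a))

/-! ## Differential forms on a `7`-manifold

The tangent space `TangentSpace (𝓡 7) x` of Mathlib is by definition the model space `E7`,
identified with it through the preferred chart `chartAt E7 x`. -/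

section Manifold

variable {M : Type*} [TopologicalSpace M] [ChartedSpace E7 M]

variable (M) in
/-- (Not necessarily smooth) differential `k`-forms on `M`: the value at `x` is an alternating
form on `TangentSpace (𝓡 7) x`. -/
abbrev DiffForm (k : ℕ) : Type _ := M → AltForm k

variable (M) in
/-- (Not necessarily smooth) vector fields on `M`: the value at `x` lies in
`TangentSpace (𝓡 7) x`. -/
abbrev VField : Type _ := M → E7

/-- The derivative at `y` of the inverse of the chart around `x`, from `ℝ⁷` to the tangent space
at the point with coordinates `y`. -/
def chartSymmDeriv (x : M) (y : E7) : E7 →L[ℝ] E7 :=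
  mfderiv (𝓡 7) (𝓡 7) (chartAt E7 x).symm y

/-- The derivative at `x` of the chart around `x`. -/
def chartDeriv (x : M) : E7 →L[ℝ] E7 :=
  mfderiv (𝓡 7) (𝓡 7) (chartAt E7 x) x

/-- The coordinate expression of a form in the chart around `x`, i.e. its pullback under the
inverse of the chart (meaningful on the target of the chart). -/
def localForm {k : ℕ} (α : DiffForm M k) (x : M) (y : E7) : AltForm k :=
  (α ((chartAt E7 x).symm y)).compContinuousLinearMap (chartSymmDeriv x y)

/-- A form is smooth if all its coordinate expressions are. -/
def IsSmoothForm {k : ℕ} (α : DiffForm M k) : Prop :=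
  ∀ x : M, ContDiffOn ℝ ∞ (localForm α x) (chartAt E7 x).target

/-- The exterior derivative, computed at `x` in the chart around `x`. -/
def extd {k : ℕ} (α : DiffForm M k) : DiffForm M (k + 1) := fun x =>
  (extDeriv (localForm α x) (chartAt E7 x x)).compContinuousLinearMap (chartDeriv x)

/-- Smooth vector fields. -/
def IsSmoothVField [IsManifold (𝓡 7) ∞ M] (X : VField M) : Prop :=
  ContMDiff (𝓡 7) (𝓡 7).tangent ∞ (fun x => (⟨x, X x⟩ : TangentBundle (𝓡 7) M))

/-- The Lie derivative of a form of positive degree, `L_X α = d(X ⌟ α) + X ⌟ dα`. -/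
def lieDeriv {k : ℕ} (X : VField M) (α : DiffForm M (k + 1)) : DiffForm M (k + 1) := fun x =>
  extd (fun y => intProd (X y) (α y)) x + intProd (X x) (extd α x)

/-! ## The Levi-Civita connection in coordinates -/

/-- The components `g_{ij}` at the point with coordinates `y` of a metric tensor, in the chart
around `x`. -/
def localMetric (g : M → LinearMap.BilinForm ℝ E7) (x : M) (y : E7) (i j : Fin 7) : ℝ :=
  g ((chartAt E7 x).symm y) (chartSymmDeriv x y (stdVec i)) (chartSymmDeriv x y (stdVec j))

/-- The partial derivative `∂_i f` at `y`. -/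
def partialD (f : E7 → ℝ) (y : E7) (i : Fin 7) : ℝ := fderiv ℝ f y (stdVec i)

/-- The Christoffel symbols `Γ^m_{ij} = ½ g^{ml} (∂_i g_{jl} + ∂_j g_{il} - ∂_l g_{ij})`
at `x` of the Levi-Civita connection of `g`, in the chart around `x`. -/
def christoffel (g : M → LinearMap.BilinForm ℝ E7) (x : M) (m i j : Fin 7) : ℝ :=
  let y : E7 := chartAt E7 x x
  (1 / 2 : ℝ) * ∑ l, (Matrix.of fun a b => localMetric g x y a b)⁻¹ m l *
    (partialD (fun z => localMetric g x z j l) y i + partialD (fun z => localMetric g x z i l) y j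
      - partialD (fun z => localMetric g x z i j) y l)

/-- The components `(∇_i α)_{j₁…j_k} = ∂_i α_{j₁…j_k} - ∑ₐ Γ^m_{i jₐ} α_{j₁…m…j_k}` at `x` of the
covariant derivative of a `k`-form with respect to the Levi-Civita connection of `g`, in the chart
around `x`. -/
def covDeriv (g : M → LinearMap.BilinForm ℝ E7) {k : ℕ} (α : DiffForm M k) (x : M)
    (i : Fin 7) (J : Fin k → Fin 7) : ℝ :=
  let y : E7 := chartAt E7 x x
  partialD (fun z => localForm α x z (fun a => stdVec (J a))) y i
    - ∑ a, ∑ m, christoffel g x m i (J a) *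
        localForm α x y (fun b => stdVec (Function.update J a m b))

/-! ## `G₂` structures -/

/-- A `G₂` structure: a smooth `3`-form which is positive at each point. -/
structure IsG2Structure (φ : DiffForm M 3) : Prop where
  smooth : IsSmoothForm φ
  positive : ∀ x, IsPositive (φ x)

/-- The Hodge star `*_φ` on differential forms. -/
def starF (φ : DiffForm M 3) {k l : ℕ} (h : k + l = 7) (α : DiffForm M k) : DiffForm M l :=
  fun x => hodgeStar (φ x) h (α x)

/-- The `4`-form `ψ = *_φ φ`. -/
def psi (φ : DiffForm M 3) : DiffForm M 4 := starF φ (by norm_num) φ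

/-- The codifferential `d* = (-1)ᵏ *_φ d *_φ` on `k`-forms, `k = m + 1`, in dimension `7`. -/
def codiff (φ : DiffForm M 3) {m l : ℕ} (h : m + 1 + l = 7) (α : DiffForm M (m + 1)) :
    DiffForm M m :=
  ((-1 : ℝ) ^ (m + 1)) • starF φ (k := l + 1) (l := m) (by omega) (extd (starF φ h α))

/-- The Hodge Laplacian `Δ_φ φ = d d* φ + d* d φ`. -/
def hodgeLaplacian (φ : DiffForm M 3) : DiffForm M 3 :=
  extd (codiff φ (m := 2) (l := 4) (by norm_num) φ)
    + codiff φ (m := 3) (l := 3) (by norm_num) (extd φ)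

/-- `φ` is torsion-free if `∇φ = 0` for the Levi-Civita connection of the metric of `φ`. -/
def IsTorsionFree (φ : DiffForm M 3) : Prop :=
  ∀ (x : M) (i : Fin 7) (J : Fin 3 → Fin 7), covDeriv (fun y => metric (φ y)) φ x i J = 0

/-- `τ` is the intrinsic torsion form of the closed `G₂` structure `φ`:
`τ ∈ Ω²₁₄`, i.e. `τ ∧ φ = -*_φ τ`, and `dψ = τ ∧ φ`. -/
structure IsTorsionForm (φ : DiffForm M 3) (τ : DiffForm M 2) : Prop where
  smooth : IsSmoothForm τ
  mem : ∀ x, wedge (τ x) (φ x) = -hodgeStar (φ x) (l := 5) (by norm_num) (τ x)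
  eq : ∀ x, extd (psi φ) x = wedge (τ x) (φ x)

/-- `(φ, X, c)` is a Laplacian soliton: `φ` is a closed `G₂` structure, `X` is a smooth vector
field and `Δ_φ φ = c φ + L_X φ`. -/
structure IsLaplacianSoliton [IsManifold (𝓡 7) ∞ M] (φ : DiffForm M 3) (X : VField M) (c : ℝ) : Prop where
  isG2 : IsG2Structure φ
  closed : extd φ = 0
  smooth : IsSmoothVField X
  eq : hodgeLaplacian φ = c • φ + lieDeriv X φ

/-- `Φ` solves the Laplacian flow `∂φ/∂t = Δ_φ φ`, `dφ = 0`, for times in `s`. -/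
structure IsLaplacianFlow (Φ : ℝ → DiffForm M 3) (s : Set ℝ) : Prop where
  isG2 : ∀ t ∈ s, IsG2Structure (Φ t)
  closed : ∀ t ∈ s, extd (Φ t) = 0
  eq : ∀ t ∈ s, ∀ x, HasDerivWithinAt (fun r => Φ r x) (hodgeLaplacian (Φ t) x) s t

/-- `φ` is a stationary point of the Laplacian flow: the constant family `φ` solves it. -/
def IsStationary (φ : DiffForm M 3) : Prop :=
  IsLaplacianFlow (fun _ => φ) (Set.Ici 0)

end Manifold

end

end G2

/-! ### Wedge products and the coordinate forms `eform`. -/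

open scoped Manifold ContDiff

namespace G2

noncomputable section

/-! The first half of the proof is pointwise: it writes everything in a frame adapted to `φ`. The
`GL(7)`-orbit of `phi0` is open, so in a chart a smooth positive 3-form is locally `u^* phi0` for a
smooth field `u` of linear isomorphisms (`exists_local_frame`). Exterior derivatives depend on the
derivative of `u` only through a connection matrix, and only modulo symmetric bilinear maps
(`torD_eq_of_symm`). Modulo these it can be made `so(7)`-valued (`exists_skew_add_symm`).

The stabiliser algebra `g₂` kills `phi0` and `psi0`, so a skew endomorphism acts on both only
through its contraction with `phi0` (`act_phi0_of_skew`, `act_psi0_of_skew`). Hence `dφ` and `dψ`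
are linear in one 7×7 torsion matrix `T`. If `dφ = 0`, then `T` is skew and lies in `Λ²₁₄`
(`skew_of_dphi`, `torsion_of_closed`). In that case `dψ = T ∧ φ = -*T`, so `T = -*dψ = d*φ` is the
torsion form and the only possible one.

For `X = 0` the soliton equation becomes `dτ = λφ`. Contract it with `φ`. In the frame the
derivative of `τ` has two parts. The componentwise derivative stays in `Λ²₁₄`, which is the kernel
of contraction with `phi0`, so it contributes nothing. The action of the connection matrix
contributes `|τ|²`. This gives `7λ = |τ|²` (`torForm_norm`, `formInner_thetaL`).

Consequently `λ = 0` iff `τ = 0` iff `dφ = dψ = 0`. This is equivalent to `∇φ = 0` by the theorem of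
Fernández and Gray (`parallel_iff`): the Levi-Civita connection matrix is itself a skew
representative, so the same `T` decides both conditions. Stationary points are the case `λ = 0`.

On a compact manifold suppose `λ ≠ 0`. Then `τ` vanishes nowhere, hence neither does `τ ∧ τ ∧ φ =
-|τ|² vol`. But `d(τ³) = 3 τ² ∧ dτ = 3λ τ ∧ τ ∧ φ` is exact, against Stokes. Stokes is proved in the
form needed: `τ³` becomes a vector field twisted by `Λ⁷` (`cubeVec`), the sign of `τ ∧ τ ∧ φ` serves
as orientation, and a partition of unity with the change of variables formula gives the divergence
theorem (`IsDivergenceOf.eq_zero`). -/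

theorem tensor_apply {k l : ℕ} (α : AltForm k) (β : AltForm l) (v : Fin (k + l) → E7) :
    tensor α β v = α (fun i => v (Fin.castAdd l i)) * β (fun j => v (Fin.natAdd k j)) := by
  change ((LinearMap.mul' ℝ ℝ).compMultilinearMap
      (MultilinearMap.domCoprod α.toMultilinearMap β.toMultilinearMap)).domDomCongr
        finSumFinEquiv v = _
  simp [MultilinearMap.domCoprod]

theorem wedge_apply {k l : ℕ} (α : AltForm k) (β : AltForm l) (v : Fin (k + l) → E7) :
    wedge α β v = ((k.factorial : ℝ) * (l.factorial : ℝ))⁻¹ *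
      ∑ σ : Equiv.Perm (Fin (k + l)), ((Equiv.Perm.sign σ : ℤ) : ℝ) *
        (α (fun i => v (σ (Fin.castAdd l i))) * β (fun j => v (σ (Fin.natAdd k j)))) := by
  simp only [wedge, ContinuousAlternatingMap.smul_apply, smul_eq_mul,
    ContinuousMultilinearMap.alternatization_apply_apply]
  congr 1
  refine Finset.sum_congr rfl fun σ _ => ?_
  rw [tensor_apply, Units.smul_def, zsmul_eq_mul]
  rfl

theorem wedge_add_left {k l : ℕ} (α α' : AltForm k) (β : AltForm l) :
    wedge (α + α') β = wedge α β + wedge α' β := by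
  ext v
  simp [wedge_apply, add_mul, mul_add, Finset.sum_add_distrib]

theorem wedge_add_right {k l : ℕ} (α : AltForm k) (β β' : AltForm l) :
    wedge α (β + β') = wedge α β + wedge α β' := by
  ext v
  simp [wedge_apply, mul_add, Finset.sum_add_distrib]

theorem wedge_smul_left {k l : ℕ} (c : ℝ) (α : AltForm k) (β : AltForm l) :
    wedge (c • α) β = c • wedge α β := by
  ext v
  simp only [wedge_apply, ContinuousAlternatingMap.smul_apply, smul_eq_mul, Finset.mul_sum]
  exact Finset.sum_congr rfl fun σ _ => by ring

theorem wedge_smul_right {k l : ℕ} (c : ℝ) (α : AltForm k) (β : AltForm l) :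
    wedge α (c • β) = c • wedge α β := by
  ext v
  simp only [wedge_apply, ContinuousAlternatingMap.smul_apply, smul_eq_mul, Finset.mul_sum]
  exact Finset.sum_congr rfl fun σ _ => by ring

/-- The wedge product as a bilinear map. -/
def wedgeB (k l : ℕ) : AltForm k →ₗ[ℝ] AltForm l →ₗ[ℝ] AltForm (k + l) :=
  LinearMap.mk₂ ℝ wedge wedge_add_left wedge_smul_left wedge_add_right wedge_smul_right

@[simp] theorem wedgeB_apply {k l : ℕ} (α : AltForm k) (β : AltForm l) :
    wedgeB k l α β = wedge α β := rfl

theorem wedge_comp {k l : ℕ} (α : AltForm k) (β : AltForm l) (u : E7 →L[ℝ] E7) :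
    wedge (α.compContinuousLinearMap u) (β.compContinuousLinearMap u) =
      (wedge α β).compContinuousLinearMap u := by
  ext v
  simp only [wedge_apply, ContinuousAlternatingMap.compContinuousLinearMap_apply]
  rfl

theorem intProd_comp {k : ℕ} (w : E7) (α : AltForm (k + 1)) (u : E7 →L[ℝ] E7) :
    intProd w (α.compContinuousLinearMap u) =
      (intProd (u w) α).compContinuousLinearMap u := by
  ext v
  simp only [intProd, ContinuousAlternatingMap.curryLeft_apply_apply,
    ContinuousAlternatingMap.compContinuousLinearMap_apply]
  congr 1
  ext i
  refine Fin.cases ?_ (fun j => ?_) i <;> simp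

/-- The coordinate form `e^{I₀} ∧ ⋯ ∧ e^{I_{k-1}}`. -/
def eform {k : ℕ} (I : Fin k → Fin 7) : AltForm k :=
  ContinuousMultilinearMap.alternatization
    (ContinuousMultilinearMap.mkPiAlgebra ℝ (Fin k) ℝ |>.compContinuousLinearMap
      fun a => (EuclideanSpace.proj (I a) : E7 →L[ℝ] ℝ))

theorem eform_apply {k : ℕ} (I : Fin k → Fin 7) (v : Fin k → E7) :
    eform I v = ∑ σ : Equiv.Perm (Fin k), ((Equiv.Perm.sign σ : ℤ) : ℝ) *
      ∏ a, v (σ a) (I a) := by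
  simp only [eform, ContinuousMultilinearMap.alternatization_apply_apply]
  refine Finset.sum_congr rfl fun σ _ => ?_
  rw [Units.smul_def, zsmul_eq_mul]
  simp

theorem eform_eq_det {k : ℕ} (I : Fin k → Fin 7) (v : Fin k → E7) :
    eform I v = (Matrix.of fun a b => v a (I b)).det := by
  rw [eform_apply, Matrix.det_apply']
  rfl

theorem sum_mul_sum_mul_sum {ι κ ν : Type*} [Fintype ι] [Fintype κ] [Fintype ν]
    (s : ι → ℝ) (f : ι → κ → ℝ) (g : ι → ν → ℝ) :
    ∑ i, s i * ((∑ j, f i j) * ∑ k, g i k) = ∑ j, ∑ k, ∑ i, s i * (f i j * g i k) := by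
  calc _ = ∑ i, ∑ j, ∑ k, s i * (f i j * g i k) := by
        refine Finset.sum_congr rfl fun i _ => ?_
        rw [Finset.sum_mul_sum, Finset.mul_sum]
        exact Finset.sum_congr rfl fun j _ => Finset.mul_sum _ _ _
    _ = _ := by
        rw [Finset.sum_comm]
        exact Finset.sum_congr rfl fun j _ => Finset.sum_comm

/-- For fixed permutations of the two blocks, right translation by the resulting block permutation
absorbs them together with their signs. Every one of the `k! l!` pairs therefore contributes the
same determinant, which cancels the normalisation of `wedge`. -/
theorem wedge_eform {k l : ℕ} (I : Fin k → Fin 7) (J : Fin l → Fin 7) :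
    wedge (eform I) (eform J) = eform (Fin.append I J) := by
  ext v
  rw [wedge_apply]
  simp only [eform_apply]
  set p : Equiv.Perm (Fin k) → Equiv.Perm (Fin l) → Equiv.Perm (Fin (k + l)) := fun ρ τ =>
    finSumFinEquiv.permCongr (Equiv.Perm.sumCongr ρ τ) with hp
  have hps : ∀ ρ τ, Equiv.Perm.sign (p ρ τ) = Equiv.Perm.sign ρ * Equiv.Perm.sign τ := by
    intro ρ τ
    simp [hp]
  have hp1 : ∀ ρ τ i, p ρ τ (Fin.castAdd l i) = Fin.castAdd l (ρ i) := by
    intro ρ τ i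
    simp [hp, Equiv.permCongr_apply]
  have hp2 : ∀ ρ τ i, p ρ τ (Fin.natAdd k i) = Fin.natAdd k (τ i) := by
    intro ρ τ i
    simp [hp, Equiv.permCongr_apply]
  have key : ∀ ρ τ, ∑ σ : Equiv.Perm (Fin (k + l)), ((Equiv.Perm.sign σ : ℤ) : ℝ) *
      ((((Equiv.Perm.sign ρ : ℤ) : ℝ) * ∏ a, v (σ (Fin.castAdd l (ρ a))) (I a)) *
        (((Equiv.Perm.sign τ : ℤ) : ℝ) * ∏ a, v (σ (Fin.natAdd k (τ a))) (J a))) =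
      ∑ σ : Equiv.Perm (Fin (k + l)), ((Equiv.Perm.sign σ : ℤ) : ℝ) *
        ∏ a, v (σ a) (Fin.append I J a) := by
    intro ρ τ
    rw [← Equiv.sum_comp (Equiv.mulRight (p ρ τ)) (fun σ => ((Equiv.Perm.sign σ : ℤ) : ℝ) *
        ∏ a, v (σ a) (Fin.append I J a))]
    refine Finset.sum_congr rfl fun σ _ => ?_
    simp only [Equiv.coe_mulRight, Equiv.Perm.sign_mul, hps, Fin.prod_univ_add,
      Equiv.Perm.mul_apply, hp1, hp2, Fin.append_left, Fin.append_right]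
    push_cast
    ring
  have h2 : ∑ σ : Equiv.Perm (Fin (k + l)), ((Equiv.Perm.sign σ : ℤ) : ℝ) *
      ((∑ ρ : Equiv.Perm (Fin k), ((Equiv.Perm.sign ρ : ℤ) : ℝ) *
          ∏ a, v (σ (Fin.castAdd l (ρ a))) (I a)) *
        (∑ τ : Equiv.Perm (Fin l), ((Equiv.Perm.sign τ : ℤ) : ℝ) *
          ∏ a, v (σ (Fin.natAdd k (τ a))) (J a))) =
      ∑ ρ : Equiv.Perm (Fin k), ∑ τ : Equiv.Perm (Fin l),
      ∑ σ : Equiv.Perm (Fin (k + l)), ((Equiv.Perm.sign σ : ℤ) : ℝ) *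
        ∏ a, v (σ a) (Fin.append I J a) := by
    rw [sum_mul_sum_mul_sum]
    exact Finset.sum_congr rfl fun ρ _ => Finset.sum_congr rfl fun τ _ => key ρ τ
  rw [h2]
  simp only [Finset.sum_const, Finset.card_univ, Fintype.card_perm, Fintype.card_fin,
    nsmul_eq_mul]
  have h1 : (k.factorial : ℝ) ≠ 0 := by exact_mod_cast k.factorial_ne_zero
  have h3 : (l.factorial : ℝ) ≠ 0 := by exact_mod_cast l.factorial_ne_zero
  field_simp

@[simp] theorem stdVec_apply (i j : Fin 7) : stdVec i j = if j = i then 1 else 0 := by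
  simp [stdVec]

theorem stdCovec_eq (i : Fin 7) : stdCovec i = eform ![i] := by
  ext v
  simp [stdCovec, eform_eq_det, EuclideanSpace.proj]

theorem stdTriple_eq (i j k : Fin 7) : stdTriple i j k = eform ![i, j, k] := by
  rw [stdTriple, stdCovec_eq, stdCovec_eq, stdCovec_eq, wedge_eform, wedge_eform]
  congr 1
  funext a
  fin_cases a <;> rfl

theorem eform_std {k : ℕ} (I J : Fin k → Fin 7) :
    eform I (fun a => stdVec (J a)) =
      (Matrix.of fun a b => if I b = J a then (1 : ℝ) else 0).det := by
  rw [eform_eq_det]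
  simp

/-- A form is determined by its values on increasing tuples of basis vectors. -/
theorem altForm_ext {k : ℕ} {α β : AltForm k}
    (h : ∀ I : Fin k → Fin 7, StrictMono I →
      α (fun a => stdVec (I a)) = β (fun a => stdVec (I a))) : α = β := by
  have hb : α.toAlternatingMap = β.toAlternatingMap := by
    refine Module.Basis.ext_alternating (EuclideanSpace.basisFun (Fin 7) ℝ).toBasis fun I hI => ?_
    have h1 : StrictMono (I ∘ Tuple.sort I) :=
      (Tuple.monotone_sort I).strictMono_of_injective (hI.comp (Tuple.sort I).injective)
    have h2 := h _ h1
    have h3 : ∀ γ : AltForm k, γ (fun a => stdVec ((I ∘ Tuple.sort I) a)) =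
        Equiv.Perm.sign (Tuple.sort I) • γ (fun a => stdVec (I a)) := by
      intro γ
      exact γ.toAlternatingMap.map_perm (fun a => stdVec (I a)) (Tuple.sort I)
    rw [h3, h3] at h2
    have h4 := smul_left_cancel _ h2
    simpa [stdVec] using h4
  exact ContinuousAlternatingMap.toAlternatingMap_injective hb

/-- Increasing tuples with the same range are equal. If the ranges differ, some row of the Kronecker
matrix is zero. -/
theorem eform_strictMono {k : ℕ} {I J : Fin k → Fin 7} (hI : StrictMono I) (hJ : StrictMono J) :
    eform I (fun a => stdVec (J a)) = if I = J then 1 else 0 := by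
  rw [eform_std]
  split_ifs with h
  · subst h
    have : (Matrix.of fun a b => if I b = I a then (1 : ℝ) else 0) = 1 := by
      ext a b
      simp [Matrix.one_apply, hI.injective.eq_iff, eq_comm]
    rw [this, Matrix.det_one]
  · have : ∃ a, J a ∉ Set.range I := by
      by_contra hc
      push Not at hc
      apply h
      have h1 : Set.range J ⊆ Set.range I := by
        rintro _ ⟨a, rfl⟩
        exact hc a
      have h2 : Set.range J = Set.range I := by
        refine Set.eq_of_subset_of_ncard_le h1 ?_
        rw [Set.ncard_range_of_injective hI.injective, Set.ncard_range_of_injective hJ.injective]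
      exact (hI.range_inj hJ).1 h2.symm
    obtain ⟨a, ha⟩ := this
    refine Matrix.det_eq_zero_of_row_eq_zero a fun b => ?_
    simp only [Matrix.of_apply, ite_eq_right_iff, one_ne_zero, imp_false]
    intro hb
    exact ha ⟨b, hb⟩

open Classical in
theorem altForm_eq_sum {k : ℕ} (α : AltForm k) :
    α = ∑ I : Fin k → Fin 7 with StrictMono I, α (fun a => stdVec (I a)) • eform I := by
  refine altForm_ext fun J hJ => ?_
  rw [ContinuousAlternatingMap.sum_apply]
  rw [Finset.sum_eq_single_of_mem J (by simp [hJ])]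
  · simp [eform_strictMono hJ hJ]
  · intro I hI hne
    simp only [Finset.mem_filter, Finset.mem_univ, true_and] at hI
    simp [eform_strictMono hI hJ, hne]

theorem eform_two (i j : Fin 7) (x y : E7) : eform ![i, j] ![x, y] = x i * y j - x j * y i := by
  rw [eform_eq_det, Matrix.det_fin_two]
  simp

/-- The sum runs over all pairs, hence the factor `1/2`, so that it matches the unrestricted index
contractions used below. -/
theorem twoForm_eq_sum (τ : AltForm 2) :
    τ = (1 / 2 : ℝ) • ∑ i, ∑ j, τ ![stdVec i, stdVec j] • eform ![i, j] := by
  refine altForm_ext fun J _ => ?_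
  have h0 : (fun a => stdVec (J a)) = ![stdVec (J 0), stdVec (J 1)] := by
    funext a
    fin_cases a <;> rfl
  have hs : τ ![stdVec (J 1), stdVec (J 0)] = - τ ![stdVec (J 0), stdVec (J 1)] := by
    have := τ.toAlternatingMap.map_swap ![stdVec (J 0), stdVec (J 1)] (i := 0) (j := 1) (by simp)
    rw [← ContinuousAlternatingMap.coe_toAlternatingMap, ← this]
    congr 1
    funext a
    fin_cases a <;> rfl
  simp only [ContinuousAlternatingMap.smul_apply, ContinuousAlternatingMap.sum_apply, h0,
    eform_two, stdVec_apply, smul_eq_mul, mul_sub, Finset.sum_sub_distrib]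
  simp only [mul_ite, mul_one, mul_zero, Finset.sum_ite_eq',
    Finset.mem_univ, if_true, Finset.sum_ite_irrel, Finset.sum_const_zero]
  rw [hs]
  ring

end

end G2

/-! ### Integer components of `phi0`, its dual and the volume form, with their contraction
identities. -/

namespace G2

/-- The multiplication table of the cross product of `ℝ⁷`: `e_i × e_j = ± e_k` is coded as
`± (k + 1)`. -/
def crossTable : List (List ℤ) :=
  [[0, 3, -2, 5, -4, 7, -6], [-3, 0, 1, 6, -7, -4, 5], [2, -1, 0, -7, -6, 5, 4],
   [-5, -6, 7, 0, 1, 2, -3], [4, 7, 6, -1, 0, -3, -2], [-7, 4, -5, -2, 3, 0, 1],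
   [6, -5, -4, 3, 2, -1, 0]]

/-- The code of `e_i × e_j`. -/
def crossCode (i j : Fin 7) : ℤ := (crossTable.getD i []).getD j 0

/-- The components of `phi0`. -/
def phiI (i j k : Fin 7) : ℤ :=
  if crossCode i j = (k : ℤ) + 1 then 1 else if crossCode i j = -((k : ℤ) + 1) then -1 else 0

/-- The Kronecker symbol. -/
def dl (i j : Fin 7) : ℤ := if i = j then 1 else 0

/-- The components of the `4`-form dual to `phi0`. -/
def psiI (i j k l : Fin 7) : ℤ :=
  (if crossCode i j = 0 then 0 else if crossCode i j = crossCode k l then 1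
    else if crossCode i j = -crossCode k l then -1 else 0) - dl i k * dl j l + dl i l * dl j k

/-- The sign of `j - i`. -/
def cmpI (i j : Fin 7) : ℤ := if i < j then 1 else if j < i then -1 else 0

/-- The Levi-Civita symbol. -/
def epsI (a b c d e f g : Fin 7) : ℤ :=
  if a = e ∨ a = f ∨ a = g ∨ b = e ∨ b = f ∨ b = g ∨ c = e ∨ c = f ∨ c = g then 0 else
  if d = e ∨ d = f ∨ d = g ∨ a = b ∨ a = c ∨ a = d ∨ b = c ∨ b = d ∨ c = d then 0 else
  cmpI a b * (cmpI a c * cmpI b c) * (cmpI a d * cmpI b d * cmpI c d) *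
  (cmpI a e * cmpI b e * cmpI c e * cmpI d e) *
  (cmpI a f * cmpI b f * cmpI c f * cmpI d f * cmpI e f) *
  (cmpI a g * cmpI b g * cmpI c g * cmpI d g * cmpI e g * cmpI f g)

theorem cmpI_self (a : Fin 7) : cmpI a a = 0 := by simp [cmpI]

/-- The tests for repeated indices in `epsI` only shorten its evaluation: the product of signs
already vanishes there. -/
theorem epsI_eq (a b c d e f g : Fin 7) : epsI a b c d e f g =
    cmpI a b * (cmpI a c * cmpI b c) * (cmpI a d * cmpI b d * cmpI c d) *
    (cmpI a e * cmpI b e * cmpI c e * cmpI d e) *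
    (cmpI a f * cmpI b f * cmpI c f * cmpI d f * cmpI e f) *
    (cmpI a g * cmpI b g * cmpI c g * cmpI d g * cmpI e g * cmpI f g) := by
  rw [epsI]
  split_ifs with h1 h2
  · rcases h1 with h | h | h | h | h | h | h | h | h <;> subst h <;> simp [cmpI_self]
  · rcases h2 with h | h | h | h | h | h | h | h | h <;> subst h <;> simp [cmpI_self]
  · rfl

theorem phiI_swap₁ : ∀ i j k, phiI j i k = -phiI i j k := by decide +kernel
theorem phiI_swap₂ : ∀ i j k, phiI i k j = -phiI i j k := by decide +kernel
theorem psiI_swap₁ : ∀ i j k l, psiI j i k l = -psiI i j k l := by decide +kernel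
theorem psiI_swap₂ : ∀ i j k l, psiI i k j l = -psiI i j k l := by decide +kernel
theorem psiI_swap₃ : ∀ i j k l, psiI i j l k = -psiI i j k l := by decide +kernel

/-- The basic identity `φ_{ijk} φ_{lmk} = δ_{il} δ_{jm} - δ_{im} δ_{jl} + ψ_{ijlm}` of the
octonionic cross product. It and its companions are finite checks. -/
theorem phiI_contract : ∀ i j l m, ∑ k, phiI i j k * phiI l m k =
    dl i l * dl j m - dl i m * dl j l + psiI i j l m := by decide +kernel

theorem phiI_contract₂ : ∀ i l, ∑ j, ∑ k, phiI i j k * phiI l j k = 6 * dl i l := by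
  decide +kernel

theorem psiI_phiI_contract₂ : ∀ k l b, ∑ i, ∑ j, psiI k l i j * phiI b i j = 4 * phiI k l b := by
  decide +kernel

/-- The right-hand side is, up to sign, the rotation in the `ab`-plane acting on `φ`. Contracting
with a skew matrix therefore gives its action on `phi0`. Increasing `j, k, l` suffice because
alternating forms are compared. -/
theorem phiI_psiI_contract : ∀ j k, j < k → ∀ l, k < l → ∀ a b, ∑ q, phiI a b q * psiI q j k l =
    dl a j * phiI b k l + dl a k * phiI j b l + dl a l * phiI j k b -
      (dl b j * phiI a k l + dl b k * phiI j a l + dl b l * phiI j k a) := by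
  decide +kernel

/-- Inserting the seven monomials of `phi0` into the Levi-Civita symbol produces the dual 4-form.
The block of three may stand last, first or in the middle (`sum_epsI'`, `sum_epsI''`) without a
sign, since it always moves past an even number of indices. -/
theorem sum_epsI : ∀ k l i j, epsI k l i j 0 1 2 + epsI k l i j 0 3 4 + epsI k l i j 0 5 6 +
    epsI k l i j 1 3 5 - epsI k l i j 1 4 6 - epsI k l i j 2 3 6 - epsI k l i j 2 4 5 =
      psiI k l i j := by
  decide +kernel

theorem sum_epsI' : ∀ k l i j, epsI 0 1 2 k l i j + epsI 0 3 4 k l i j + epsI 0 5 6 k l i j +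
    epsI 1 3 5 k l i j - epsI 1 4 6 k l i j - epsI 2 3 6 k l i j - epsI 2 4 5 k l i j =
      psiI k l i j := by
  decide +kernel

/-- The components of `e^a ∧ e^b ∧ e^c`. -/
def triI (a b c i j k : Fin 7) : ℤ :=
  dl a i * dl b j * dl c k - dl a i * dl c j * dl b k - dl b i * dl a j * dl c k
    + dl b i * dl c j * dl a k + dl c i * dl a j * dl b k - dl c i * dl b j * dl a k

/-- Reconciles the multiplication table behind `phiI` with the seven explicit monomials of `phi0`.
-/
theorem sum_triI : ∀ i j k, triI 0 1 2 i j k + triI 0 3 4 i j k + triI 0 5 6 i j k +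
    triI 1 3 5 i j k - triI 1 4 6 i j k - triI 2 3 6 i j k - triI 2 4 5 i j k = phiI i j k := by
  decide +kernel

/-- `36` times the matrix `A` with `A · phi0 = e^a ∧ e^b ∧ e^c`. -/
def liftI (a b c m j : Fin 7) : ℤ :=
  6 * (dl m a * phiI j b c + dl m b * phiI j c a + dl m c * phiI j a b) +
  12 * (dl j a * phiI m b c + dl j b * phiI m c a + dl j c * phiI m a b) -
  6 * phiI a b c * dl m j

/-- Since the `GL(7)`-orbit of `phi0` is open, `gl(7)` acting on `phi0` reaches every 3-form. An
equivariant right inverse can be sought among the expressions in `δ` and `φ` that make up `liftI`;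
the coefficients 6, 12, -6 over 36 make the identity hold. -/
theorem liftI_act : ∀ a b, a < b → ∀ c, b < c → ∀ j k, j < k → ∀ l, k < l →
    ∑ m, (liftI a b c m j * phiI m k l + liftI a b c m k * phiI j m l +
      liftI a b c m l * phiI j k m) = 36 * triI a b c j k l := by
  decide +kernel

end G2

/-! ### The standard volume form, components of `phi0`, and the coefficient of `a ∧ b ∧ χ`. -/

namespace G2

noncomputable section

/-- Choosing from this existence statement makes `vol0` opaque: it is known through `vol0_eq` alone
and its determinant is never unfolded. `wedge223`, `star0` and `psi0` are introduced in the same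
way. -/
theorem exists_eq_eform_id : ∃ ν : AltForm 7, ν = eform id := ⟨_, rfl⟩

/-- The standard volume form `e¹²³⁴⁵⁶⁷`. -/
def vol0 : AltForm 7 := exists_eq_eform_id.choose

theorem vol0_eq : vol0 = eform id := exists_eq_eform_id.choose_spec

/-- The standard metric. -/
def g0 : LinearMap.BilinForm ℝ E7 := innerₗ E7

theorem g0_apply (u v : E7) : g0 u v = ∑ i, u i * v i := by
  simp [g0, PiLp.inner_apply, mul_comm]

theorem sum_stdVec (x : E7) : ∑ m, x m • stdVec m = x := by
  ext i
  simp

theorem map_update_eq_sum {k : ℕ} (α : AltForm k) (v : Fin k → E7) (a : Fin k) (x : E7) :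
    α (Function.update v a x) = ∑ m, x m * α (Function.update v a (stdVec m)) := by
  conv_lhs => rw [← sum_stdVec x]
  have := α.toMultilinearMap.map_update_sum Finset.univ a (fun m => x m • stdVec m) v
  refine this.trans (Finset.sum_congr rfl fun m _ => ?_)
  exact α.toMultilinearMap.map_update_smul _ _ _ _

section vec

theorem two_left (α : AltForm 2) (x y : E7) :
    α ![x, y] = ∑ m, x m * α ![stdVec m, y] := by
  have h : ∀ t, Function.update ![x, y] 0 t = ![t, y] := fun t => by
    funext a; fin_cases a <;> rfl
  simpa only [h] using map_update_eq_sum α ![x, y] 0 x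

theorem two_right (α : AltForm 2) (x y : E7) :
    α ![x, y] = ∑ m, y m * α ![x, stdVec m] := by
  have h : ∀ t, Function.update ![x, y] 1 t = ![x, t] := fun t => by
    funext a; fin_cases a <;> rfl
  simpa only [h] using map_update_eq_sum α ![x, y] 1 y

theorem three_zero (α : AltForm 3) (x y z : E7) :
    α ![x, y, z] = ∑ m, x m * α ![stdVec m, y, z] := by
  have h : ∀ t, Function.update ![x, y, z] 0 t = ![t, y, z] := fun t => by
    funext a; fin_cases a <;> rfl
  simpa only [h] using map_update_eq_sum α ![x, y, z] 0 x

theorem three_one (α : AltForm 3) (x y z : E7) :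
    α ![x, y, z] = ∑ m, y m * α ![x, stdVec m, z] := by
  have h : ∀ t, Function.update ![x, y, z] 1 t = ![x, t, z] := fun t => by
    funext a; fin_cases a <;> rfl
  simpa only [h] using map_update_eq_sum α ![x, y, z] 1 y

theorem three_two (α : AltForm 3) (x y z : E7) :
    α ![x, y, z] = ∑ m, z m * α ![x, y, stdVec m] := by
  have h : ∀ t, Function.update ![x, y, z] 2 t = ![x, y, t] := fun t => by
    funext a; fin_cases a <;> rfl
  simpa only [h] using map_update_eq_sum α ![x, y, z] 2 z

theorem four_zero (α : AltForm 4) (x y z w : E7) :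
    α ![x, y, z, w] = ∑ m, x m * α ![stdVec m, y, z, w] := by
  have h : ∀ t, Function.update ![x, y, z, w] 0 t = ![t, y, z, w] := fun t => by
    funext a; fin_cases a <;> rfl
  simpa only [h] using map_update_eq_sum α ![x, y, z, w] 0 x

theorem four_one (α : AltForm 4) (x y z w : E7) :
    α ![x, y, z, w] = ∑ m, y m * α ![x, stdVec m, z, w] := by
  have h : ∀ t, Function.update ![x, y, z, w] 1 t = ![x, t, z, w] := fun t => by
    funext a; fin_cases a <;> rfl
  simpa only [h] using map_update_eq_sum α ![x, y, z, w] 1 y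

theorem four_two (α : AltForm 4) (x y z w : E7) :
    α ![x, y, z, w] = ∑ m, z m * α ![x, y, stdVec m, w] := by
  have h : ∀ t, Function.update ![x, y, z, w] 2 t = ![x, y, t, w] := fun t => by
    funext a; fin_cases a <;> rfl
  simpa only [h] using map_update_eq_sum α ![x, y, z, w] 2 z

theorem four_three (α : AltForm 4) (x y z w : E7) :
    α ![x, y, z, w] = ∑ m, w m * α ![x, y, z, stdVec m] := by
  have h : ∀ t, Function.update ![x, y, z, w] 3 t = ![x, y, z, t] := fun t => by
    funext a; fin_cases a <;> rfl
  simpa only [h] using map_update_eq_sum α ![x, y, z, w] 3 w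

theorem two_swap (α : AltForm 2) (x y : E7) : α ![y, x] = -α ![x, y] := by
  have := α.toAlternatingMap.map_swap ![x, y] (i := 0) (j := 1) (by simp)
  rw [← ContinuousAlternatingMap.coe_toAlternatingMap, ← this]
  congr 1
  funext a
  fin_cases a <;> rfl

theorem vec_two {β : Type*} (f : Fin 7 → β) (J : Fin 2 → Fin 7) :
    (fun a => f (J a)) = ![f (J 0), f (J 1)] := by
  funext a; fin_cases a <;> rfl

theorem vec_three {β : Type*} (f : Fin 7 → β) (J : Fin 3 → Fin 7) :
    (fun a => f (J a)) = ![f (J 0), f (J 1), f (J 2)] := by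
  funext a; fin_cases a <;> rfl

theorem vec_four {β : Type*} (f : Fin 7 → β) (J : Fin 4 → Fin 7) :
    (fun a => f (J a)) = ![f (J 0), f (J 1), f (J 2), f (J 3)] := by
  funext a; fin_cases a <;> rfl

end vec

/-! ### Components of the model form -/

theorem eform_three_std (a b c i j k : Fin 7) :
    eform ![a, b, c] ![stdVec i, stdVec j, stdVec k] = triI a b c i j k := by
  rw [eform_eq_det, Matrix.det_fin_three]
  simp [triI, dl]

theorem phi0_std (i j k : Fin 7) : phi0 ![stdVec i, stdVec j, stdVec k] = phiI i j k := by
  simp only [phi0, stdTriple_eq, ContinuousAlternatingMap.add_apply,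
    ContinuousAlternatingMap.sub_apply, eform_three_std]
  rw [← sum_triI]
  push_cast
  ring

theorem det_delta_perm {n : ℕ} (σ : Equiv.Perm (Fin n)) :
    (Matrix.of fun a b => if σ a = b then (1 : ℝ) else 0).det = ((Equiv.Perm.sign σ : ℤ) : ℝ) := by
  have h : (Matrix.of fun a b => if σ a = b then (1 : ℝ) else 0) =
      (1 : Matrix (Fin n) (Fin n) ℝ).submatrix σ id := by
    ext a b
    simp [Matrix.one_apply]
  rw [h, Matrix.det_permute]
  simp

theorem vol0_perm (σ : Equiv.Perm (Fin 7)) :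
    vol0 (fun a => stdVec (σ a)) = ((Equiv.Perm.sign σ : ℤ) : ℝ) := by
  rw [vol0_eq, eform_std, ← det_delta_perm σ]
  simp only [id, eq_comm]

theorem vol0_self : vol0 stdVec = 1 := by
  have h1 : (fun a => stdVec ((1 : Equiv.Perm (Fin 7)) a)) = stdVec := rfl
  have h2 := (congrArg vol0 h1).symm.trans (vol0_perm 1)
  rw [h2, Equiv.Perm.sign_one, Units.val_one]
  exact Int.cast_one

theorem vol0_of_not_injective {I : Fin 7 → Fin 7} (h : ¬ Function.Injective I) :
    vol0 (fun a => stdVec (I a)) = 0 := by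
  simp only [Function.Injective, not_forall] at h
  obtain ⟨a, b, hab, hne⟩ := h
  exact vol0.map_eq_zero_of_eq _ (by simp [hab]) hne

theorem prod_cmpI_of_not_injective {I : Fin 7 → Fin 7} (h : ¬ Function.Injective I) :
    ∏ j, ∏ i ∈ Finset.Iio j, cmpI (I i) (I j) = 0 := by
  simp only [Function.Injective, not_forall] at h
  obtain ⟨a, b, hab, hne⟩ := h
  rcases lt_or_gt_of_ne hne with h1 | h1
  · refine Finset.prod_eq_zero (Finset.mem_univ b) (Finset.prod_eq_zero (i := a) (by simpa) ?_)
    simp [hab, cmpI_self]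
  · refine Finset.prod_eq_zero (Finset.mem_univ a) (Finset.prod_eq_zero (i := b) (by simpa) ?_)
    simp [hab, cmpI_self]

/-- The sign of a permutation is a product of signs over pairs, and both sides vanish when an index
repeats. -/
theorem vol0_eq_prod (I : Fin 7 → Fin 7) :
    vol0 (fun a => stdVec (I a)) = ((∏ j, ∏ i ∈ Finset.Iio j, cmpI (I i) (I j) : ℤ) : ℝ) := by
  by_cases h : Function.Injective I
  · obtain ⟨σ, rfl⟩ : ∃ σ : Equiv.Perm (Fin 7), I = σ :=
      ⟨Equiv.ofBijective I (Finite.injective_iff_bijective.1 h), rfl⟩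
    rw [vol0_perm, Equiv.Perm.sign_eq_prod_prod_Iio]
    push_cast
    refine Finset.prod_congr rfl fun j _ => Finset.prod_congr rfl fun i hi => ?_
    have hij : σ i ≠ σ j := fun hh => by
      have := σ.injective hh
      simp [this] at hi
    rw [cmpI]
    split_ifs with h1 h2 <;> simp
    omega
  · rw [vol0_of_not_injective h, prod_cmpI_of_not_injective h]
    simp

theorem prod_Iio_eq (f : Fin 7 → Fin 7 → ℤ) : ∏ j, ∏ i ∈ Finset.Iio j, f i j =
    f 0 1 * (f 0 2 * f 1 2) * (f 0 3 * f 1 3 * f 2 3) * (f 0 4 * f 1 4 * f 2 4 * f 3 4) *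
    (f 0 5 * f 1 5 * f 2 5 * f 3 5 * f 4 5) *
    (f 0 6 * f 1 6 * f 2 6 * f 3 6 * f 4 6 * f 5 6) := by
  have h0 : Finset.Iio (0 : Fin 7) = ∅ := by decide
  have h1 : Finset.Iio (1 : Fin 7) = {0} := by decide
  have h2 : Finset.Iio (2 : Fin 7) = {0, 1} := by decide
  have h3 : Finset.Iio (3 : Fin 7) = {0, 1, 2} := by decide
  have h4 : Finset.Iio (4 : Fin 7) = {0, 1, 2, 3} := by decide
  have h5 : Finset.Iio (5 : Fin 7) = {0, 1, 2, 3, 4} := by decide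
  have h6 : Finset.Iio (6 : Fin 7) = {0, 1, 2, 3, 4, 5} := by decide
  rw [Fin.prod_univ_seven, h0, h1, h2, h3, h4, h5, h6]
  repeat rw [Finset.prod_insert (by decide)]
  simp only [Finset.prod_singleton, Finset.prod_empty]
  ring

theorem vol0_std (J : Fin 7 → Fin 7) :
    vol0 (fun i => stdVec (J i)) = epsI (J 0) (J 1) (J 2) (J 3) (J 4) (J 5) (J 6) := by
  rw [vol0_eq_prod, prod_Iio_eq, epsI_eq]

/-- Transposing the determinant exchanges the tuple of indices with the tuple of arguments. -/
theorem eform_seven_std (I : Fin 7 → Fin 7) :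
    eform I stdVec = vol0 (fun a => stdVec (I a)) := by
  rw [eform_eq_det, vol0_eq, eform_std, ← Matrix.det_transpose]
  congr 1
  ext a b
  simp [Matrix.transpose_apply, eq_comm]

theorem seven_ext {α β : AltForm 7} (h : α stdVec = β stdVec) : α = β := by
  refine altForm_ext fun I hI => ?_
  have hI' : Function.Bijective I := Finite.injective_iff_bijective.1 hI.injective
  have h3 : ∀ γ : AltForm 7, γ (fun a => stdVec (I a)) =
      Equiv.Perm.sign (Equiv.ofBijective I hI') • γ stdVec := by
    intro γ
    exact γ.toAlternatingMap.map_perm stdVec (Equiv.ofBijective I hI')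
  rw [h3, h3, h]

theorem seven_eq_smul (α : AltForm 7) : α = α stdVec • vol0 := by
  refine seven_ext ?_
  simp [vol0_self]

theorem seven_comp (α : AltForm 7) (u : E7 →L[ℝ] E7) :
    α.compContinuousLinearMap u = LinearMap.det (u : E7 →ₗ[ℝ] E7) • α := by
  have h := α.toAlternatingMap.map_linearDependent
  have h1 : ∀ v, α (fun i => u (v i)) = LinearMap.det (u : E7 →ₗ[ℝ] E7) * α v := by
    intro v
    have := (α.toAlternatingMap.eq_smul_basis_det (EuclideanSpace.basisFun (Fin 7) ℝ).toBasis)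
    have h2 : ∀ w, α w = α.toAlternatingMap (EuclideanSpace.basisFun (Fin 7) ℝ).toBasis *
        (EuclideanSpace.basisFun (Fin 7) ℝ).toBasis.det w := fun w => by
      conv_lhs => rw [← ContinuousAlternatingMap.coe_toAlternatingMap, this]
      simp
    rw [h2, h2 v]
    have h3 := Module.Basis.det_comp (EuclideanSpace.basisFun (Fin 7) ℝ).toBasis
      (u : E7 →ₗ[ℝ] E7) v
    have h4 : ((u : E7 →ₗ[ℝ] E7) ∘ v) = fun i => u (v i) := rfl
    rw [h4] at h3
    rw [h3]
    ring
  ext v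
  exact h1 v

theorem sum_comm_pairs {ι : Type*} [Fintype ι] (f : ι → ι → ι → ι → ℝ) :
    ∑ i, ∑ j, ∑ k, ∑ l, f i j k l = ∑ k, ∑ l, ∑ i, ∑ j, f i j k l := by
  calc _ = ∑ p : ι × ι, ∑ q : ι × ι, f p.1 p.2 q.1 q.2 := by simp [Fintype.sum_prod_type]
    _ = ∑ q : ι × ι, ∑ p : ι × ι, f p.1 p.2 q.1 q.2 := Finset.sum_comm
    _ = _ := by simp [Fintype.sum_prod_type]

/-- Evaluation of a top form on the standard basis. -/
def evalStd : AltForm 7 →ₗ[ℝ] ℝ where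
  toFun χ := χ stdVec
  map_add' _ _ := rfl
  map_smul' _ _ := rfl

theorem evalStd_apply (χ : AltForm 7) : evalStd χ = χ stdVec := rfl

theorem exists_wedge223 : ∃ W : AltForm 2 →ₗ[ℝ] AltForm 2 →ₗ[ℝ] AltForm 3 →ₗ[ℝ] ℝ,
    ∀ a b χ, W a b χ = (wedge (k := 4) (wedge a b) χ : AltForm 7) stdVec :=
  ⟨(wedgeB 2 2).compr₂ ((wedgeB 4 3).compr₂ evalStd : AltForm 4 →ₗ[ℝ] AltForm 3 →ₗ[ℝ] ℝ),
    fun a b χ => by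
      rw [LinearMap.compr₂_apply, LinearMap.compr₂_apply, evalStd_apply, wedgeB_apply, wedgeB_apply]⟩

/-- The coefficient of `a ∧ b ∧ χ`, for two `2`-forms and a `3`-form. -/
def wedge223 : AltForm 2 →ₗ[ℝ] AltForm 2 →ₗ[ℝ] AltForm 3 →ₗ[ℝ] ℝ := exists_wedge223.choose

theorem wedge223_apply (a b : AltForm 2) (χ : AltForm 3) :
    wedge223 a b χ = (wedge (k := 4) (wedge a b) χ : AltForm 7) stdVec :=
  exists_wedge223.choose_spec a b χ

theorem wedge223_of_eq_eform (a b : AltForm 2) (χ : AltForm 3) (J : Fin 7 → Fin 7)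
    (h : (wedge (k := 4) (wedge a b) χ : AltForm 7) = eform J) :
    wedge223 a b χ = epsI (J 0) (J 1) (J 2) (J 3) (J 4) (J 5) (J 6) := by
  rw [wedge223_apply, h, eform_seven_std, vol0_std]

theorem wedge_eform_four_three (I : Fin 4 → Fin 7) (K : Fin 3 → Fin 7) :
    (wedge (k := 4) (eform I) (eform K) : AltForm 7) = eform (Fin.append I K) :=
  wedge_eform I K

theorem wedge223_eform' (k l i j p q r : Fin 7) :
    ∃ J : Fin 7 → Fin 7, (J 0 = k ∧ J 1 = l ∧ J 2 = i ∧ J 3 = j ∧ J 4 = p ∧ J 5 = q ∧ J 6 = r) ∧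
     (wedge (k := 4) (wedge (eform ![k, l]) (eform ![i, j])) (eform ![p, q, r]) : AltForm 7) =
        eform J := by
  refine ⟨Fin.append (Fin.append ![k, l] ![i, j]) ![p, q, r],
    ⟨rfl, rfl, rfl, rfl, rfl, rfl, rfl⟩, ?_⟩
  rw [wedge_eform ![k, l] ![i, j]]
  exact wedge_eform_four_three _ _

theorem wedge223_eform (k l i j p q r : Fin 7) :
    wedge223 (eform ![k, l]) (eform ![i, j]) (eform ![p, q, r]) = epsI k l i j p q r := by
  obtain ⟨J, ⟨h0, h1, h2, h3, h4, h5, h6⟩, h⟩ := wedge223_eform' k l i j p q r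
  rw [wedge223_of_eq_eform _ _ _ J h, h0, h1, h2, h3, h4, h5, h6]

/-- Any linear functional of `phi0` reduces to seven monomials, to which the Levi-Civita identities
apply. -/
theorem linear_phi0 (L : AltForm 3 →ₗ[ℝ] ℝ) : L phi0 = L (eform ![0, 1, 2]) +
    L (eform ![0, 3, 4]) + L (eform ![0, 5, 6]) + L (eform ![1, 3, 5]) - L (eform ![1, 4, 6]) -
      L (eform ![2, 3, 6]) - L (eform ![2, 4, 5]) := by
  simp only [phi0, stdTriple_eq, map_add, map_sub]

theorem bilinear_eq_sum (B : AltForm 2 →ₗ[ℝ] AltForm 2 →ₗ[ℝ] ℝ) (a b : AltForm 2) :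
    B a b = (1 / 4 : ℝ) * ∑ k, ∑ l, ∑ i, ∑ j,
      a ![stdVec k, stdVec l] * b ![stdVec i, stdVec j] * B (eform ![k, l]) (eform ![i, j]) := by
  conv_lhs => rw [twoForm_eq_sum a, twoForm_eq_sum b]
  simp only [map_smul, map_sum, LinearMap.smul_apply, LinearMap.sum_apply, smul_eq_mul,
    Finset.mul_sum]
  rw [sum_comm_pairs]
  refine Finset.sum_congr rfl fun k _ => Finset.sum_congr rfl fun l _ =>
    Finset.sum_congr rfl fun i _ => Finset.sum_congr rfl fun j _ => ?_
  ring

theorem wedge223_eform_phi0 (k l i j : Fin 7) :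
    wedge223 (eform ![k, l]) (eform ![i, j]) phi0 = psiI k l i j := by
  rw [linear_phi0, wedge223_eform, wedge223_eform, wedge223_eform, wedge223_eform,
    wedge223_eform, wedge223_eform, wedge223_eform, ← sum_epsI, Int.cast_sub, Int.cast_sub,
    Int.cast_sub, Int.cast_add, Int.cast_add, Int.cast_add]

/-- The coefficient of `a ∧ b ∧ χ` as a bilinear form in `a`, `b`. -/
def wedge22 (χ : AltForm 3) : AltForm 2 →ₗ[ℝ] AltForm 2 →ₗ[ℝ] ℝ :=
  wedge223.compr₂ (LinearMap.applyₗ χ)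

theorem wedge22_apply (χ : AltForm 3) (a b : AltForm 2) : wedge22 χ a b = wedge223 a b χ := by
  rw [wedge22, LinearMap.compr₂_apply, LinearMap.applyₗ_apply_apply]

theorem wedge223_phi0 (a b : AltForm 2) : wedge223 a b phi0 = (1 / 4 : ℝ) * ∑ k, ∑ l, ∑ i, ∑ j,
      a ![stdVec k, stdVec l] * b ![stdVec i, stdVec j] * psiI k l i j := by
  rw [← wedge22_apply, bilinear_eq_sum]
  congr 1
  refine Finset.sum_congr rfl fun k _ => Finset.sum_congr rfl fun l _ =>
    Finset.sum_congr rfl fun i _ => Finset.sum_congr rfl fun j _ => ?_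
  rw [wedge22_apply, wedge223_eform_phi0]

theorem intProd_phi0_std (u : E7) (k l : Fin 7) :
    intProd u phi0 ![stdVec k, stdVec l] = ∑ m, u m * phiI m k l := by
  have : intProd u phi0 ![stdVec k, stdVec l] = phi0 ![u, stdVec k, stdVec l] := rfl
  rw [this, three_zero]
  simp only [phi0_std]

theorem psiI_phiI_contract_real (k l b : Fin 7) :
    ∑ i, ∑ j, (psiI k l i j : ℝ) * phiI b i j = 4 * phiI k l b := by
  exact_mod_cast psiI_phiI_contract₂ k l b

theorem phiI_contract₂_real (i l : Fin 7) :
    ∑ j, ∑ k, (phiI i j k : ℝ) * phiI l j k = 6 * dl i l := by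
  exact_mod_cast phiI_contract₂ i l

end

end G2

/-! ### The metric and volume form of a positive 3-form. -/

namespace G2

noncomputable section

theorem phiI_rot (i j k : Fin 7) : phiI j k i = phiI i j k := by
  rw [phiI_swap₂, phiI_swap₁, neg_neg]

theorem sum_comm_four {ι κ : Type*} [Fintype ι] [Fintype κ] (f : ι → ι → κ → ℝ) :
    ∑ i, ∑ j, ∑ k, f i j k = ∑ k, ∑ i, ∑ j, f i j k := by
  calc _ = ∑ i, ∑ k, ∑ j, f i j k := Finset.sum_congr rfl fun i _ => Finset.sum_comm
    _ = _ := Finset.sum_comm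

/-- The forms `v ⌟ phi0` make up `Λ²₇`, on which full contraction with `ψ` is multiplication by 4.
On `Λ²₁₄` it is multiplication by -2, see `IsLambda14.sum_psiI`. -/
theorem psi_intProd_phi0 (v : E7) (k l : Fin 7) :
    ∑ i, ∑ j, intProd v phi0 ![stdVec i, stdVec j] * psiI k l i j =
      4 * intProd v phi0 ![stdVec k, stdVec l] := by
  simp only [intProd_phi0_std, Finset.sum_mul]
  rw [sum_comm_four, Finset.mul_sum]
  refine Finset.sum_congr rfl fun m _ => ?_
  have h := psiI_phiI_contract_real k l m
  calc _ = v m * ∑ i, ∑ j, (psiI k l i j : ℝ) * phiI m i j := by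
        simp only [Finset.mul_sum]
        exact Finset.sum_congr rfl fun i _ => Finset.sum_congr rfl fun j _ => by ring
    _ = _ := by
        rw [h, phiI_rot m k l]
        ring

theorem intProd_phi0_inner (u v : E7) :
    ∑ k, ∑ l, intProd u phi0 ![stdVec k, stdVec l] * intProd v phi0 ![stdVec k, stdVec l] =
      6 * ∑ i, u i * v i := by
  simp only [intProd_phi0_std, Finset.sum_mul_sum]
  calc _ = ∑ m, ∑ n, u m * v n * ∑ k, ∑ l, (phiI m k l : ℝ) * phiI n k l := by
        rw [sum_comm_four]
        refine Finset.sum_congr rfl fun m _ => ?_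
        rw [sum_comm_four]
        refine Finset.sum_congr rfl fun n _ => ?_
        simp only [Finset.mul_sum]
        exact Finset.sum_congr rfl fun i _ => Finset.sum_congr rfl fun j _ => by ring
    _ = _ := by
        simp only [phiI_contract₂_real, dl]
        simp [Finset.mul_sum]
        exact Finset.sum_congr rfl fun i _ => by ring

/-- The constants are `1/6` from `bForm`, `1/4` from expanding two 2-forms, the eigenvalue 4 on
`Λ²₇`, and 6 from `φ_{mkl} φ_{nkl} = 6 δ_{mn}`; their product is 1. -/
theorem bForm_phi0_std (u v : E7) : bForm phi0 u v stdVec = ∑ i, u i * v i := by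
  have h1 : bForm phi0 u v stdVec =
      (1 / 6 : ℝ) * wedge223 (intProd u phi0) (intProd v phi0) phi0 := by
    rw [wedge223_apply]
    rfl
  rw [h1, wedge223_phi0]
  have h2 : ∀ k l, ∑ i, ∑ j, intProd u phi0 ![stdVec k, stdVec l] *
      intProd v phi0 ![stdVec i, stdVec j] * psiI k l i j =
      4 * (intProd u phi0 ![stdVec k, stdVec l] * intProd v phi0 ![stdVec k, stdVec l]) := by
    intro k l
    have h := psi_intProd_phi0 v k l
    calc _ = intProd u phi0 ![stdVec k, stdVec l] *
          ∑ i, ∑ j, intProd v phi0 ![stdVec i, stdVec j] * psiI k l i j := by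
          simp only [Finset.mul_sum, mul_assoc]
      _ = _ := by rw [h]; ring
  simp only [h2, ← Finset.mul_sum]
  rw [intProd_phi0_inner]
  ring

theorem comp_apply {k : ℕ} (α : AltForm k) (e : E7 →L[ℝ] E7) (v : Fin k → E7) :
    α.compContinuousLinearMap e v = α (fun i => e (v i)) := rfl

theorem smul_comp {k : ℕ} (c : ℝ) (α : AltForm k) (e : E7 →L[ℝ] E7) :
    (c • α).compContinuousLinearMap e = c • α.compContinuousLinearMap e := rfl

theorem bForm_comp (ρ : AltForm 3) (e : E7 →L[ℝ] E7) (u v : E7) :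
    bForm (ρ.compContinuousLinearMap e) u v =
      (bForm ρ (e u) (e v)).compContinuousLinearMap e := by
  have h := wedge_comp (k := 4) (l := 3) (wedge (intProd (e u) ρ) (intProd (e v) ρ)) ρ e
  rw [bForm, bForm, intProd_comp, intProd_comp, wedge_comp, smul_comp, ← h]

/-- The pullback of the standard metric. -/
def pullMetric (e : E7 →L[ℝ] E7) : LinearMap.BilinForm ℝ E7 :=
  g0.compl₁₂ (e : E7 →ₗ[ℝ] E7) (e : E7 →ₗ[ℝ] E7)

theorem pullMetric_apply (e : E7 →L[ℝ] E7) (u v : E7) : pullMetric e u v = g0 (e u) (e v) := rfl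

theorem gram_eq (v : Fin 7 → E7) :
    (Matrix.of fun i j => g0 (v i) (v j)).det = vol0 v ^ 2 := by
  have h : (Matrix.of fun i j => g0 (v i) (v j)) =
      (Matrix.of fun a b => v a (id b)) * (Matrix.of fun a b => v a (id b)).transpose := by
    ext i j
    simp [Matrix.mul_apply, g0_apply]
  rw [vol0_eq, eform_eq_det, h, Matrix.det_mul, Matrix.det_transpose, sq]

theorem isMetricOf_comp (e : E7 ≃L[ℝ] E7) :
    IsMetricOf (phi0.compContinuousLinearMap (e : E7 →L[ℝ] E7)) (pullMetric (e : E7 →L[ℝ] E7))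
      (vol0.compContinuousLinearMap (e : E7 →L[ℝ] E7)) where
  symm u v := by
    simp only [pullMetric_apply, g0_apply]
    exact Finset.sum_congr rfl fun i _ => mul_comm _ _
  pos u hu := by
    have : e u ≠ 0 := by simpa using hu
    rw [pullMetric_apply]
    exact real_inner_self_pos.2 this
  vol_sq v := by
    rw [comp_apply, ← gram_eq]
    rfl
  eq_bForm u v := by
    rw [bForm_comp, pullMetric_apply]
    have h : bForm phi0 ((e : E7 →L[ℝ] E7) u) ((e : E7 →L[ℝ] E7) v) =
        g0 ((e : E7 →L[ℝ] E7) u) ((e : E7 →L[ℝ] E7) v) • vol0 := by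
      rw [seven_eq_smul (bForm phi0 _ _), bForm_phi0_std, g0_apply]
    rw [h, smul_comp]

/-- Otherwise the Gram matrix is singular, and a kernel vector has length zero, against positivity.
-/
theorem IsMetricOf.vol_ne_zero {ρ : AltForm 3} {g : LinearMap.BilinForm ℝ E7} {vol : AltForm 7}
    (h : IsMetricOf ρ g vol) : vol stdVec ≠ 0 := by
  intro h0
  have h1 := h.vol_sq stdVec
  rw [h0, zero_pow two_ne_zero] at h1
  obtain ⟨x, hx, hx0⟩ := Matrix.exists_mulVec_eq_zero_iff.2 h1.symm
  have h2 : ∑ i, x i • stdVec i ≠ 0 := by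
    intro hc
    apply hx
    funext i
    have := congrArg (fun z : E7 => z i) hc
    simpa using this
  have h3 := h.pos _ h2
  have h4 : g (∑ i, x i • stdVec i) (∑ i, x i • stdVec i) =
      ∑ i, x i * (Matrix.of fun i j => g (stdVec i) (stdVec j)).mulVec x i := by
    simp only [map_sum, map_smul, LinearMap.sum_apply, LinearMap.smul_apply, Matrix.mulVec,
      dotProduct, Matrix.of_apply, smul_eq_mul, Finset.mul_sum]
    rw [Finset.sum_comm]
    exact Finset.sum_congr rfl fun i _ => Finset.sum_congr rfl fun j _ => by ring
  rw [h4, hx0] at h3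
  simp at h3

theorem bilin_ext {g g' : LinearMap.BilinForm ℝ E7}
    (h : ∀ i j, g (stdVec i) (stdVec j) = g' (stdVec i) (stdVec j)) : g = g' := by
  refine LinearMap.ext fun x => LinearMap.ext fun y => ?_
  rw [← sum_stdVec x, ← sum_stdVec y]
  simp only [map_sum, map_smul, LinearMap.sum_apply, LinearMap.smul_apply, h]

/-- Only the product `g · vol` is prescribed. Its determinant in the standard basis is `vol⁷ det g =
vol⁹`. The ninth power is injective on the reals, so `vol` is recovered with its sign, and then so
is `g`. -/
theorem IsMetricOf.unique {ρ : AltForm 3} {g g' : LinearMap.BilinForm ℝ E7} {vol vol' : AltForm 7}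
    (h : IsMetricOf ρ g vol) (h' : IsMetricOf ρ g' vol') : g = g' ∧ vol = vol' := by
  have h1 : ∀ u v, g u v * vol stdVec = g' u v * vol' stdVec := by
    intro u v
    have := (h.eq_bForm u v).trans (h'.eq_bForm u v).symm
    exact congrArg (fun χ : AltForm 7 => χ stdVec) this
  have h2 : vol stdVec ^ 9 = vol' stdVec ^ 9 := by
    have h3 : vol stdVec • (Matrix.of fun i j => g (stdVec i) (stdVec j)) =
        vol' stdVec • (Matrix.of fun i j => g' (stdVec i) (stdVec j)) := by
      ext i j
      simp only [Matrix.smul_apply, Matrix.of_apply, smul_eq_mul]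
      rw [mul_comm, h1, mul_comm]
    have h4 := congrArg Matrix.det h3
    rw [Matrix.det_smul, Matrix.det_smul, ← h.vol_sq, ← h'.vol_sq, Fintype.card_fin, ← pow_add,
      ← pow_add] at h4
    exact h4
  have h3 : vol stdVec = vol' stdVec := (Odd.strictMono_pow (by decide : Odd 9)).injective h2
  refine ⟨bilin_ext fun i j => ?_, seven_ext h3⟩
  have h4 := h1 (stdVec i) (stdVec j)
  rw [← h3] at h4
  exact mul_right_cancel₀ h.vol_ne_zero h4

theorem IsMetricOf.metricVol_eq {ρ : AltForm 3} {g : LinearMap.BilinForm ℝ E7} {vol : AltForm 7}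
    (h : IsMetricOf ρ g vol) : metricVol ρ = (g, vol) := by
  have hex : ∃ p : LinearMap.BilinForm ℝ E7 × AltForm 7, IsMetricOf ρ p.1 p.2 := ⟨(g, vol), h⟩
  rw [metricVol, dif_pos hex]
  obtain ⟨h1, h2⟩ := hex.choose_spec.unique h
  exact Prod.ext h1 h2

theorem metricVol_comp (e : E7 ≃L[ℝ] E7) :
    metricVol (phi0.compContinuousLinearMap (e : E7 →L[ℝ] E7)) =
      (pullMetric (e : E7 →L[ℝ] E7), vol0.compContinuousLinearMap (e : E7 →L[ℝ] E7)) :=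
  (isMetricOf_comp e).metricVol_eq

theorem metric_comp (e : E7 ≃L[ℝ] E7) :
    metric (phi0.compContinuousLinearMap (e : E7 →L[ℝ] E7)) =
      pullMetric (e : E7 →L[ℝ] E7) := by
  rw [metric, metricVol_comp]

theorem volForm_comp (e : E7 ≃L[ℝ] E7) :
    volForm (phi0.compContinuousLinearMap (e : E7 →L[ℝ] E7)) =
      vol0.compContinuousLinearMap (e : E7 →L[ℝ] E7) := by
  rw [volForm, metricVol_comp]

/-- The matrix of a linear map in the standard basis. -/
def stdMatrix (e : E7 →L[ℝ] E7) : Matrix (Fin 7) (Fin 7) ℝ := Matrix.of fun m i => e (stdVec i) m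

theorem stdMatrix_mul (e f : E7 →L[ℝ] E7) :
    stdMatrix (e.comp f) = stdMatrix e * stdMatrix f := by
  ext m i
  simp only [stdMatrix, Matrix.of_apply, Matrix.mul_apply, ContinuousLinearMap.comp_apply]
  conv_lhs => rw [← sum_stdVec (f (stdVec i))]
  simp [mul_comm]

/-- The Gram matrix of `e^* g0` is `Eᵀ E`. The identity `E G Eᵀ = 1` for its inverse is the form in
which `sum_invMetric` uses it. -/
theorem invMetric_comp (e : E7 ≃L[ℝ] E7) :
    stdMatrix (e : E7 →L[ℝ] E7) * invMetric (phi0.compContinuousLinearMap (e : E7 →L[ℝ] E7)) *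
      (stdMatrix (e : E7 →L[ℝ] E7)).transpose = 1 := by
  have h1 : (Matrix.of fun i j => metric (phi0.compContinuousLinearMap (e : E7 →L[ℝ] E7))
      (stdVec i) (stdVec j)) =
      (stdMatrix (e : E7 →L[ℝ] E7)).transpose * stdMatrix (e : E7 →L[ℝ] E7) := by
    ext i j
    simp [metric_comp, pullMetric_apply, g0_apply, Matrix.mul_apply, stdMatrix]
  have h2 : stdMatrix (e : E7 →L[ℝ] E7) * stdMatrix (e.symm : E7 →L[ℝ] E7) = 1 := by
    rw [← stdMatrix_mul]
    ext i j
    simp [stdMatrix, Matrix.one_apply]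
  have h3 : IsUnit (stdMatrix (e : E7 →L[ℝ] E7)).det := by
    have := congrArg Matrix.det h2
    rw [Matrix.det_mul, Matrix.det_one] at this
    exact IsUnit.of_mul_eq_one _ this
  rw [invMetric, h1, Matrix.mul_inv_rev, ← mul_assoc, Matrix.mul_nonsing_inv _ h3, one_mul,
    Matrix.nonsing_inv_mul]
  rwa [Matrix.det_transpose]

end

end G2

/-! ### The Hodge star and its naturality under linear isomorphisms. -/

namespace G2

noncomputable section

/-- The Hodge star of the standard metric and the volume form `ν`. -/
def starVol (ν : AltForm 7) {k l : ℕ} (h : k + l = 7) (α : AltForm k) : AltForm l :=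
  (k.factorial : ℝ)⁻¹ • ∑ I : Fin k → Fin 7,
    α (fun a => stdVec (I a)) • contract h ν (fun a => stdVec (I a))

theorem exists_eq_starVol : ∃ S : ∀ k l : ℕ, k + l = 7 → AltForm k → AltForm l,
    ∀ k l h α, S k l h α = starVol vol0 h α := ⟨_, fun _ _ _ _ => rfl⟩

/-- The Hodge star of the standard metric and orientation. -/
def star0 {k l : ℕ} (h : k + l = 7) (α : AltForm k) : AltForm l := exists_eq_starVol.choose k l h α

theorem star0_eq {k l : ℕ} (h : k + l = 7) (α : AltForm k) : star0 h α = starVol vol0 h α :=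
  exists_eq_starVol.choose_spec k l h α

theorem contract_apply {k l n : ℕ} (h : k + l = n) (ν : AltForm n) (w : Fin k → E7)
    (v : Fin l → E7) : contract h ν w v = ν (fun a => Fin.append w v (Fin.cast h.symm a)) := rfl

theorem starVol_apply (ν : AltForm 7) {k l : ℕ} (h : k + l = 7) (α : AltForm k)
    (v : Fin l → E7) : starVol ν h α v = (k.factorial : ℝ)⁻¹ * ∑ I : Fin k → Fin 7,
      α (fun a => stdVec (I a)) * contract h ν (fun a => stdVec (I a)) v := by
  simp only [starVol, ContinuousAlternatingMap.smul_apply, ContinuousAlternatingMap.sum_apply,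
    smul_eq_mul]

theorem update_append {k l : ℕ} (w : Fin k → E7) (v : Fin l → E7) (i : Fin k) (x : E7) :
    Fin.append (Function.update w i x) v =
      Function.update (Fin.append w v) (Fin.castAdd l i) x := by
  funext a
  refine Fin.addCases (fun b => ?_) (fun b => ?_) a
  · by_cases h : b = i
    · subst h
      simp
    · have hne : Fin.castAdd l b ≠ Fin.castAdd l i := by simpa using h
      simp [Function.update_of_ne hne, Function.update_of_ne h]
  · have hne : Fin.natAdd k b ≠ Fin.castAdd l i := by
      intro h
      have h1 := congrArg Fin.val h
      simp only [Fin.val_castAdd, Fin.val_natAdd] at h1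
      omega
    simp [Function.update_of_ne hne]

/-- Contraction as a multilinear map in the contracted vectors. -/
def contractMul {k l n : ℕ} (h : k + l = n) (ν : AltForm n) (v : Fin l → E7) :
    MultilinearMap ℝ (fun _ : Fin k => E7) ℝ where
  toFun w := contract h ν w v
  map_update_add' := by
    intro inst w i x y
    subst h
    have hi : inst = instDecidableEqFin k := Subsingleton.elim _ _
    subst hi
    simp only [contract_apply, update_append]
    exact ν.map_update_add _ _ _ _
  map_update_smul' := by
    intro inst w i c x
    subst h
    have hi : inst = instDecidableEqFin k := Subsingleton.elim _ _
    subst hi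
    simp only [contract_apply, update_append]
    exact ν.map_update_smul _ _ _ _

theorem contractMul_apply {k l n : ℕ} (h : k + l = n) (ν : AltForm n) (v : Fin l → E7)
    (w : Fin k → E7) : contractMul h ν v w = contract h ν w v := rfl

theorem multilinear_expand {k : ℕ} (f : MultilinearMap ℝ (fun _ : Fin k => E7) ℝ)
    (e : E7 →L[ℝ] E7) (I : Fin k → Fin 7) :
    f (fun a => e (stdVec (I a))) =
      ∑ K : Fin k → Fin 7, (∏ a, stdMatrix e (K a) (I a)) * f (fun a => stdVec (K a)) := by
  have h : (fun a => e (stdVec (I a))) =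
      fun a => ∑ m, stdMatrix e m (I a) • stdVec m := by
    funext a
    rw [← sum_stdVec (e (stdVec (I a)))]
    simp [stdMatrix]
  rw [h, f.map_sum]
  refine Finset.sum_congr rfl fun K _ => ?_
  exact f.map_smul_univ (fun a => stdMatrix e (K a) (I a)) (fun a => stdVec (K a))

/-- After both factors are expanded, the sum over `I, J` factorises index by index into entries of
`E G Eᵀ`, which are Kronecker deltas. The inner product on forms and the Hodge star are both
instances. -/
theorem sum_invMetric {k : ℕ} (f g : MultilinearMap ℝ (fun _ : Fin k => E7) ℝ)
    (E G : Matrix (Fin 7) (Fin 7) ℝ) (h : E * G * E.transpose = 1)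
    (F F' : (Fin k → Fin 7) → ℝ)
    (hF : ∀ I, F I = ∑ K : Fin k → Fin 7, (∏ a, E (K a) (I a)) * f (fun a => stdVec (K a)))
    (hF' : ∀ I, F' I = ∑ K : Fin k → Fin 7, (∏ a, E (K a) (I a)) * g (fun a => stdVec (K a))) :
    ∑ I : Fin k → Fin 7, ∑ J : Fin k → Fin 7, F I * F' J * ∏ a, G (I a) (J a) =
      ∑ I : Fin k → Fin 7, f (fun a => stdVec (I a)) * g (fun a => stdVec (I a)) := by
  have h1 : ∀ K L : Fin k → Fin 7, ∑ I : Fin k → Fin 7, ∑ J : Fin k → Fin 7,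
      (∏ a, E (K a) (I a)) * (∏ a, E (L a) (J a)) * ∏ a, G (I a) (J a) =
      if K = L then 1 else 0 := by
    intro K L
    calc _ = ∑ I : Fin k → Fin 7, ∑ J : Fin k → Fin 7,
          ∏ a, (E (K a) (I a) * E (L a) (J a) * G (I a) (J a)) := by
          simp only [Finset.prod_mul_distrib]
      _ = ∏ a, ∑ i, ∑ j, E (K a) i * E (L a) j * G i j := by
          rw [Finset.prod_univ_sum]
          simp only [Fintype.piFinset_univ]
          refine Finset.sum_congr rfl fun I _ => ?_
          rw [Finset.prod_univ_sum]
          simp only [Fintype.piFinset_univ]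
      _ = ∏ a, (E * G * E.transpose) (K a) (L a) := by
          refine Finset.prod_congr rfl fun a _ => ?_
          simp only [Matrix.mul_apply, Matrix.transpose_apply, Finset.sum_mul]
          rw [Finset.sum_comm]
          exact Finset.sum_congr rfl fun i _ => Finset.sum_congr rfl fun j _ => by ring
      _ = _ := by
          rw [h]
          split_ifs with hKL
          · subst hKL
            simp
          · obtain ⟨a, ha⟩ := Function.ne_iff.1 hKL
            exact Finset.prod_eq_zero (Finset.mem_univ a) (Matrix.one_apply_ne ha)
  calc _ = ∑ I : Fin k → Fin 7, ∑ J : Fin k → Fin 7, ∑ K : Fin k → Fin 7, ∑ L : Fin k → Fin 7,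
        f (fun a => stdVec (K a)) * g (fun a => stdVec (L a)) *
        ((∏ a, E (K a) (I a)) * (∏ a, E (L a) (J a)) * ∏ a, G (I a) (J a)) := by
        refine Finset.sum_congr rfl fun I _ => Finset.sum_congr rfl fun J _ => ?_
        rw [hF, hF', Finset.sum_mul_sum, Finset.sum_mul]
        refine Finset.sum_congr rfl fun K _ => ?_
        rw [Finset.sum_mul]
        exact Finset.sum_congr rfl fun L _ => by ring
    _ = ∑ K : Fin k → Fin 7, ∑ L : Fin k → Fin 7, f (fun a => stdVec (K a)) *
        g (fun a => stdVec (L a)) * if K = L then 1 else 0 := by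
        rw [sum_comm_pairs]
        refine Finset.sum_congr rfl fun K _ => Finset.sum_congr rfl fun L _ => ?_
        rw [← h1]
        simp only [Finset.mul_sum]
    _ = _ := by simp

theorem formInner_comp {k : ℕ} (e : E7 ≃L[ℝ] E7) (α β : AltForm k) :
    formInner (phi0.compContinuousLinearMap (e : E7 →L[ℝ] E7))
      (α.compContinuousLinearMap (e : E7 →L[ℝ] E7)) (β.compContinuousLinearMap (e : E7 →L[ℝ] E7)) =
      (k.factorial : ℝ)⁻¹ * ∑ I : Fin k → Fin 7,
        α (fun a => stdVec (I a)) * β (fun a => stdVec (I a)) := by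
  rw [formInner, sum_invMetric α.toMultilinearMap β.toMultilinearMap _ _ (invMetric_comp e)
    (fun I => α.compContinuousLinearMap (e : E7 →L[ℝ] E7) (fun a => stdVec (I a)))
    (fun I => β.compContinuousLinearMap (e : E7 →L[ℝ] E7) (fun a => stdVec (I a)))
    (multilinear_expand α.toMultilinearMap e) (multilinear_expand β.toMultilinearMap e)]
  rfl

theorem contract_comp {k l : ℕ} (h : k + l = 7) (e : E7 →L[ℝ] E7) (ν : AltForm 7)
    (w : Fin k → E7) (v : Fin l → E7) :
    contract h (ν.compContinuousLinearMap e) w v =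
      contract h ν (fun a => e (w a)) (fun b => e (v b)) := by
  rw [contract_apply, contract_apply, comp_apply]
  congr 1
  funext a
  refine Fin.addCases (fun b => ?_) (fun b => ?_) (Fin.cast h.symm a) <;> simp

theorem starVol_comp_aux (ν ν' : AltForm 7) {k l : ℕ} (h : k + l = 7) (e : E7 →L[ℝ] E7)
    (hν : ν' = ν.compContinuousLinearMap e) (G : Matrix (Fin 7) (Fin 7) ℝ)
    (hG : stdMatrix e * G * (stdMatrix e).transpose = 1) (α : AltForm k) :
    (k.factorial : ℝ)⁻¹ • ∑ I : Fin k → Fin 7, ∑ J : Fin k → Fin 7,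
      (α.compContinuousLinearMap e (fun a => stdVec (I a)) * ∏ a, G (I a) (J a)) •
        contract h ν' (fun a => stdVec (J a)) = (starVol ν h α).compContinuousLinearMap e := by
  ext v
  rw [comp_apply, starVol_apply]
  simp only [ContinuousAlternatingMap.smul_apply, ContinuousAlternatingMap.sum_apply, smul_eq_mul]
  congr 1
  have key := sum_invMetric α.toMultilinearMap (contractMul h ν (fun b => e (v b))) _ _ hG
    (fun I => α.compContinuousLinearMap e (fun a => stdVec (I a)))
    (fun I => contract h ν' (fun a => stdVec (I a)) v)
    (multilinear_expand α.toMultilinearMap e) (fun I => by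
      rw [← multilinear_expand, hν, contract_comp, contractMul_apply])
  refine Eq.trans ?_ (key.trans ?_)
  · exact Finset.sum_congr rfl fun I _ => Finset.sum_congr rfl fun J _ => mul_right_comm _ _ _
  · exact Finset.sum_congr rfl fun I _ => rfl

theorem hodgeStar_comp {k l : ℕ} (h : k + l = 7) (e : E7 ≃L[ℝ] E7) (α : AltForm k) :
    hodgeStar (phi0.compContinuousLinearMap (e : E7 →L[ℝ] E7)) h
      (α.compContinuousLinearMap (e : E7 →L[ℝ] E7)) =
      (star0 h α).compContinuousLinearMap (e : E7 →L[ℝ] E7) := by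
  rw [star0_eq]
  exact starVol_comp_aux vol0 _ h e (volForm_comp e) _ (invMetric_comp e) α

theorem comp_id {k : ℕ} (α : AltForm k) :
    α.compContinuousLinearMap (ContinuousLinearMap.id ℝ E7) = α := by
  ext v
  rfl

theorem comp_comp {k : ℕ} (α : AltForm k) (e f : E7 →L[ℝ] E7) :
    (α.compContinuousLinearMap e).compContinuousLinearMap f =
      α.compContinuousLinearMap (e.comp f) := by
  ext v
  rfl

theorem comp_symm {k : ℕ} (α : AltForm k) (e : E7 ≃L[ℝ] E7) :
    (α.compContinuousLinearMap (e.symm : E7 →L[ℝ] E7)).compContinuousLinearMap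
      (e : E7 →L[ℝ] E7) = α := by
  rw [comp_comp, ContinuousLinearEquiv.coe_symm_comp_coe, comp_id]

theorem comp_symm' {k : ℕ} (α : AltForm k) (e : E7 ≃L[ℝ] E7) :
    (α.compContinuousLinearMap (e : E7 →L[ℝ] E7)).compContinuousLinearMap
      (e.symm : E7 →L[ℝ] E7) = α := by
  rw [comp_comp, ContinuousLinearEquiv.coe_comp_coe_symm, comp_id]

/-- The Hodge star of a positive form is natural under linear isomorphisms. -/
theorem IsPositive.hodgeStar_comp {ρ : AltForm 3} (hρ : IsPositive ρ) {k l : ℕ} (h : k + l = 7)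
    (f : E7 ≃L[ℝ] E7) (α : AltForm k) :
    hodgeStar (ρ.compContinuousLinearMap (f : E7 →L[ℝ] E7)) h
      (α.compContinuousLinearMap (f : E7 →L[ℝ] E7)) =
      (hodgeStar ρ h α).compContinuousLinearMap (f : E7 →L[ℝ] E7) := by
  obtain ⟨e, rfl⟩ := hρ
  obtain ⟨β, rfl⟩ : ∃ β : AltForm k, α = β.compContinuousLinearMap (e : E7 →L[ℝ] E7) :=
    ⟨_, (comp_symm α e).symm⟩
  have h2 : (e : E7 →L[ℝ] E7).comp (f : E7 →L[ℝ] E7) = (f.trans e : E7 ≃L[ℝ] E7) := rfl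
  rw [G2.hodgeStar_comp, comp_comp, comp_comp, comp_comp, h2, G2.hodgeStar_comp]

theorem contract_perm {k l : ℕ} (h : k + l = 7) (ν : AltForm 7) (w : Fin k → E7) (v : Fin l → E7)
    (ρ : Equiv.Perm (Fin k)) :
    contract h ν (fun a => w (ρ a)) v = ((Equiv.Perm.sign ρ : ℤ) : ℝ) * contract h ν w v := by
  set p : Equiv.Perm (Fin 7) := (finSumFinEquiv.trans (finCongr h)).permCongr
    (Equiv.Perm.sumCongr ρ (1 : Equiv.Perm (Fin l))) with hp
  have hps : Equiv.Perm.sign p = Equiv.Perm.sign ρ := by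
    simp [hp]
  rw [contract_apply, contract_apply]
  have h1 := ν.toAlternatingMap.map_perm (fun a => Fin.append w v (Fin.cast h.symm a)) p
  rw [hps, Units.smul_def, zsmul_eq_mul] at h1
  refine Eq.trans (congrArg ν ?_) h1
  funext a
  obtain ⟨b, rfl⟩ := (finSumFinEquiv.trans (finCongr h)).surjective a
  rcases b with b | b
  · simp [hp, Equiv.permCongr_apply]
  · simp [hp, Equiv.permCongr_apply]

/-- The Hodge star on basis vectors. -/
theorem starVol_perm (ν : AltForm 7)
    (hν : ∀ σ : Equiv.Perm (Fin 7), ν (fun a => stdVec (σ a)) = ((Equiv.Perm.sign σ : ℤ) : ℝ))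
    (hν0 : ∀ I : Fin 7 → Fin 7, ¬ Function.Injective I → ν (fun a => stdVec (I a)) = 0)
    {k l : ℕ} (h : k + l = 7) (α : AltForm k) (π : Equiv.Perm (Fin 7)) :
    starVol ν h α (fun b => stdVec (π (Fin.cast h (Fin.natAdd k b)))) =
      ((Equiv.Perm.sign π : ℤ) : ℝ) * α (fun a => stdVec (π (Fin.cast h (Fin.castAdd l a)))) := by
  obtain ⟨P, hP⟩ : ∃ P : Fin k → Fin 7, P = fun a => π (Fin.cast h (Fin.castAdd l a)) := ⟨_, rfl⟩
  obtain ⟨Q, hQ⟩ : ∃ Q : Fin l → Fin 7, Q = fun b => π (Fin.cast h (Fin.natAdd k b)) := ⟨_, rfl⟩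
  have hPα : (fun a => stdVec (π (Fin.cast h (Fin.castAdd l a)))) = fun a => stdVec (P a) := by
    rw [hP]
  have hQα : (fun b => stdVec (π (Fin.cast h (Fin.natAdd k b)))) = fun b => stdVec (Q b) := by
    rw [hQ]
  rw [hPα, hQα]
  have hPinj : Function.Injective P := fun a b hab => by simpa [hP] using hab
  have hPQ : contract h ν (fun a => stdVec (P a)) (fun b => stdVec (Q b)) =
      ((Equiv.Perm.sign π : ℤ) : ℝ) := by
    rw [contract_apply, ← hν]
    congr 1
    funext a
    obtain ⟨b, rfl⟩ := (finSumFinEquiv.trans (finCongr h)).surjective a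
    rcases b with b | b
    · simp [hP]
    · simp [hQ]
  rw [starVol_apply]
  -- The surviving tuples `I` are the rearrangements of `P`. For these the form and the contraction
  -- both acquire `sign ρ`, so all `k!` terms are equal.
  have hsum : ∑ _ρ : Equiv.Perm (Fin k), ((Equiv.Perm.sign π : ℤ) : ℝ) *
      α (fun a => stdVec (P a)) = ∑ I : Fin k → Fin 7,
      α (fun a => stdVec (I a)) *
        contract h ν (fun a => stdVec (I a)) (fun b => stdVec (Q b)) := by
    refine Finset.sum_of_injOn (fun ρ a => P (ρ a)) ?_ (fun _ _ => Finset.mem_coe.2 (Finset.mem_univ _))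
      ?_ ?_
    · intro ρ _ ρ' _ hρ
      ext a
      have := congrFun hρ a
      simpa using congrArg Fin.val (hPinj this)
    · intro I _ hI
      suffices hc : contract h ν (fun a => stdVec (I a)) (fun b => stdVec (Q b)) = 0 by
        rw [hc, mul_zero]
      have h1 : contract h ν (fun a => stdVec (I a)) (fun b => stdVec (Q b)) =
          ν (fun a => stdVec (Fin.append I Q (Fin.cast h.symm a))) := by
        rw [contract_apply]
        congr 1
        funext a
        refine Fin.addCases (fun b => ?_) (fun b => ?_) (Fin.cast h.symm a) <;> simp
      rw [h1]
      apply hν0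
      -- If `I` and `Q` together are injective, `I` avoids the values of `Q`, hence takes its values
      -- in those of `P` and is a rearrangement of `P`.
      intro hinj
      apply hI
      have hIinj : Function.Injective I := by
        intro a b hab
        have := @hinj (Fin.cast h (Fin.castAdd l a)) (Fin.cast h (Fin.castAdd l b)) (by simpa)
        simpa using this
      have hIP : ∀ a, ∃ a', P a' = I a := by
        intro a
        obtain ⟨c, hc⟩ := (finSumFinEquiv.trans (finCongr h)).surjective (π.symm (I a))
        rcases c with c | c
        · refine ⟨c, ?_⟩
          rw [hP]
          simp only
          rw [← π.apply_symm_apply (I a), ← hc]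
          simp
        · exfalso
          have hQc : Q c = I a := by
            rw [hQ]
            simp only
            rw [← π.apply_symm_apply (I a), ← hc]
            simp
          have := @hinj (Fin.cast h (Fin.castAdd l a)) (Fin.cast h (Fin.natAdd k c))
            (by simp [hQc])
          have h2 := congrArg Fin.val this
          simp at h2
          omega
      choose r hr using hIP
      have hrinj : Function.Injective r := by
        intro a b hab
        apply hIinj
        rw [← hr a, ← hr b, hab]
      refine ⟨Equiv.ofBijective r (Finite.injective_iff_bijective.1 hrinj), by simp, ?_⟩
      funext a
      exact hr a
    · intro ρ _
      beta_reduce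
      have h1 := α.toAlternatingMap.map_perm (fun a => stdVec (P a)) ρ
      rw [Units.smul_def, zsmul_eq_mul] at h1
      have h2 := contract_perm h ν (fun a => stdVec (P a)) (fun b => stdVec (Q b)) ρ
      have h3 : α (fun a => stdVec (P (ρ a))) =
        ((Equiv.Perm.sign ρ : ℤ) : ℝ) * α (fun a => stdVec (P a)) := h1
      have h4 : contract h ν (fun a => stdVec (P (ρ a))) (fun b => stdVec (Q b)) =
        ((Equiv.Perm.sign ρ : ℤ) : ℝ) *
          contract h ν (fun a => stdVec (P a)) (fun b => stdVec (Q b)) := h2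
      rw [h3, h4, hPQ]
      have h5 : ((Equiv.Perm.sign ρ : ℤ) : ℝ) * ((Equiv.Perm.sign ρ : ℤ) : ℝ) = 1 := by
        rcases Int.units_eq_one_or (Equiv.Perm.sign ρ) with h | h <;> simp [h]
      linear_combination (-(((Equiv.Perm.sign π : ℤ) : ℝ) * α (fun a => stdVec (P a)))) * h5
  rw [← hsum]
  simp only [Finset.sum_const, Finset.card_univ, Fintype.card_perm, Fintype.card_fin, nsmul_eq_mul]
  have h1 : (k.factorial : ℝ) ≠ 0 := by exact_mod_cast k.factorial_ne_zero
  field_simp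

theorem star0_perm {k l : ℕ} (h : k + l = 7) (α : AltForm k) (π : Equiv.Perm (Fin 7)) :
    star0 h α (fun b => stdVec (π (Fin.cast h (Fin.natAdd k b)))) =
      ((Equiv.Perm.sign π : ℤ) : ℝ) * α (fun a => stdVec (π (Fin.cast h (Fin.castAdd l a)))) := by
  rw [star0_eq]
  exact starVol_perm vol0 vol0_perm (fun _ hI => vol0_of_not_injective hI) h α π

end

end G2

/-! ### The dual 4-form `psi0` and the type `Λ²₁₄`. -/

namespace G2

noncomputable section

theorem sum_epsI'' : ∀ i j k l, epsI i j 0 1 2 k l + epsI i j 0 3 4 k l + epsI i j 0 5 6 k l +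
    epsI i j 1 3 5 k l - epsI i j 1 4 6 k l - epsI i j 2 3 6 k l - epsI i j 2 4 5 k l =
      psiI i j k l := by
  decide +kernel

theorem exists_perm_extend {k l : ℕ} (h : k + l = 7) {I : Fin k → Fin 7}
    (hI : Function.Injective I) :
    ∃ π : Equiv.Perm (Fin 7), ∀ a, π (Fin.cast h (Fin.castAdd l a)) = I a := by
  classical
  have hc : Function.Injective fun a : Fin k => Fin.cast h (Fin.castAdd l a) := fun a b hab => by
    simpa using hab
  let e : {x // x ∈ Set.range fun a : Fin k => Fin.cast h (Fin.castAdd l a)} ≃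
      {x // x ∈ Set.range I} := (Equiv.ofInjective _ hc).symm.trans (Equiv.ofInjective I hI)
  refine ⟨e.extendSubtype, fun a => ?_⟩
  rw [e.extendSubtype_apply_of_mem _ ⟨a, rfl⟩]
  have : (⟨Fin.cast h (Fin.castAdd l a), ⟨a, rfl⟩⟩ :
      {x // x ∈ Set.range fun a : Fin k => Fin.cast h (Fin.castAdd l a)}) =
      Equiv.ofInjective _ hc a := rfl
  rw [this]
  simp [e]

/-- The permutation exchanging the first `l` and the last `k` indices. -/
def blockFlip {k l : ℕ} (h : k + l = 7) (h' : l + k = 7) : Equiv.Perm (Fin 7) :=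
  (finSumFinEquiv.trans (finCongr h')).symm.trans
    ((Equiv.sumComm _ _).trans (finSumFinEquiv.trans (finCongr h)))

theorem blockFlip_castAdd {k l : ℕ} (h : k + l = 7) (h' : l + k = 7) (b : Fin l) :
    blockFlip h h' (Fin.cast h' (Fin.castAdd k b)) = Fin.cast h (Fin.natAdd k b) := by
  have : Fin.cast h' (Fin.castAdd k b) = (finSumFinEquiv.trans (finCongr h')) (Sum.inl b) := rfl
  rw [this, blockFlip, Equiv.trans_apply, Equiv.symm_apply_apply]
  rfl

theorem blockFlip_natAdd {k l : ℕ} (h : k + l = 7) (h' : l + k = 7) (a : Fin k) :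
    blockFlip h h' (Fin.cast h' (Fin.natAdd l a)) = Fin.cast h (Fin.castAdd l a) := by
  have : Fin.cast h' (Fin.natAdd l a) = (finSumFinEquiv.trans (finCongr h')) (Sum.inr a) := rfl
  rw [this, blockFlip, Equiv.trans_apply, Equiv.symm_apply_apply]
  rfl

/-- Extend `I` to a permutation `π` and apply `star0_perm` to `π` and to `π` composed with the block
flip. The two signs of `π` cancel, so `**` is the sign of the flip. -/
theorem star0_star0 {k l : ℕ} (h : k + l = 7) (h' : l + k = 7)
    (hs : Equiv.Perm.sign (blockFlip h h') = 1) (α : AltForm k) :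
    star0 h' (star0 h α) = α := by
  refine altForm_ext fun I hI => ?_
  obtain ⟨π, hπ⟩ := exists_perm_extend h hI.injective
  have h1 := star0_perm h' (star0 h α) (π * blockFlip h h')
  have h2 := star0_perm h α π
  simp only [Equiv.Perm.mul_apply, blockFlip_castAdd, blockFlip_natAdd, hπ, Equiv.Perm.sign_mul, hs,
    mul_one] at h1 h2
  rw [h1, h2, ← mul_assoc]
  have h5 : ((Equiv.Perm.sign π : ℤ) : ℝ) * ((Equiv.Perm.sign π : ℤ) : ℝ) = 1 := by
    rcases Int.units_eq_one_or (Equiv.Perm.sign π) with h | h <;> simp [h]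
  rw [h5, one_mul]

theorem sign_blockFlip_two : Equiv.Perm.sign (blockFlip (k := 2) (l := 5) rfl rfl) = 1 := by
  have : blockFlip (k := 2) (l := 5) rfl rfl = finRotate 7 * finRotate 7 := by decide
  rw [this]
  simp

theorem sign_blockFlip_five : Equiv.Perm.sign (blockFlip (k := 5) (l := 2) rfl rfl) = 1 := by
  have : blockFlip (k := 5) (l := 2) rfl rfl = (finRotate 7 * finRotate 7)⁻¹ := by decide
  rw [this]
  simp

theorem star0_two_five (τ : AltForm 2) :
    star0 (k := 5) (l := 2) rfl (star0 (k := 2) (l := 5) rfl τ) = τ :=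
  star0_star0 _ _ sign_blockFlip_two τ

theorem star0_five_two (β : AltForm 5) :
    star0 (k := 2) (l := 5) rfl (star0 (k := 5) (l := 2) rfl β) = β :=
  star0_star0 _ _ sign_blockFlip_five β

/-- The Hodge star as a linear map. -/
def starVolL (ν : AltForm 7) {k l : ℕ} (h : k + l = 7) : AltForm k →ₗ[ℝ] AltForm l where
  toFun α := starVol ν h α
  map_add' α β := by
    ext v
    simp only [starVol_apply, ContinuousAlternatingMap.add_apply, add_mul, Finset.sum_add_distrib,
      mul_add]
  map_smul' c α := by
    ext v
    simp only [starVol_apply, ContinuousAlternatingMap.smul_apply, smul_eq_mul, Finset.mul_sum,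
      RingHom.id_apply]
    exact Finset.sum_congr rfl fun I _ => by ring

theorem starVolL_apply (ν : AltForm 7) {k l : ℕ} (h : k + l = 7) (α : AltForm k) :
    starVolL ν h α = starVol ν h α := rfl

/-- The Hodge star of the standard metric as a linear map. -/
def star0L {k l : ℕ} (h : k + l = 7) : AltForm k →ₗ[ℝ] AltForm l := starVolL vol0 h

theorem star0L_apply {k l : ℕ} (h : k + l = 7) (α : AltForm k) : star0L h α = star0 h α := by
  rw [star0L, star0_eq, starVolL_apply]

theorem eform_std_eq_sum {k : ℕ} (I J : Fin k → Fin 7) :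
    eform I (fun a => stdVec (J a)) = ∑ σ : Equiv.Perm (Fin k), ((Equiv.Perm.sign σ : ℤ) : ℝ) *
      if (fun a => J (σ a)) = I then 1 else 0 := by
  rw [eform_apply]
  refine Finset.sum_congr rfl fun σ _ => ?_
  congr 1
  simp only [stdVec_apply]
  split_ifs with h
  · exact Finset.prod_eq_one fun a _ => by rw [if_pos (congrFun h a).symm]
  · obtain ⟨a, ha⟩ := Function.ne_iff.1 h
    exact Finset.prod_eq_zero (Finset.mem_univ a) (if_neg fun hc => ha hc.symm)

/-- Each permutation in the expansion of `eform I` selects one tuple, and its sign cancels against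
that of the contraction; `k!` equal terms remain. -/
theorem starVol_eform (ν : AltForm 7) {k l : ℕ} (h : k + l = 7) (I : Fin k → Fin 7) :
    starVol ν h (eform I) = contract h ν (fun a => stdVec (I a)) := by
  ext v
  rw [starVol_apply]
  have h1 : ∀ σ : Equiv.Perm (Fin k), ∑ J : Fin k → Fin 7, (((Equiv.Perm.sign σ : ℤ) : ℝ) *
      if (fun a => J (σ a)) = I then 1 else 0) * contract h ν (fun a => stdVec (J a)) v =
      contract h ν (fun a => stdVec (I a)) v := by
    intro σ
    rw [Finset.sum_eq_single (fun a => I (σ⁻¹ a))]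
    · have h2 := contract_perm h ν (fun a => stdVec (I a)) v σ⁻¹
      rw [h2, if_pos (by funext a; simp)]
      rcases Int.units_eq_one_or (Equiv.Perm.sign σ) with h | h <;> simp [h]
    · intro J _ hJ
      rw [if_neg, mul_zero, zero_mul]
      rintro rfl
      apply hJ
      funext a
      simp
    · intro hc
      exact absurd (Finset.mem_univ _) hc
  simp only [eform_std_eq_sum, Finset.sum_mul]
  rw [Finset.sum_comm]
  simp only [h1, Finset.sum_const, Finset.card_univ, Fintype.card_perm, Fintype.card_fin,
    nsmul_eq_mul]
  have h1 : (k.factorial : ℝ) ≠ 0 := by exact_mod_cast k.factorial_ne_zero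
  field_simp

theorem contract_std (ν : AltForm 7) {k l : ℕ} (h : k + l = 7) (I : Fin k → Fin 7)
    (J : Fin l → Fin 7) : contract h ν (fun a => stdVec (I a)) (fun b => stdVec (J b)) =
      ν (fun a => stdVec (Fin.append I J (Fin.cast h.symm a))) := by
  rw [contract_apply]
  congr 1
  funext a
  refine Fin.addCases (fun b => ?_) (fun b => ?_) (Fin.cast h.symm a) <;> simp

/-- The form `ν` has the components of the standard volume form. -/
def IsStdVol (ν : AltForm 7) : Prop := ∀ J : Fin 7 → Fin 7,
  ν (fun i => stdVec (J i)) = epsI (J 0) (J 1) (J 2) (J 3) (J 4) (J 5) (J 6)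

theorem IsStdVol.star_eform {ν : AltForm 7} (hν : IsStdVol ν) {k l : ℕ} (h : k + l = 7)
    (I : Fin k → Fin 7) (J : Fin l → Fin 7)
    (K : Fin 7 → Fin 7) (hK : ∀ a, Fin.append I J (Fin.cast h.symm a) = K a) :
    starVol ν h (eform I) (fun b => stdVec (J b)) =
      epsI (K 0) (K 1) (K 2) (K 3) (K 4) (K 5) (K 6) := by
  rw [starVol_eform, contract_std, ← hν]
  simp only [hK]

theorem exists_eq_star_phi0 : ∃ ψ : AltForm 4, ψ = star0 (k := 3) (l := 4) rfl phi0 := ⟨_, rfl⟩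

/-- The model `4`-form `*phi0`. -/
def psi0 : AltForm 4 := exists_eq_star_phi0.choose

theorem psi0_eq : psi0 = star0 (k := 3) (l := 4) rfl phi0 := exists_eq_star_phi0.choose_spec

/-- Evaluation on a tuple of vectors, as a linear map. -/
def evalL {k : ℕ} (v : Fin k → E7) : AltForm k →ₗ[ℝ] ℝ where
  toFun χ := χ v
  map_add' _ _ := rfl
  map_smul' _ _ := rfl

theorem evalL_apply {k : ℕ} (v : Fin k → E7) (χ : AltForm k) : evalL v χ = χ v := rfl

theorem IsStdVol.star_eform_three {ν : AltForm 7} (hν : IsStdVol ν) (p q r k l i j : Fin 7) :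
    starVol ν (k := 3) (l := 4) rfl (eform ![p, q, r])
      (fun b => stdVec ((![k, l, i, j] : Fin 4 → Fin 7) b)) = epsI p q r k l i j := by
  refine hν.star_eform (k := 3) (l := 4) rfl ![p, q, r] ![k, l, i, j] ![p, q, r, k, l, i, j] ?_
  intro a
  fin_cases a <;> rfl

theorem vec_four_eq (k l i j : Fin 7) : ![stdVec k, stdVec l, stdVec i, stdVec j] =
    fun b => stdVec ((![k, l, i, j] : Fin 4 → Fin 7) b) :=
  (vec_four stdVec ![k, l, i, j]).symm

theorem vec_two_eq (k l : Fin 7) : ![stdVec k, stdVec l] =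
    fun b => stdVec ((![k, l] : Fin 2 → Fin 7) b) :=
  (vec_two stdVec ![k, l]).symm

theorem IsStdVol.star_phi0_std {ν : AltForm 7} (hν : IsStdVol ν) (k l i j : Fin 7) :
    starVol ν (k := 3) (l := 4) rfl phi0 ![stdVec k, stdVec l, stdVec i, stdVec j] =
      psiI k l i j := by
  have h : starVol ν (k := 3) (l := 4) rfl phi0 ![stdVec k, stdVec l, stdVec i, stdVec j] =
      (evalL (fun b => stdVec ((![k, l, i, j] : Fin 4 → Fin 7) b)) ∘ₗ
        starVolL ν (k := 3) (l := 4) rfl) phi0 := by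
    rw [LinearMap.comp_apply, starVolL_apply, evalL_apply, vec_four_eq]
  rw [h, linear_phi0]
  simp only [LinearMap.comp_apply, starVolL_apply, evalL_apply, hν.star_eform_three]
  rw [← sum_epsI', Int.cast_sub, Int.cast_sub,
    Int.cast_sub, Int.cast_add, Int.cast_add, Int.cast_add]

theorem isStdVol_vol0 : IsStdVol vol0 := vol0_std

/-- Replaces `vol0` by an unnamed form known only through its components. -/
theorem exists_isStdVol : ∃ ν : AltForm 7, IsStdVol ν ∧
    ∀ {k l : ℕ} (h : k + l = 7) (α : AltForm k), star0 h α = starVol ν h α :=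
  ⟨vol0, isStdVol_vol0, fun h α => star0_eq h α⟩

theorem psi0_std (k l i j : Fin 7) :
    psi0 ![stdVec k, stdVec l, stdVec i, stdVec j] = psiI k l i j := by
  obtain ⟨ν, hν, hs⟩ := exists_isStdVol
  rw [psi0_eq, hs, hν.star_phi0_std]

/-- The wedge product of a `2`-form and a `3`-form. -/
def wedge23 : AltForm 2 →ₗ[ℝ] AltForm 3 →ₗ[ℝ] AltForm 5 := wedgeB 2 3

theorem wedge23_apply (τ : AltForm 2) (χ : AltForm 3) : wedge23 τ χ = wedge τ χ := rfl

theorem wedge23_eform (i j p q r : Fin 7) :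
    ∃ J : Fin 5 → Fin 7, (J 0 = i ∧ J 1 = j ∧ J 2 = p ∧ J 3 = q ∧ J 4 = r) ∧
      wedge23 (eform ![i, j]) (eform ![p, q, r]) = eform J :=
  ⟨Fin.append ![i, j] ![p, q, r], ⟨rfl, rfl, rfl, rfl, rfl⟩, wedge_eform _ _⟩

theorem IsStdVol.star_eform_five {ν : AltForm 7} (hν : IsStdVol ν) (i j p q r k l : Fin 7) :
    starVol ν (k := 5) (l := 2) rfl (wedge23 (eform ![i, j]) (eform ![p, q, r]))
      ![stdVec k, stdVec l] = epsI i j p q r k l := by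
  obtain ⟨J, ⟨h0, h1, h2, h3, h4⟩, hJ⟩ := wedge23_eform i j p q r
  have h := hν.star_eform (k := 5) (l := 2) rfl J ![k, l] (Fin.append J ![k, l]) fun _ => rfl
  have e0 : Fin.append J ![k, l] 0 = i := h0
  have e1 : Fin.append J ![k, l] 1 = j := h1
  have e2 : Fin.append J ![k, l] 2 = p := h2
  have e3 : Fin.append J ![k, l] 3 = q := h3
  have e4 : Fin.append J ![k, l] 4 = r := h4
  have e5 : Fin.append J ![k, l] 5 = k := rfl
  have e6 : Fin.append J ![k, l] 6 = l := rfl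
  rw [e0, e1, e2, e3, e4, e5, e6] at h
  rw [hJ, vec_two_eq, h]

theorem IsStdVol.star_wedge_eform_phi0 {ν : AltForm 7} (hν : IsStdVol ν) (i j k l : Fin 7) :
    (evalL ![stdVec k, stdVec l] ∘ₗ starVolL ν (k := 5) (l := 2) rfl ∘ₗ wedge23 (eform ![i, j]))
      phi0 = psiI i j k l := by
  rw [linear_phi0]
  simp only [LinearMap.comp_apply, starVolL_apply, evalL_apply, hν.star_eform_five]
  rw [← sum_epsI'', Int.cast_sub, Int.cast_sub,
    Int.cast_sub, Int.cast_add, Int.cast_add, Int.cast_add]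

theorem linear_wedge23 (S : AltForm 5 →ₗ[ℝ] ℝ) (τ : AltForm 2) (χ : AltForm 3) :
    S (wedge23 τ χ) =
      (1 / 2 : ℝ) * ∑ i, ∑ j, τ ![stdVec i, stdVec j] * S (wedge23 (eform ![i, j]) χ) := by
  conv_lhs => rw [twoForm_eq_sum τ]
  simp only [map_smul, map_sum, smul_eq_mul, LinearMap.smul_apply, LinearMap.sum_apply]

theorem IsStdVol.star_wedge_phi0 {ν : AltForm 7} (hν : IsStdVol ν) (τ : AltForm 2) (k l : Fin 7) :
    starVol ν (k := 5) (l := 2) rfl (wedge23 τ phi0) ![stdVec k, stdVec l] =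
      (1 / 2 : ℝ) * ∑ i, ∑ j, τ ![stdVec i, stdVec j] * psiI i j k l := by
  have h := linear_wedge23 (evalL ![stdVec k, stdVec l] ∘ₗ starVolL ν (k := 5) (l := 2) rfl) τ phi0
  have h2 : ∀ i j, (evalL ![stdVec k, stdVec l] ∘ₗ starVolL ν (k := 5) (l := 2) rfl)
      (wedge23 (eform ![i, j]) phi0) = psiI i j k l := by
    intro i j
    rw [← hν.star_wedge_eform_phi0 i j k l, LinearMap.comp_apply, LinearMap.comp_apply,
      LinearMap.comp_apply]
  simp only [h2] at h
  rw [← h, LinearMap.comp_apply, starVolL_apply, evalL_apply]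

theorem star0_wedge_phi0 (τ : AltForm 2) (k l : Fin 7) :
    star0 (k := 5) (l := 2) rfl (wedge23 τ phi0) ![stdVec k, stdVec l] =
      (1 / 2 : ℝ) * ∑ i, ∑ j, τ ![stdVec i, stdVec j] * psiI i j k l := by
  obtain ⟨ν, hν, hs⟩ := exists_isStdVol
  rw [hs, hν.star_wedge_phi0]

theorem phiI_contract_real (i j l m : Fin 7) : ∑ k, (phiI i j k : ℝ) * phiI l m k =
    dl i l * dl j m - dl i m * dl j l + psiI i j l m := by
  exact_mod_cast phiI_contract i j l m

/-- Membership of a `2`-form in `Λ²₁₄`. -/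
def IsLambda14 (τ : AltForm 2) : Prop :=
  ∀ m, ∑ i, ∑ j, τ ![stdVec i, stdVec j] * phiI i j m = 0

/-- Contracting `τ_{ij} φ_{ijm} = 0` with `φ_{klm}` and using `phiI_contract` gives `2 τ_{kl} +
τ_{ij} ψ_{ijkl} = 0`. -/
theorem IsLambda14.sum_psiI {τ : AltForm 2} (hτ : IsLambda14 τ) (k l : Fin 7) :
    ∑ i, ∑ j, τ ![stdVec i, stdVec j] * psiI i j k l = -2 * τ ![stdVec k, stdVec l] := by
  have h1 : ∑ m, (∑ i, ∑ j, τ ![stdVec i, stdVec j] * phiI i j m) * phiI k l m = 0 := by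
    refine Finset.sum_eq_zero fun m _ => ?_
    rw [hτ m, zero_mul]
  have h2 : ∑ m, (∑ i, ∑ j, τ ![stdVec i, stdVec j] * phiI i j m) * phiI k l m =
      ∑ i, ∑ j, τ ![stdVec i, stdVec j] * (dl i k * dl j l - dl i l * dl j k + psiI i j k l) := by
    simp only [Finset.sum_mul]
    rw [← sum_comm_four]
    refine Finset.sum_congr rfl fun i _ => Finset.sum_congr rfl fun j _ => ?_
    rw [← phiI_contract_real, Finset.mul_sum]
    exact Finset.sum_congr rfl fun m _ => by ring
  rw [h1] at h2
  simp only [mul_add, mul_sub, Finset.sum_add_distrib, Finset.sum_sub_distrib] at h2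
  have h3 : ∀ a b : Fin 7, ∑ i, ∑ j, τ ![stdVec i, stdVec j] * ((dl i a : ℝ) * dl j b) =
      τ ![stdVec a, stdVec b] := by
    intro a b
    simp [dl]
  rw [h3, h3, two_swap τ (stdVec k) (stdVec l)] at h2
  linarith

/-- The components of `*(τ ∧ phi0)` are `½ τ_{ij} ψ_{ijkl} = -τ_{kl}`, and `** = 1`. This ties the
contraction condition `IsLambda14` to the condition `τ ∧ φ = -*τ` on a torsion form. -/
theorem IsLambda14.wedge_phi0 {τ : AltForm 2} (hτ : IsLambda14 τ) :
    wedge23 τ phi0 = -star0 (k := 2) (l := 5) rfl τ := by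
  have h1 : star0 (k := 5) (l := 2) rfl (wedge23 τ phi0) = -τ := by
    refine altForm_ext fun J _ => ?_
    rw [vec_two, star0_wedge_phi0, hτ.sum_psiI, ContinuousAlternatingMap.neg_apply]
    ring
  rw [← star0_five_two (wedge23 τ phi0), h1, ← star0L_apply, ← star0L_apply, map_neg]

end

end G2

namespace G2

noncomputable section

open ContinuousAlternatingMap hiding map_sum

/-! ### The action of endomorphisms on forms -/

/-- The derivative of `B ↦ (1 + B)^* α` at `0`. -/
def act {k : ℕ} (B : E7 →L[ℝ] E7) (α : AltForm k) : AltForm k :=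
  α.fderivCompContinuousLinearMap (.id ℝ E7) B

theorem act_apply {k : ℕ} (B : E7 →L[ℝ] E7) (α : AltForm k) (v : Fin k → E7) :
    act B α v = ∑ i, α (Function.update v i (B (v i))) := by
  rw [act, fderivCompContinuousLinearMap_apply]
  refine Finset.sum_congr rfl fun i _ => ?_
  congr 1
  funext j
  by_cases h : j = i
  · subst h; simp
  · simp [h]

theorem act_two (B : E7 →L[ℝ] E7) (α : AltForm 2) (x y : E7) :
    act B α ![x, y] = α ![B x, y] + α ![x, B y] := by
  rw [act_apply, Fin.sum_univ_two]
  congr 2 <;> funext a <;> fin_cases a <;> rfl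

theorem act_three (B : E7 →L[ℝ] E7) (α : AltForm 3) (x y z : E7) :
    act B α ![x, y, z] = α ![B x, y, z] + α ![x, B y, z] + α ![x, y, B z] := by
  rw [act_apply, Fin.sum_univ_three]
  have h0 : Function.update ![x, y, z] 0 (B x) = ![B x, y, z] := by
    funext a; fin_cases a <;> rfl
  have h1 : Function.update ![x, y, z] 1 (B y) = ![x, B y, z] := by
    funext a; fin_cases a <;> rfl
  have h2 : Function.update ![x, y, z] 2 (B z) = ![x, y, B z] := by
    funext a; fin_cases a <;> rfl
  rw [← h0, ← h1, ← h2]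
  rfl

theorem act_four (B : E7 →L[ℝ] E7) (α : AltForm 4) (x y z w : E7) :
    act B α ![x, y, z, w] =
      α ![B x, y, z, w] + α ![x, B y, z, w] + α ![x, y, B z, w] + α ![x, y, z, B w] := by
  rw [act_apply, Fin.sum_univ_four]
  have h0 : Function.update ![x, y, z, w] 0 (B x) = ![B x, y, z, w] := by
    funext a; fin_cases a <;> rfl
  have h1 : Function.update ![x, y, z, w] 1 (B y) = ![x, B y, z, w] := by
    funext a; fin_cases a <;> rfl
  have h2 : Function.update ![x, y, z, w] 2 (B z) = ![x, y, B z, w] := by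
    funext a; fin_cases a <;> rfl
  have h3 : Function.update ![x, y, z, w] 3 (B w) = ![x, y, z, B w] := by
    funext a; fin_cases a <;> rfl
  rw [← h0, ← h1, ← h2, ← h3]
  rfl

theorem alternatize_two (f : E7 →L[ℝ] AltForm 2) (x y z : E7) :
    (alternatizeUncurryFin f : AltForm 3) ![x, y, z] = f x ![y, z] - f y ![x, z] + f z ![x, y] := by
  have h0 : Fin.removeNth 0 ![x, y, z] = ![y, z] := by funext a; fin_cases a <;> rfl
  have h1 : Fin.removeNth 1 ![x, y, z] = ![x, z] := by funext a; fin_cases a <;> rfl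
  have h2 : Fin.removeNth 2 ![x, y, z] = ![x, y] := by funext a; fin_cases a <;> rfl
  rw [alternatizeUncurryFin_apply, Fin.sum_univ_three]
  rw [h0, h1, h2]
  simp
  ring

theorem alternatize_three (f : E7 →L[ℝ] AltForm 3) (x y z w : E7) :
    (alternatizeUncurryFin f : AltForm 4) ![x, y, z, w] =
      f x ![y, z, w] - f y ![x, z, w] + f z ![x, y, w] - f w ![x, y, z] := by
  have h0 : Fin.removeNth 0 ![x, y, z, w] = ![y, z, w] := by funext a; fin_cases a <;> rfl
  have h1 : Fin.removeNth 1 ![x, y, z, w] = ![x, z, w] := by funext a; fin_cases a <;> rfl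
  have h2 : Fin.removeNth 2 ![x, y, z, w] = ![x, y, w] := by funext a; fin_cases a <;> rfl
  have h3 : Fin.removeNth 3 ![x, y, z, w] = ![x, y, z] := by funext a; fin_cases a <;> rfl
  rw [alternatizeUncurryFin_apply, Fin.sum_univ_four]
  rw [h0, h1, h2, h3]
  simp
  ring

/-- Left exterior multiplication by `e^i`. -/
def ext1 {k : ℕ} (i : Fin 7) : AltForm k →ₗ[ℝ] AltForm (k + 1) where
  toFun β := alternatizeUncurryFin ((EuclideanSpace.proj i : E7 →L[ℝ] ℝ).smulRight β)
  map_add' β β' := by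
    rw [← alternatizeUncurryFin_add]
    congr 1
    ext x v
    simp
  map_smul' c β := by
    rw [RingHom.id_apply, ← alternatizeUncurryFin_smul]
    congr 1
    ext x v
    simp
    ring

theorem ext1_apply {k : ℕ} (i : Fin 7) (β : AltForm k) :
    ext1 i β = alternatizeUncurryFin ((EuclideanSpace.proj i : E7 →L[ℝ] ℝ).smulRight β) := rfl

theorem alternatize_eq_sum_ext1 {k : ℕ} (f : E7 →L[ℝ] AltForm k) :
    alternatizeUncurryFin f = ∑ i, ext1 i (f (stdVec i)) := by
  have h : f = ∑ i, (EuclideanSpace.proj i : E7 →L[ℝ] ℝ).smulRight (f (stdVec i)) := by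
    refine ContinuousLinearMap.ext fun x => ?_
    conv_lhs => rw [← sum_stdVec x]
    rw [map_sum, _root_.sum_apply]
    refine Finset.sum_congr rfl fun i _ => ?_
    rw [map_smul]
    rfl
  conv_lhs => rw [h]
  simp only [ext1_apply]
  exact map_sum (alternatizeUncurryFinCLM ℝ E7 ℝ) _ _

/-- Laplace expansion of the determinant along its first column. -/
theorem ext1_eform {k : ℕ} (i : Fin 7) (J : Fin k → Fin 7) :
    ext1 i (eform J) = eform (Fin.cons i J) := by
  ext v
  rw [ext1_apply, alternatizeUncurryFin_apply, eform_eq_det, Matrix.det_succ_column_zero]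
  refine Finset.sum_congr rfl fun a _ => ?_
  have h : ((EuclideanSpace.proj i : E7 →L[ℝ] ℝ).smulRight (eform J)) (v a) (Fin.removeNth a v) =
    v a i * eform J (Fin.removeNth a v) := rfl
  rw [h, eform_eq_det]
  simp only [Matrix.of_apply, Fin.cons_zero, zsmul_eq_mul, Int.cast_pow, Int.cast_neg, Int.cast_one]
  rw [mul_assoc]
  rfl

theorem form_induction {k : ℕ} {V : Type*} [AddCommGroup V] [Module ℝ V]
    {L L' : AltForm k →ₗ[ℝ] V} (h : ∀ I, L (eform I) = L' (eform I)) : L = L' := by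
  refine LinearMap.ext fun α => ?_
  rw [altForm_eq_sum α, map_sum, map_sum]
  refine Finset.sum_congr rfl fun I _ => ?_
  rw [map_smul, map_smul, h]

/-- Left exterior multiplication by `e^i ∧ e^j` on `3`-forms. -/
def ext2 (i j : Fin 7) : AltForm 3 →ₗ[ℝ] AltForm 5 := ext1 (k := 4) i ∘ₗ ext1 (k := 3) j

theorem ext2_apply (i j : Fin 7) (χ : AltForm 3) :
    ext2 i j χ = ext1 (k := 4) i (ext1 (k := 3) j χ) := rfl

/-- Exterior derivatives appear below as iterated left multiplications by covectors; this converts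
them to wedge products with a 2-form. -/
theorem wedge23_eform_left (i j : Fin 7) : wedge23 (eform ![i, j]) = ext2 i j := by
  refine form_induction fun J => ?_
  rw [ext2_apply, ext1_eform, ext1_eform, wedge23_apply, wedge_eform]
  congr 1
  funext a
  fin_cases a <;> rfl

theorem ext1_three (q : Fin 7) (α : AltForm 3) (x y z w : E7) :
    (ext1 q α : AltForm 4) ![x, y, z, w] = x q * α ![y, z, w] - y q * α ![x, z, w] +
      z q * α ![x, y, w] - w q * α ![x, y, z] := by
  rw [ext1_apply, alternatize_three]
  rfl

end

end G2

/-! ### The torsion matrix of a skew connection matrix. -/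

namespace G2

noncomputable section

open ContinuousAlternatingMap hiding map_sum map_zero

theorem psiI_contract₂ : ∀ i j m n, ∑ k, ∑ l, psiI i j k l * psiI m n k l =
    4 * (dl i m * dl j n - dl i n * dl j m) + 2 * psiI i j m n := by
  decide +kernel

theorem psiI_contract₃ : ∀ i m, ∑ j, ∑ k, ∑ l, psiI i j k l * psiI m j k l = 24 * dl i m := by
  decide +kernel

/-- The companion of `phiI_psiI_contract` one degree higher. The covector `φ_{ab·}` wedged with
`phi0` is, up to sign, the rotation in the `ab`-plane acting on the dual 4-form. -/
theorem phiI_wedge_phiI : ∀ j k, j < k → ∀ l, k < l → ∀ m, l < m → ∀ a b,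
    phiI a b j * phiI k l m - phiI a b k * phiI j l m + phiI a b l * phiI j k m -
      phiI a b m * phiI j k l =
    dl b j * psiI a k l m + dl b k * psiI j a l m + dl b l * psiI j k a m + dl b m * psiI j k l a -
    (dl a j * psiI b k l m + dl a k * psiI j b l m + dl a l * psiI j k b m +
      dl a m * psiI j k l b) := by
  decide +kernel

theorem zero_form_apply {k : ℕ} (v : Fin k → E7) : (0 : AltForm k) v = 0 := rfl

/-- Skew-symmetry of an endomorphism for the standard inner product. -/
def IsSkew (C : E7 →L[ℝ] E7) : Prop := ∀ j m, C (stdVec j) m = -C (stdVec m) j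

/-- The contraction of an endomorphism with `phi0`. -/
def tor (C : E7 →L[ℝ] E7) (q : Fin 7) : ℝ := ∑ a, ∑ b, C (stdVec b) a * phiI a b q

/-- A skew matrix contracted against a delta in either slot gives the same sum up to sign, so the
two halves of the rotation identities add up instead of cancelling. -/
theorem sum_skew {c : Fin 7 → Fin 7 → ℝ} (hc : ∀ a b, c a b = -c b a) (j : Fin 7)
    (f : Fin 7 → ℝ) :
    ∑ a, ∑ b, c a b * ((dl a j : ℝ) * f b) = -∑ m, c m j * f m ∧
    ∑ a, ∑ b, c a b * ((dl b j : ℝ) * f a) = ∑ m, c m j * f m := by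
  constructor
  · rw [Finset.sum_comm, ← Finset.sum_neg_distrib]
    refine Finset.sum_congr rfl fun b _ => ?_
    rw [Finset.sum_eq_single j]
    · simp [dl, hc j b]
    · intro a _ ha
      simp [dl, ha]
    · simp
  · refine Finset.sum_congr rfl fun a _ => ?_
    rw [Finset.sum_eq_single j]
    · simp [dl]
    · intro b _ hb
      simp [dl, hb]
    · simp

theorem intProd_four (α : AltForm 4) (x y z w : E7) :
    intProd x α ![y, z, w] = α ![x, y, z, w] := rfl

/-- In `so(7) = g₂ ⊕ Λ²₇` the first summand kills `phi0`, so only the `Λ²₇`-part `tor C` can enter.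
Contracting `phiI_psiI_contract` with `C` gives `-2` times the action, hence the constant. -/
theorem act_phi0_of_skew {C : E7 →L[ℝ] E7} (hC : IsSkew C) :
    act C phi0 = (-1 / 2 : ℝ) • ∑ q, tor C q • intProd (stdVec q) psi0 := by
  refine altForm_ext fun J hJ => ?_
  have hjk : J 0 < J 1 := hJ (by decide)
  have hkl : J 1 < J 2 := hJ (by decide)
  rw [vec_three]
  generalize J 0 = j at *
  generalize J 1 = k at *
  generalize J 2 = l at *
  have hψ : ∀ q, intProd (stdVec q) psi0 ![stdVec j, stdVec k, stdVec l] = psiI q j k l := by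
    intro q
    rw [← psi0_std, intProd_four]
  rw [act_three, three_zero, three_one _ _ (C (stdVec k)), three_two _ _ _ (C (stdVec l))]
  simp only [phi0_std, ContinuousAlternatingMap.smul_apply, ContinuousAlternatingMap.sum_apply,
    smul_eq_mul, hψ]
  have h1 : ∀ a b, ∑ q, (phiI a b q : ℝ) * psiI q j k l =
      dl a j * phiI b k l + dl a k * phiI j b l + dl a l * phiI j k b -
      (dl b j * phiI a k l + dl b k * phiI j a l + dl b l * phiI j k a) := by
    intro a b
    exact_mod_cast phiI_psiI_contract j k hjk l hkl a b
  have h2 : ∑ q, tor C q * (psiI q j k l : ℝ) = ∑ a, ∑ b, C (stdVec b) a *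
      (dl a j * phiI b k l + dl a k * phiI j b l + dl a l * phiI j k b -
      (dl b j * phiI a k l + dl b k * phiI j a l + dl b l * phiI j k a)) := by
    simp only [tor, Finset.sum_mul]
    rw [← sum_comm_four]
    refine Finset.sum_congr rfl fun a _ => Finset.sum_congr rfl fun b _ => ?_
    rw [← h1, Finset.mul_sum]
    exact Finset.sum_congr rfl fun q _ => by ring
  have hs : ∀ a b, (fun a b => C (stdVec b) a) a b = -(fun a b => C (stdVec b) a) b a :=
    fun a b => hC b a
  have s0 := sum_skew hs j fun m => phiI m k l
  have s1 := sum_skew hs k fun m => phiI j m l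
  have s2 := sum_skew hs l fun m => phiI j k m
  rw [h2]
  simp only [mul_add, mul_sub, Finset.sum_add_distrib, Finset.sum_sub_distrib]
  simp only at s0 s1 s2
  rw [s0.1, s0.2, s1.1, s1.2, s2.1, s2.2]
  ring

/-- The same mechanism with `phiI_wedge_phiI`, whose contraction with `C` is `+2` times the action
on `psi0`. -/
theorem act_psi0_of_skew {C : E7 →L[ℝ] E7} (hC : IsSkew C) :
    act C psi0 = (1 / 2 : ℝ) • ∑ q, tor C q • ext1 q phi0 := by
  refine altForm_ext fun J hJ => ?_
  have hjk : J 0 < J 1 := hJ (by decide)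
  have hkl : J 1 < J 2 := hJ (by decide)
  have hlm : J 2 < J 3 := hJ (by decide)
  rw [vec_four]
  generalize J 0 = j at *
  generalize J 1 = k at *
  generalize J 2 = l at *
  generalize J 3 = m at *
  rw [act_four, four_zero, four_one _ _ (C (stdVec k)), four_two _ _ _ (C (stdVec l)),
    four_three _ _ _ _ (C (stdVec m))]
  simp only [phi0_std, ContinuousAlternatingMap.smul_apply, ContinuousAlternatingMap.sum_apply,
    smul_eq_mul, psi0_std, ext1_three]
  have hx : ∀ (q : Fin 7) (i : Fin 7), stdVec i q = (dl q i : ℝ) := by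
    intro q i
    simp [dl]
  have h0 : ∀ (i : Fin 7) (r : ℝ), ∑ q, tor C q * ((dl q i : ℝ) * r) = tor C i * r := by
    intro i r
    simp [dl]
  have h2 : tor C j * phiI k l m - tor C k * phiI j l m + tor C l * phiI j k m -
      tor C m * phiI j k l = ∑ a, ∑ b, C (stdVec b) a *
    (dl b j * psiI a k l m + dl b k * psiI j a l m + dl b l * psiI j k a m + dl b m * psiI j k l a -
    (dl a j * psiI b k l m + dl a k * psiI j b l m + dl a l * psiI j k b m +
      dl a m * psiI j k l b)) := by
    simp only [tor, Finset.sum_mul, ← Finset.sum_sub_distrib, ← Finset.sum_add_distrib]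
    refine Finset.sum_congr rfl fun a _ => Finset.sum_congr rfl fun b _ => ?_
    have h1 : (phiI a b j * phiI k l m - phiI a b k * phiI j l m + phiI a b l * phiI j k m -
      phiI a b m * phiI j k l : ℝ) = dl b j * psiI a k l m + dl b k * psiI j a l m +
        dl b l * psiI j k a m + dl b m * psiI j k l a -
    (dl a j * psiI b k l m + dl a k * psiI j b l m + dl a l * psiI j k b m +
      dl a m * psiI j k l b) := by
      exact_mod_cast phiI_wedge_phiI j k hjk l hkl m hlm a b
    rw [← h1]
    ring
  have hs : ∀ a b, (fun a b => C (stdVec b) a) a b = -(fun a b => C (stdVec b) a) b a :=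
    fun a b => hC b a
  have s0 := sum_skew hs j fun p => psiI p k l m
  have s1 := sum_skew hs k fun p => psiI j p l m
  have s2 := sum_skew hs l fun p => psiI j k p m
  have s3 := sum_skew hs m fun p => psiI j k l p
  simp only at s0 s1 s2 s3
  simp only [hx, mul_add, mul_sub, Finset.sum_add_distrib, Finset.sum_sub_distrib, h0]
  simp only [mul_add, mul_sub, Finset.sum_add_distrib, Finset.sum_sub_distrib] at h2
  rw [s0.1, s0.2, s1.1, s1.2, s2.1, s2.2, s3.1, s3.2] at h2
  linarith

/-- The exterior derivative at a point of `α` written in a frame with connection matrix `A`. -/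
def torD {k : ℕ} (A : E7 →L[ℝ] E7 →L[ℝ] E7) (α : AltForm k) : AltForm (k + 1) :=
  alternatizeUncurryFin (α.fderivCompContinuousLinearMap (.id ℝ E7) ∘L A)

theorem torD_eq_sum {k : ℕ} (A : E7 →L[ℝ] E7 →L[ℝ] E7) (α : AltForm k) :
    torD A α = ∑ i, ext1 i (act (A (stdVec i)) α) := alternatize_eq_sum_ext1 _

theorem torD_three (A : E7 →L[ℝ] E7 →L[ℝ] E7) (α : AltForm 3) (x y z w : E7) :
    (torD A α : AltForm 4) ![x, y, z, w] = act (A x) α ![y, z, w] - act (A y) α ![x, z, w] +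
      act (A z) α ![x, y, w] - act (A w) α ![x, y, z] := alternatize_three _ x y z w

/-- The torsion form of a skew connection matrix, in the frame. -/
def torForm (B : E7 →L[ℝ] E7 →L[ℝ] E7) : AltForm 2 :=
  (1 / 2 : ℝ) • ∑ i, ∑ q, tor (B (stdVec i)) q • eform ![i, q]

theorem torForm_std (B : E7 →L[ℝ] E7 →L[ℝ] E7) (j k : Fin 7) :
    torForm B ![stdVec j, stdVec k] =
      (1 / 2 : ℝ) * (tor (B (stdVec j)) k - tor (B (stdVec k)) j) := by
  simp only [torForm, ContinuousAlternatingMap.smul_apply, ContinuousAlternatingMap.sum_apply,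
    smul_eq_mul, eform_two, stdVec_apply, mul_sub, Finset.sum_sub_distrib]
  simp

/-- Antisymmetrising `act_psi0_of_skew` over the direction gives `½ T_{iq} eⁱ ∧ e^q ∧ phi0`, so `dψ`
sees only the skew part of `T`. -/
theorem torD_psi0_of_skew {B : E7 →L[ℝ] E7 →L[ℝ] E7} (hB : ∀ v, IsSkew (B v)) :
    torD B psi0 = wedge23 (torForm B) phi0 := by
  rw [torD_eq_sum, torForm]
  simp only [map_smul, map_sum, LinearMap.smul_apply, LinearMap.sum_apply, wedge23_eform_left,
    ext2_apply, Finset.smul_sum]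
  refine Finset.sum_congr rfl fun i _ => ?_
  rw [act_psi0_of_skew (hB _)]
  simp only [map_smul, map_sum, Finset.smul_sum]

theorem psiI_contract₂_real (i j m n : Fin 7) : ∑ k, ∑ l, (psiI i j k l : ℝ) * psiI m n k l =
    4 * (dl i m * dl j n - dl i n * dl j m) + 2 * psiI i j m n := by
  exact_mod_cast psiI_contract₂ i j m n

theorem psiI_contract₃_real (i m : Fin 7) :
    ∑ j, ∑ k, ∑ l, (psiI i j k l : ℝ) * psiI m j k l = 24 * dl i m := by
  exact_mod_cast psiI_contract₃ i m

/-- Contract the closedness relation with `ψ_{pjkl}` over `j, k, l`. The first term gives `24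
t_{ip}`, and the other three coincide by skewness of `ψ`; each is evaluated by `psiI_contract₂`. -/
theorem contract_dphi (t : Fin 7 → Fin 7 → ℝ)
    (h : ∀ i j k l, ∑ q, (t i q * psiI q j k l - t j q * psiI q i k l + t k q * psiI q i j l -
      t l q * psiI q i j k) = 0) (i p : Fin 7) :
    12 * t i p + 12 * dl p i * ∑ j, t j j - 6 * ∑ j, ∑ q, t j q * psiI p j q i = 0 := by
  have hX : ∑ j, ∑ k, ∑ l, ∑ q, (psiI p j k l : ℝ) * (t j q * psiI q i k l) =
      4 * t i p - 4 * dl p i * ∑ j, t j j + 2 * ∑ j, ∑ q, t j q * psiI p j q i := by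
    have h1 : ∀ j, ∑ k, ∑ l, ∑ q, (psiI p j k l : ℝ) * (t j q * psiI q i k l) =
        ∑ q, t j q * (4 * (dl p q * dl j i - dl p i * dl j q) + 2 * psiI p j q i) := by
      intro j
      rw [sum_comm_four (fun k l q => (psiI p j k l : ℝ) * (t j q * psiI q i k l))]
      refine Finset.sum_congr rfl fun q _ => ?_
      rw [← psiI_contract₂_real, Finset.mul_sum]
      refine Finset.sum_congr rfl fun k _ => ?_
      rw [Finset.mul_sum]
      exact Finset.sum_congr rfl fun l _ => by ring
    simp only [h1, mul_add, mul_sub, Finset.sum_add_distrib, Finset.sum_sub_distrib]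
    have e1 : ∑ j, ∑ q, t j q * (4 * ((dl p q : ℝ) * dl j i)) = 4 * t i p := by
      simp [dl, mul_comm]
    have e2 : ∑ j, ∑ q, t j q * (4 * ((dl p i : ℝ) * dl j q)) = 4 * dl p i * ∑ j, t j j := by
      rw [Finset.mul_sum]
      refine Finset.sum_congr rfl fun j _ => ?_
      rw [Finset.sum_eq_single j]
      · simp only [dl, if_true, Int.cast_one, mul_one]
        ring
      · intro q _ hq
        simp [dl, Ne.symm hq]
      · simp
    have e3 : ∑ j, ∑ q, t j q * (2 * (psiI p j q i : ℝ)) = 2 * ∑ j, ∑ q, t j q * psiI p j q i := by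
      rw [Finset.mul_sum]
      refine Finset.sum_congr rfl fun j _ => ?_
      rw [Finset.mul_sum]
      exact Finset.sum_congr rfl fun q _ => by ring
    rw [e1, e2, e3]
  have h0 : ∑ j, ∑ k, ∑ l, (psiI p j k l : ℝ) * ∑ q, (t i q * psiI q j k l - t j q * psiI q i k l +
      t k q * psiI q i j l - t l q * psiI q i j k) = 0 := by
    simp only [h, mul_zero, Finset.sum_const_zero]
  simp only [Finset.mul_sum, mul_sub, mul_add, Finset.sum_add_distrib, Finset.sum_sub_distrib] at h0
  have a1 : ∑ j, ∑ k, ∑ l, ∑ q, (psiI p j k l : ℝ) * (t i q * psiI q j k l) = 24 * t i p := by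
    have : ∀ q, ∑ j, ∑ k, ∑ l, (psiI p j k l : ℝ) * (t i q * psiI q j k l) =
        t i q * (24 * dl p q) := by
      intro q
      rw [← psiI_contract₃_real]
      simp only [Finset.mul_sum]
      exact Finset.sum_congr rfl fun j _ => Finset.sum_congr rfl fun k _ =>
        Finset.sum_congr rfl fun l _ => by ring
    have h2 : ∑ j, ∑ k, ∑ l, ∑ q, (psiI p j k l : ℝ) * (t i q * psiI q j k l) =
        ∑ q, ∑ j, ∑ k, ∑ l, (psiI p j k l : ℝ) * (t i q * psiI q j k l) := by
      rw [Finset.sum_comm (γ := Fin 7) (f := fun q j => ∑ k, ∑ l, (psiI p j k l : ℝ) *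
        (t i q * psiI q j k l))]
      exact Finset.sum_congr rfl fun j _ => sum_comm_four _
    rw [h2]
    simp only [this]
    simp [dl, mul_comm]
  have a2 : ∑ j, ∑ k, ∑ l, ∑ q, (psiI p j k l : ℝ) * (t k q * psiI q i j l) =
      -∑ j, ∑ k, ∑ l, ∑ q, (psiI p j k l : ℝ) * (t j q * psiI q i k l) := by
    rw [Finset.sum_comm]
    simp only [← Finset.sum_neg_distrib]
    refine Finset.sum_congr rfl fun j _ => Finset.sum_congr rfl fun k _ =>
        Finset.sum_congr rfl fun l _ => Finset.sum_congr rfl fun q _ => ?_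
    rw [psiI_swap₂ p j k l]
    push_cast
    ring
  have a3 : ∑ j, ∑ k, ∑ l, ∑ q, (psiI p j k l : ℝ) * (t l q * psiI q i j k) =
      ∑ j, ∑ k, ∑ l, ∑ q, (psiI p j k l : ℝ) * (t j q * psiI q i k l) := by
    rw [sum_comm_four (fun j k l : Fin 7 => ∑ q, (psiI p j k l : ℝ) * (t l q * psiI q i j k))]
    refine Finset.sum_congr rfl fun j _ => Finset.sum_congr rfl fun k _ =>
        Finset.sum_congr rfl fun l _ => Finset.sum_congr rfl fun q _ => ?_
    rw [psiI_swap₃ p k j l, psiI_swap₂ p j k l, neg_neg]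
  rw [a1, a2, a3, hX] at h0
  linarith

/-- The `ψ`-term of `contract_dphi` is skew in `i, p`, so the symmetric part of `t` is `-δ tr t`.
Taking the trace gives `tr t = -7 tr t`, hence `tr t = 0` and `t` is skew. What remains is `2 t_{ip}
= t_{jq} ψ_{pjqi}`. Contracted with `φ` this says `2x = -4x` for the `Λ²₇`-component, which
therefore vanishes. -/
theorem skew_of_dphi (t : Fin 7 → Fin 7 → ℝ)
    (h : ∀ i j k l, ∑ q, (t i q * psiI q j k l - t j q * psiI q i k l + t k q * psiI q i j l -
      t l q * psiI q i j k) = 0) :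
    (∀ i p, t i p = -t p i) ∧ ∀ m, ∑ i, ∑ p, t i p * phiI i p m = 0 := by
  have h1 := contract_dphi t h
  have hY : ∀ i p, ∑ j, ∑ q, t j q * (psiI p j q i : ℝ) =
      -∑ j, ∑ q, t j q * (psiI i j q p : ℝ) := by
    intro i p
    simp only [← Finset.sum_neg_distrib]
    refine Finset.sum_congr rfl fun j _ => Finset.sum_congr rfl fun q _ => ?_
    have : psiI p j q i = -psiI i j q p := by
      rw [psiI_swap₁ j p q i, psiI_swap₂ j q p i, psiI_swap₃ j q i p, psiI_swap₂ j i q p,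
        psiI_swap₁ i j q p]
      ring
    rw [this]
    push_cast
    ring
  have hd : ∀ i p : Fin 7, dl i p = dl p i := by
    intro i p
    simp [dl, eq_comm]
  have h2 : ∀ i p, t i p + t p i = -2 * dl p i * ∑ j, t j j := by
    intro i p
    have := h1 i p
    have := h1 p i
    have := hY i p
    rw [hd i p] at *
    linarith
  have htr : ∑ j, t j j = 0 := by
    have h3 : ∀ i, t i i = -∑ j, t j j := by
      intro i
      have := h2 i i
      simp [dl] at this
      linarith
    have h4 : ∑ i, t i i = ∑ i : Fin 7, -∑ j, t j j := Finset.sum_congr rfl fun i _ => h3 i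
    simp only [Finset.sum_const, Finset.card_univ, Fintype.card_fin, nsmul_eq_mul] at h4
    push_cast at h4
    linarith
  refine ⟨fun i p => ?_, fun m => ?_⟩
  · have := h2 i p
    rw [htr] at this
    linarith
  · have h3 : ∀ i p, 2 * t i p = ∑ j, ∑ q, t j q * (psiI p j q i : ℝ) := by
      intro i p
      have := h1 i p
      rw [htr] at this
      linarith
    have h4 : ∀ j q, ∑ i, ∑ p, (psiI p j q i : ℝ) * phiI i p m = -4 * phiI j q m := by
      intro j q
      have h5 := psiI_phiI_contract_real j q m
      have h6 : ∑ i, ∑ p, (psiI p j q i : ℝ) * phiI i p m =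
          -∑ i, ∑ p, (psiI j q i p : ℝ) * phiI m i p := by
        simp only [← Finset.sum_neg_distrib]
        refine Finset.sum_congr rfl fun i _ => Finset.sum_congr rfl fun p _ => ?_
        have e1 : psiI p j q i = -psiI j q i p := by
          rw [psiI_swap₁ j p q i, psiI_swap₂ j q p i, psiI_swap₃ j q i p]
          ring
        rw [e1, ← phiI_rot m i p]
        push_cast
        ring
      rw [h6, h5]
      ring
    have h7 : 2 * ∑ i, ∑ p, t i p * (phiI i p m : ℝ) = -4 * ∑ i, ∑ p, t i p * (phiI i p m : ℝ) := by
      calc 2 * ∑ i, ∑ p, t i p * (phiI i p m : ℝ)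
          = ∑ i, ∑ p, (2 * t i p) * (phiI i p m : ℝ) := by
            simp only [Finset.mul_sum, mul_assoc]
        _ = ∑ i, ∑ p, ∑ j, ∑ q, t j q * ((psiI p j q i : ℝ) * phiI i p m) := by
            simp only [h3, Finset.sum_mul, mul_assoc]
        _ = ∑ j, ∑ q, ∑ i, ∑ p, t j q * ((psiI p j q i : ℝ) * phiI i p m) :=
            sum_comm_pairs fun i p j q => t j q * ((psiI p j q i : ℝ) * phiI i p m)
        _ = ∑ j, ∑ q, t j q * (-4 * phiI j q m) := by
            simp only [← Finset.mul_sum, h4]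
        _ = _ := by
            simp only [Finset.mul_sum]
            exact Finset.sum_congr rfl fun i _ => Finset.sum_congr rfl fun p _ => by ring
    linarith

/-- The torsion matrix of a skew connection matrix for which `phi0` is closed. -/
theorem torsion_of_closed {B : E7 →L[ℝ] E7 →L[ℝ] E7} (hB : ∀ v, IsSkew (B v))
    (h : torD B phi0 = 0) :
    (∀ i p, tor (B (stdVec i)) p = -tor (B (stdVec p)) i) ∧ IsLambda14 (torForm B) := by
  have h1 : ∀ i j k l, act (B (stdVec i)) phi0 ![stdVec j, stdVec k, stdVec l] =
      (-1 / 2 : ℝ) * ∑ q, tor (B (stdVec i)) q * psiI q j k l := by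
    intro i j k l
    rw [act_phi0_of_skew (hB _)]
    simp only [ContinuousAlternatingMap.smul_apply, ContinuousAlternatingMap.sum_apply,
      smul_eq_mul, intProd_four, psi0_std]
  have h2 := skew_of_dphi (fun i q => tor (B (stdVec i)) q) fun i j k l => by
    have h3 := torD_three B phi0 (stdVec i) (stdVec j) (stdVec k) (stdVec l)
    rw [h, h1, h1, h1, h1, zero_form_apply] at h3
    simp only [Finset.sum_add_distrib, Finset.sum_sub_distrib]
    linarith
  refine ⟨h2.1, fun m => ?_⟩
  rw [← h2.2 m]
  refine Finset.sum_congr rfl fun i _ => Finset.sum_congr rfl fun p _ => ?_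
  rw [torForm_std, h2.1 p i]
  ring

theorem torForm_std_of_closed {B : E7 →L[ℝ] E7 →L[ℝ] E7} (hB : ∀ v, IsSkew (B v))
    (h : torD B phi0 = 0) (i p : Fin 7) :
    torForm B ![stdVec i, stdVec p] = tor (B (stdVec i)) p := by
  rw [torForm_std, (torsion_of_closed hB h).1 p i]
  ring

/-- On `Λ²₁₄` wedging with `phi0` is `-*`, which is injective. -/
theorem IsLambda14.eq_zero {τ : AltForm 2} (hτ : IsLambda14 τ) (h : wedge23 τ phi0 = 0) :
    τ = 0 := by
  rw [hτ.wedge_phi0, neg_eq_zero] at h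
  rw [← star0_two_five τ, h, ← star0L_apply, map_zero]

/-- Closedness puts `T` in `Λ²₁₄`, coclosedness gives `T ∧ phi0 = 0`, so `T = 0`. -/
theorem act_phi0_eq_zero {B : E7 →L[ℝ] E7 →L[ℝ] E7} (hB : ∀ v, IsSkew (B v))
    (h : torD B phi0 = 0) (h' : torD B psi0 = 0) (i : Fin 7) : act (B (stdVec i)) phi0 = 0 := by
  rw [torD_psi0_of_skew hB] at h'
  have h1 := (torsion_of_closed hB h).2.eq_zero h'
  rw [act_phi0_of_skew (hB _)]
  have h2 : ∀ q, tor (B (stdVec i)) q = 0 := by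
    intro q
    rw [← torForm_std_of_closed hB h, h1, zero_form_apply]
  simp [h2]

/-- If `B` kills `phi0`, then `T_{iq} ψ_{qjkl} = 0`. Contraction with `ψ_{pjkl}` gives `24 T_{ip} =
0`, so `B` kills `psi0` as well. -/
theorem torD_eq_zero {B : E7 →L[ℝ] E7 →L[ℝ] E7} (hB : ∀ v, IsSkew (B v))
    (h : ∀ i, act (B (stdVec i)) phi0 = 0) : torD B phi0 = 0 ∧ torD B psi0 = 0 := by
  have h1 : ∀ i q, tor (B (stdVec i)) q = 0 := by
    intro i p
    have h2 : ∀ j k l, ∑ q, tor (B (stdVec i)) q * (psiI q j k l : ℝ) = 0 := by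
      intro j k l
      have h3 := h i
      rw [act_phi0_of_skew (hB _)] at h3
      have h4 := congrArg (fun β : AltForm 3 => β ![stdVec j, stdVec k, stdVec l]) h3
      simp only [ContinuousAlternatingMap.smul_apply, ContinuousAlternatingMap.sum_apply,
        smul_eq_mul, intProd_four, psi0_std, zero_form_apply] at h4
      linarith
    have h5 : ∑ j, ∑ k, ∑ l, (∑ q, tor (B (stdVec i)) q * (psiI q j k l : ℝ)) * psiI p j k l =
        ∑ q, tor (B (stdVec i)) q * (24 * dl q p) := by
      simp only [← psiI_contract₃_real, Finset.sum_mul, Finset.mul_sum, mul_assoc]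
      rw [Finset.sum_comm (γ := Fin 7) (f := fun q j => ∑ k, ∑ l, tor (B (stdVec i)) q *
        ((psiI q j k l : ℝ) * psiI p j k l))]
      exact Finset.sum_congr rfl fun j _ => sum_comm_four _
    simp only [h2, zero_mul, Finset.sum_const_zero] at h5
    simp [dl] at h5
    exact h5
  constructor
  · rw [torD_eq_sum]
    simp [h]
  · rw [torD_eq_sum]
    simp [act_psi0_of_skew (hB _), h1]

end

end G2

/-! ### The contraction of `dτ` with `phi0`, and the skew normalisation of connection matrices. -/

namespace G2

noncomputable section

open ContinuousAlternatingMap hiding map_sum map_zero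

/-- As `C` is skew, it can be moved from `σ` to `φ` with a sign. The extra term, where `C` rotates
the free index, vanishes because `σ ∈ Λ²₁₄`. The rest follows from `act_phi0_of_skew` and the
eigenvalue -2 of `IsLambda14.sum_psiI`. -/
theorem sum_act_mul_phiI {C : E7 →L[ℝ] E7} (hC : IsSkew C) {σ : AltForm 2} (hσ : IsLambda14 σ)
    (i : Fin 7) : ∑ j, ∑ k, act C σ ![stdVec j, stdVec k] * phiI j k i =
      ∑ q, tor C q * σ ![stdVec i, stdVec q] := by
  have h1 : ∑ j, ∑ k, act C σ ![stdVec j, stdVec k] * phiI j k i =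
      -∑ j, ∑ k, σ ![stdVec j, stdVec k] * act C phi0 ![stdVec j, stdVec k, stdVec i] := by
    have e1 : ∀ j k, act C σ ![stdVec j, stdVec k] =
        ∑ m, C (stdVec j) m * σ ![stdVec m, stdVec k] +
        ∑ m, C (stdVec k) m * σ ![stdVec j, stdVec m] := by
      intro j k
      rw [act_two, two_left, two_right _ _ (C (stdVec k))]
    have e2 : ∀ j k, act C phi0 ![stdVec j, stdVec k, stdVec i] =
        ∑ m, C (stdVec j) m * phiI m k i + ∑ m, C (stdVec k) m * phiI j m i +
          ∑ m, C (stdVec i) m * phiI j k m := by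
      intro j k
      rw [act_three, three_zero, three_one _ _ (C (stdVec k)), three_two _ _ _ (C (stdVec i))]
      simp only [phi0_std]
    have e3 : ∑ j, ∑ k, σ ![stdVec j, stdVec k] * ∑ m, C (stdVec i) m * phiI j k m = 0 := by
      have : ∑ m, C (stdVec i) m * ∑ j, ∑ k, σ ![stdVec j, stdVec k] * (phiI j k m : ℝ) = 0 := by
        refine Finset.sum_eq_zero fun m _ => ?_
        rw [hσ m, mul_zero]
      rw [← this]
      simp only [Finset.mul_sum]
      rw [sum_comm_four]
      exact Finset.sum_congr rfl fun m _ => Finset.sum_congr rfl fun j _ =>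
        Finset.sum_congr rfl fun k _ => by ring
    have e4 : ∑ j, ∑ k, (∑ m, C (stdVec j) m * σ ![stdVec m, stdVec k]) * (phiI j k i : ℝ) =
        -∑ j, ∑ k, σ ![stdVec j, stdVec k] * ∑ m, C (stdVec j) m * (phiI m k i : ℝ) := by
      simp only [Finset.sum_mul, Finset.mul_sum, ← Finset.sum_neg_distrib]
      rw [Finset.sum_comm]
      conv_rhs => rw [Finset.sum_comm]
      refine Finset.sum_congr rfl fun k _ => ?_
      rw [Finset.sum_comm]
      refine Finset.sum_congr rfl fun j _ => Finset.sum_congr rfl fun m _ => ?_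
      rw [hC m j]
      ring
    have e5 : ∑ j, ∑ k, (∑ m, C (stdVec k) m * σ ![stdVec j, stdVec m]) * (phiI j k i : ℝ) =
        -∑ j, ∑ k, σ ![stdVec j, stdVec k] * ∑ m, C (stdVec k) m * (phiI j m i : ℝ) := by
      simp only [Finset.sum_mul, Finset.mul_sum, ← Finset.sum_neg_distrib]
      refine Finset.sum_congr rfl fun j _ => ?_
      rw [Finset.sum_comm]
      refine Finset.sum_congr rfl fun k _ => Finset.sum_congr rfl fun m _ => ?_
      rw [hC m k]
      ring
    simp only [e1, e2, add_mul, mul_add, Finset.sum_add_distrib]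
    rw [e3, e4, e5]
    ring
  have h2 : ∀ j k, act C phi0 ![stdVec j, stdVec k, stdVec i] =
      (-1 / 2 : ℝ) * ∑ q, tor C q * psiI j k q i := by
    intro j k
    rw [act_phi0_of_skew hC]
    simp only [ContinuousAlternatingMap.smul_apply, ContinuousAlternatingMap.sum_apply,
      smul_eq_mul, intProd_four, psi0_std]
    have : ∀ q, psiI q j k i = psiI j k q i := by
      intro q
      rw [psiI_swap₁ j q k i, psiI_swap₂ j k q i, neg_neg]
    simp only [this]
  rw [h1]
  simp only [h2, Finset.mul_sum]
  rw [sum_comm_four, ← Finset.sum_neg_distrib]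
  refine Finset.sum_congr rfl fun q _ => ?_
  have h3 := hσ.sum_psiI q i
  have h4 : ∑ j, ∑ k, σ ![stdVec j, stdVec k] * (-1 / 2 * (tor C q * (psiI j k q i : ℝ))) =
      (-1 / 2 * tor C q) * ∑ j, ∑ k, σ ![stdVec j, stdVec k] * (psiI j k q i : ℝ) := by
    simp only [Finset.mul_sum]
    exact Finset.sum_congr rfl fun j _ => Finset.sum_congr rfl fun k _ => by ring
  rw [h4, h3, two_swap σ (stdVec i) (stdVec q)]
  ring

/-- Contract with `φ_{ijk}`. On the right `φ_{ijk} φ_{ijk} = 42`, and the three terms of the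
antisymmetrisation contribute equally, which leaves `42 / 3 = 14`. -/
theorem contract_alternatize (f : E7 →L[ℝ] AltForm 2) (c : ℝ)
    (h : (alternatizeUncurryFin f : AltForm 3) = c • phi0) :
    ∑ i, ∑ j, ∑ k, f (stdVec i) ![stdVec j, stdVec k] * phiI j k i = 14 * c := by
  have h1 : ∀ i j k, f (stdVec i) ![stdVec j, stdVec k] - f (stdVec j) ![stdVec i, stdVec k] +
      f (stdVec k) ![stdVec i, stdVec j] = c * phiI i j k := by
    intro i j k
    rw [← alternatize_two, h, ContinuousAlternatingMap.smul_apply, smul_eq_mul, phi0_std]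
  have h2 : ∑ i, ∑ j, ∑ k, (f (stdVec i) ![stdVec j, stdVec k] -
      f (stdVec j) ![stdVec i, stdVec k] + f (stdVec k) ![stdVec i, stdVec j]) * phiI i j k =
      42 * c := by
    have h3 : ∀ i, ∑ j, ∑ k, (c * phiI i j k) * (phiI i j k : ℝ) = 6 * c := by
      intro i
      have := phiI_contract₂_real i i
      simp only [dl, if_true, Int.cast_one, mul_one] at this
      simp only [mul_assoc, ← Finset.mul_sum, this]
      ring
    simp only [h1, h3]
    simp
    ring
  simp only [add_mul, sub_mul, Finset.sum_add_distrib, Finset.sum_sub_distrib] at h2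
  have a1 : ∑ i, ∑ j, ∑ k, f (stdVec i) ![stdVec j, stdVec k] * (phiI i j k : ℝ) =
      ∑ i, ∑ j, ∑ k, f (stdVec i) ![stdVec j, stdVec k] * (phiI j k i : ℝ) := by
    simp only [phiI_rot]
  have a2 : ∑ i, ∑ j, ∑ k, f (stdVec j) ![stdVec i, stdVec k] * (phiI i j k : ℝ) =
      -∑ i, ∑ j, ∑ k, f (stdVec i) ![stdVec j, stdVec k] * (phiI j k i : ℝ) := by
    rw [Finset.sum_comm]
    simp only [← Finset.sum_neg_distrib]
    refine Finset.sum_congr rfl fun i _ => Finset.sum_congr rfl fun j _ =>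
      Finset.sum_congr rfl fun k _ => ?_
    rw [phiI_swap₁ i j k, ← phiI_rot i j k]
    push_cast
    ring
  have a3 : ∑ i, ∑ j, ∑ k, f (stdVec k) ![stdVec i, stdVec j] * (phiI i j k : ℝ) =
      ∑ i, ∑ j, ∑ k, f (stdVec i) ![stdVec j, stdVec k] * (phiI j k i : ℝ) :=
    sum_comm_four fun i j k => f (stdVec k) ![stdVec i, stdVec j] * (phiI i j k : ℝ)
  rw [a1, a2, a3] at h2
  linarith

theorem add_fderivComp_apply {k : ℕ} (s : E7 →L[ℝ] AltForm k) (σ : AltForm k)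
    (B : E7 →L[ℝ] E7 →L[ℝ] E7) (x : E7) (v : Fin k → E7) :
    (s + σ.fderivCompContinuousLinearMap (.id ℝ E7) ∘L B) x v = s x v + act (B x) σ v := rfl

/-- The norm of the torsion form, from its exterior derivative. -/
theorem torForm_norm {B : E7 →L[ℝ] E7 →L[ℝ] E7} (hB : ∀ v, IsSkew (B v))
    (h : torD B phi0 = 0) {s : E7 →L[ℝ] AltForm 2} (hs : ∀ v, IsLambda14 (s v)) {c : ℝ}
    (hc : alternatizeUncurryFin s + torD B (torForm B) = c • phi0) :
    7 * c = (1 / 2 : ℝ) * ∑ j, ∑ k, torForm B ![stdVec j, stdVec k] ^ 2 := by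
  have h1 := torsion_of_closed hB h
  rw [torD, ← alternatizeUncurryFin_add] at hc
  have h2 := contract_alternatize _ c hc
  have h3 : ∀ i, ∑ j, ∑ k, (s + (torForm B).fderivCompContinuousLinearMap (.id ℝ E7) ∘L B)
      (stdVec i) ![stdVec j, stdVec k] * (phiI j k i : ℝ) =
      ∑ q, torForm B ![stdVec i, stdVec q] ^ 2 := by
    intro i
    -- The componentwise derivative `s` takes values in `Λ²₁₄` and drops out; the action of `B`
    -- leaves `T_{iq} τ_{iq}`, where `T = τ`.
    simp only [add_fderivComp_apply, add_mul, Finset.sum_add_distrib, hs (stdVec i) i, zero_add]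
    rw [sum_act_mul_phiI (hB _) h1.2]
    refine Finset.sum_congr rfl fun q _ => ?_
    rw [← torForm_std_of_closed hB h]
    ring
  simp only [h3] at h2
  linarith

/-- The continuous bilinear map with given components. -/
def ofComponents (s : Fin 7 → Fin 7 → Fin 7 → ℝ) : E7 →L[ℝ] E7 →L[ℝ] E7 :=
  ∑ i, ∑ j, ∑ m, s m i j • (EuclideanSpace.proj i : E7 →L[ℝ] ℝ).smulRight
    ((EuclideanSpace.proj j : E7 →L[ℝ] ℝ).smulRight (stdVec m))

theorem ofComponents_apply (s : Fin 7 → Fin 7 → Fin 7 → ℝ) (x y : E7) :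
    ofComponents s x y = ∑ i, ∑ j, ∑ m, (s m i j * (x i * y j)) • stdVec m := by
  have h : ∀ (i : Fin 7) (x : E7), (EuclideanSpace.proj i : E7 →L[ℝ] ℝ) x = x i := fun _ _ => rfl
  simp only [ofComponents, _root_.sum_apply, _root_.smul_apply, ContinuousLinearMap.smulRight_apply,
    h, smul_smul, mul_assoc]

theorem ofComponents_std (s : Fin 7 → Fin 7 → Fin 7 → ℝ) (i j m : Fin 7) :
    ofComponents s (stdVec i) (stdVec j) m = s m i j := by
  rw [ofComponents_apply]
  simp [Finset.sum_apply]

theorem isSkew_of_std {B : E7 →L[ℝ] E7 →L[ℝ] E7} (h : ∀ i, IsSkew (B (stdVec i))) (v : E7) :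
    IsSkew (B v) := by
  intro j m
  rw [← sum_stdVec v]
  simp only [map_sum, map_smul, _root_.sum_apply, _root_.smul_apply, PiLp.smul_apply,
    WithLp.ofLp_sum, Finset.sum_apply, smul_eq_mul, ← Finset.sum_neg_distrib]
  refine Finset.sum_congr rfl fun i _ => ?_
  rw [h i j m]
  ring

/-- A symmetric bilinear term behaves like the second derivative of a coordinate change, which the
exterior derivative does not see. -/
theorem torD_eq_of_symm {k : ℕ} {A B S : E7 →L[ℝ] E7 →L[ℝ] E7} (hS : ∀ x y, S x y = S y x)
    (h : A = B + S) (α : AltForm k) : torD A α = torD B α := by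
  rw [torD, torD, h, ContinuousLinearMap.comp_add, alternatizeUncurryFin_add,
    alternatizeUncurryFin_fderivCompContinuousLinearMap_eq_zero α _ hS, add_zero]

/-- Any connection matrix becomes skew after subtracting a symmetric one. -/
theorem exists_skew_add_symm (A : E7 →L[ℝ] E7 →L[ℝ] E7) :
    ∃ B S : E7 →L[ℝ] E7 →L[ℝ] E7, (∀ v, IsSkew (B v)) ∧ (∀ x y, S x y = S y x) ∧ A = B + S := by
  let a : Fin 7 → Fin 7 → Fin 7 → ℝ := fun m i j => A (stdVec i) (stdVec j) m
  -- The Koszul formula, for a metric that is standard at the point and whose first derivatives are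
  -- `∂_i g_{jm} = a m i j + a j i m`.
  let S := ofComponents fun m i j => (1 / 2 : ℝ) * ((a m i j + a j i m) + (a m j i + a i j m) -
    (a i m j + a j m i))
  refine ⟨A - S, S, isSkew_of_std fun i j m => ?_, fun x y => ?_, (sub_add_cancel A S).symm⟩
  · have h1 : ∀ j m, (A - S) (stdVec i) (stdVec j) m = a m i j - (1 / 2 : ℝ) *
        ((a m i j + a j i m) + (a m j i + a i j m) - (a i m j + a j m i)) := by
      intro j m
      rw [← ofComponents_std (fun m i j => (1 / 2 : ℝ) * ((a m i j + a j i m) +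
        (a m j i + a i j m) - (a i m j + a j m i))) i j m]
      rfl
    rw [h1, h1]
    ring
  · simp only [S, ofComponents_apply]
    rw [Finset.sum_comm]
    refine Finset.sum_congr rfl fun i _ => Finset.sum_congr rfl fun j _ =>
      Finset.sum_congr rfl fun m _ => ?_
    congr 1
    ring

end

end G2

namespace G2

noncomputable section

open ContinuousAlternatingMap hiding map_sum map_zero

/-! ### Smooth maps to spaces of forms -/

section

variable {V : Type*} [NormedAddCommGroup V] [NormedSpace ℝ V]

theorem contDiffAt_form {k : ℕ} {n : WithTop ℕ∞} {f : V → AltForm k} {y : V}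
    (h : ∀ J : Fin k → Fin 7, ContDiffAt ℝ n (fun z => f z (fun a => stdVec (J a))) y) :
    ContDiffAt ℝ n f y := by
  classical
  have h1 : f = fun z => ∑ I : Fin k → Fin 7 with StrictMono I,
      f z (fun a => stdVec (I a)) • eform I := funext fun z => by
    convert altForm_eq_sum (f z)
  rw [h1]
  exact ContDiffAt.sum fun I _ => (h I).smul contDiffAt_const

theorem contDiffAt_form_apply {k : ℕ} {n : WithTop ℕ∞} {f : V → AltForm k} {y : V}
    (h : ContDiffAt ℝ n f y) (v : Fin k → E7) : ContDiffAt ℝ n (fun z => f z v) y :=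
  (ContinuousAlternatingMap.apply ℝ E7 ℝ v).contDiff.contDiffAt.comp y h

theorem contDiffAt_coord {n : WithTop ℕ∞} {f : V → E7} {y : V}
    (h : ContDiffAt ℝ n f y) (m : Fin 7) : ContDiffAt ℝ n (fun z => f z m) y :=
  (EuclideanSpace.proj m : E7 →L[ℝ] ℝ).contDiff.contDiffAt.comp y h

/-- In the standard basis a pullback is polynomial in the matrix entries and linear in the
components of the form. -/
theorem contDiffAt_comp {k : ℕ} {n : WithTop ℕ∞} {f : V → AltForm k} {u : V → E7 →L[ℝ] E7}
    {y : V} (hf : ContDiffAt ℝ n f y) (hu : ContDiffAt ℝ n u y) :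
    ContDiffAt ℝ n (fun z => (f z).compContinuousLinearMap (u z)) y := by
  refine contDiffAt_form fun J => ?_
  have h1 : (fun z => (f z).compContinuousLinearMap (u z) (fun a => stdVec (J a))) = fun z =>
      ∑ K : Fin k → Fin 7, (∏ a, u z (stdVec (J a)) (K a)) * f z (fun a => stdVec (K a)) :=
    funext fun z => multilinear_expand (f z).toMultilinearMap (u z) J
  rw [h1]
  refine ContDiffAt.sum fun K _ => ContDiffAt.mul (contDiffAt_prod fun a _ => ?_)
    (contDiffAt_form_apply hf _)
  exact contDiffAt_coord (hu.clm_apply contDiffAt_const) _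

end

/-! ### A linear right inverse of `B ↦ act B phi0` -/

/-- An endomorphism mapped to `e^I` by the infinitesimal action on `phi0`. -/
def liftE (I : Fin 3 → Fin 7) : E7 →L[ℝ] E7 :=
  ∑ j, ∑ m, ((1 / 36 : ℝ) * liftI (I 0) (I 1) (I 2) m j) •
    (EuclideanSpace.proj j : E7 →L[ℝ] ℝ).smulRight (stdVec m)

theorem liftE_std (I : Fin 3 → Fin 7) (j m : Fin 7) :
    liftE I (stdVec j) m = (1 / 36 : ℝ) * liftI (I 0) (I 1) (I 2) m j := by
  have h : ∀ (i : Fin 7) (x : E7), (EuclideanSpace.proj i : E7 →L[ℝ] ℝ) x = x i := fun _ _ => rfl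
  simp only [liftE, _root_.sum_apply, _root_.smul_apply, ContinuousLinearMap.smulRight_apply, h,
    stdVec_apply]
  simp [Finset.sum_apply]

theorem act_liftE {I : Fin 3 → Fin 7} (hI : StrictMono I) : act (liftE I) phi0 = eform I := by
  refine altForm_ext fun J hJ => ?_
  have hI' : eform I = eform ![I 0, I 1, I 2] := by
    congr 1
    exact vec_three id I
  rw [vec_three, act_three, three_zero, three_one _ _ (liftE I (stdVec (J 1))),
    three_two _ _ _ (liftE I (stdVec (J 2))), hI', eform_three_std]
  simp only [phi0_std, liftE_std]
  have h := liftI_act (I 0) (I 1) (hI (by decide)) (I 2) (hI (by decide)) (J 0) (J 1)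
    (hJ (by decide)) (J 2) (hJ (by decide))
  have h' : ∑ m, ((liftI (I 0) (I 1) (I 2) m (J 0) : ℝ) * phiI m (J 1) (J 2) +
      liftI (I 0) (I 1) (I 2) m (J 1) * phiI (J 0) m (J 2) +
      liftI (I 0) (I 1) (I 2) m (J 2) * phiI (J 0) (J 1) m) =
        36 * triI (I 0) (I 1) (I 2) (J 0) (J 1) (J 2) := by
    exact_mod_cast h
  simp only [mul_assoc, ← Finset.mul_sum]
  simp only [Finset.sum_add_distrib] at h'
  linarith

open Classical in
/-- A linear right inverse of `B ↦ act B phi0`. -/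
def liftForm : AltForm 3 →L[ℝ] E7 →L[ℝ] E7 :=
  ∑ I : Fin 3 → Fin 7 with StrictMono I,
    (ContinuousAlternatingMap.apply ℝ E7 ℝ fun a => stdVec (I a)).smulRight (liftE I)

theorem act_liftForm (χ : AltForm 3) : act (liftForm χ) phi0 = χ := by
  classical
  have h : ∀ B, act B phi0 = phi0.fderivCompContinuousLinearMap (.id ℝ E7) B := fun _ => rfl
  rw [h, liftForm]
  simp only [_root_.sum_apply, ContinuousLinearMap.smulRight_apply,
    ContinuousAlternatingMap.apply_apply, map_sum, map_smul]
  conv_rhs => rw [altForm_eq_sum χ]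
  refine Finset.sum_congr (by congr) fun I hI => ?_
  rw [← h, act_liftE (Finset.mem_filter.1 hI).2]

/-! ### Local frames -/

theorem exists_local_right_inverse {V : Type*} [NormedAddCommGroup V] [NormedSpace ℝ V]
    [CompleteSpace V] {F : V → V} {p : V} (hF : F 0 = p) (hcd : ContDiffAt ℝ ∞ F 0)
    (hder : HasFDerivAt F (.id ℝ V) 0) :
    ∃ G : V → V, G p = 0 ∧ ContDiffAt ℝ ∞ G p ∧ ∀ᶠ z in nhds p, F (G z) = z := by
  have hn : (∞ : WithTop ℕ∞) ≠ 0 := by simp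
  have hder' : HasFDerivAt F ((ContinuousLinearEquiv.refl ℝ V : V ≃L[ℝ] V) : V →L[ℝ] V) 0 := hder
  subst hF
  exact ⟨hcd.localInverse hder' hn, hcd.localInverse_apply_image hder' hn,
    hcd.to_localInverse hder' hn, (hcd.hasStrictFDerivAt' hder' hn).eventually_right_inverse⟩

/-- Pullback of `phi0` by the endomorphisms in the image of `liftForm`. -/
def frameMap (χ : AltForm 3) : AltForm 3 := phi0.compContinuousLinearMap (.id ℝ E7 + liftForm χ)

/-- The derivative of `B ↦ (1 + B)^* phi0` at 0 is `B ↦ act B phi0`, and `liftForm` was built as its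
right inverse. -/
theorem hasFDerivAt_frameMap : HasFDerivAt frameMap (.id ℝ (AltForm 3)) 0 := by
  have h1 : HasFDerivAt (fun χ : AltForm 3 => ContinuousLinearMap.id ℝ E7 + liftForm χ)
    liftForm 0 := liftForm.hasFDerivAt.const_add _
  have h0 : HasFDerivAt (fun _ : AltForm 3 => phi0)
    (0 : AltForm 3 →L[ℝ] AltForm 3) 0 := hasFDerivAt_const phi0 0
  have h2 := HasFDerivAt.continuousAlternatingMapCompContinuousLinearMap h0 h1
  refine h2.congr_fderiv (ContinuousLinearMap.ext fun χ => ?_)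
  rw [ContinuousLinearMap.comp_zero, zero_add, map_zero, add_zero, ContinuousLinearMap.id_apply]
  exact act_liftForm χ

theorem contDiffAt_frameMap : ContDiffAt ℝ ∞ frameMap 0 :=
  contDiffAt_comp contDiffAt_const (contDiffAt_const.add liftForm.contDiff.contDiffAt)

theorem frameMap_zero : frameMap 0 = phi0 := by
  rw [frameMap, map_zero, add_zero, comp_id]

theorem contDiffAt_id_add_liftForm {G : AltForm 3 → AltForm 3} {p : AltForm 3}
    (hG : ContDiffAt ℝ ∞ G p) : ContDiffAt ℝ ∞ (fun χ => .id ℝ E7 + liftForm (G χ)) p :=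
  contDiffAt_const.add (liftForm.contDiff.contDiffAt.comp _ hG)

/-- A smooth local section of `u ↦ u^* phi0`. Restricting to endomorphisms in the image of
`liftForm` turns the submersion into a map from 3-forms to 3-forms with identity derivative, so the
inverse function theorem applies. -/
theorem exists_frame_phi0 : ∃ U : AltForm 3 → E7 →L[ℝ] E7, U phi0 = .id ℝ E7 ∧
    ContDiffAt ℝ ∞ U phi0 ∧
    ∀ᶠ χ in nhds phi0, phi0.compContinuousLinearMap (U χ) = χ := by
  have h1 := exists_local_right_inverse frameMap_zero contDiffAt_frameMap hasFDerivAt_frameMap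
  obtain ⟨G, hG, hGd, hGe⟩ := h1
  refine ⟨fun χ => .id ℝ E7 + liftForm (G χ), ?_, contDiffAt_id_add_liftForm hGd, ?_⟩
  · beta_reduce
    rw [hG, map_zero, add_zero]
  · simp only [frameMap] at hGe
    exact hGe

theorem exists_local_frame {w : E7 → AltForm 3} {y : E7} (hw : ContDiffAt ℝ ∞ w y)
    {e : E7 ≃L[ℝ] E7} (he : w y = phi0.compContinuousLinearMap (e : E7 →L[ℝ] E7)) :
    ∃ u : E7 → E7 →L[ℝ] E7, ContDiffAt ℝ ∞ u y ∧ u y = e ∧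
      ∀ᶠ z in nhds y, w z = phi0.compContinuousLinearMap (u z) := by
  obtain ⟨U, hU0, hU, hUe⟩ := exists_frame_phi0
  let χ : E7 → AltForm 3 := fun z => (w z).compContinuousLinearMap (e.symm : E7 →L[ℝ] E7)
  have hχy : χ y = phi0 := by
    change (w y).compContinuousLinearMap (e.symm : E7 →L[ℝ] E7) = phi0
    rw [he, comp_symm']
  have hχ : ContDiffAt ℝ ∞ χ y := contDiffAt_comp hw contDiffAt_const
  refine ⟨fun z => U (χ z) ∘L (e : E7 →L[ℝ] E7), ?_, ?_, ?_⟩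
  · refine ContDiffAt.clm_comp ?_ contDiffAt_const
    exact ContDiffAt.comp y (hχy.symm ▸ hU) hχ
  · simp only [hχy, hU0, ContinuousLinearMap.id_comp]
  · have h1 : Filter.Tendsto χ (nhds y) (nhds phi0) := hχy ▸ hχ.continuousAt
    filter_upwards [h1.eventually hUe] with z hz
    rw [← comp_comp, hz]
    exact (comp_symm _ _).symm

/-- The inverse of a smooth family of linear isomorphisms. -/
theorem eventually_equiv {u : E7 → E7 →L[ℝ] E7} {y : E7} (hu : ContDiffAt ℝ ∞ u y)
    {e : E7 ≃L[ℝ] E7} (he : u y = e) :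
    ∃ f : E7 → E7 ≃L[ℝ] E7, (∀ᶠ z in nhds y, (f z : E7 →L[ℝ] E7) = u z) ∧
      ContDiffAt ℝ ∞ (fun z => ((f z).symm : E7 →L[ℝ] E7)) y := by
  have h1 : ∀ᶠ z in nhds y, ∃ f : E7 ≃L[ℝ] E7, (f : E7 →L[ℝ] E7) = u z := by
    have := hu.continuousAt (he ▸ e.nhds : _ ∈ nhds (u y))
    exact this
  classical
  let f : E7 → E7 ≃L[ℝ] E7 := fun z =>
    if h : ∃ f : E7 ≃L[ℝ] E7, (f : E7 →L[ℝ] E7) = u z then h.choose else e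
  have h2 : ∀ᶠ z in nhds y, (f z : E7 →L[ℝ] E7) = u z := by
    filter_upwards [h1] with z hz
    simp only [f, dif_pos hz]
    exact hz.choose_spec
  refine ⟨f, h2, ?_⟩
  have h3 : ContDiffAt ℝ ∞ (fun z => ContinuousLinearMap.inverse (u z)) y :=
    ContDiffAt.comp (g := ContinuousLinearMap.inverse) y (he ▸ contDiffAt_map_inverse e) hu
  refine h3.congr_of_eventuallyEq ?_
  filter_upwards [h2] with z hz
  rw [← hz, ContinuousLinearMap.inverse_equiv]

theorem contDiffAt_star0 {k l : ℕ} (h : k + l = 7) {β : E7 → AltForm k} {y : E7}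
    (hβ : ContDiffAt ℝ ∞ β y) : ContDiffAt ℝ ∞ (fun z => star0 h (β z)) y := by
  refine contDiffAt_form fun J => ?_
  simp only [star0_eq, starVol_apply]
  exact contDiffAt_const.mul (ContDiffAt.sum fun I _ =>
    (contDiffAt_form_apply hβ _).mul contDiffAt_const)

/-- In an adapted frame the star is conjugate to the constant operator `star0`, so it depends
smoothly on the 3-form. -/
theorem contDiffAt_hodgeStar {k l : ℕ} (h : k + l = 7) {w : E7 → AltForm 3} {β : E7 → AltForm k}
    {y : E7} (hw : ContDiffAt ℝ ∞ w y) (hp : IsPositive (w y)) (hβ : ContDiffAt ℝ ∞ β y) :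
    ContDiffAt ℝ ∞ (fun z => hodgeStar (w z) h (β z)) y := by
  obtain ⟨e, he⟩ := hp
  obtain ⟨u, hu, hue, hev⟩ := exists_local_frame hw he
  obtain ⟨f, hf, hfs⟩ := eventually_equiv hu hue
  have h1 : ContDiffAt ℝ ∞ (fun z => (star0 h ((β z).compContinuousLinearMap
      ((f z).symm : E7 →L[ℝ] E7))).compContinuousLinearMap (u z)) y :=
    contDiffAt_comp (contDiffAt_star0 h (contDiffAt_comp hβ hfs)) hu
  refine h1.congr_of_eventuallyEq ?_
  filter_upwards [hev, hf] with z hz hfz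
  rw [hz, ← hfz, ← hodgeStar_comp, comp_symm]

end

end G2

namespace G2

noncomputable section

open ContinuousAlternatingMap hiding map_sum map_zero

/-! ### Exterior derivatives in a local frame -/

/-- The connection matrix of a frame with value `e` and derivative `u'` at a point. -/
def connMatrix (e : E7 ≃L[ℝ] E7) (u' : E7 →L[ℝ] E7 →L[ℝ] E7) : E7 →L[ℝ] E7 →L[ℝ] E7 :=
  ((e.symm : E7 →L[ℝ] E7).precomp E7) ∘L u' ∘L (e.symm : E7 →L[ℝ] E7)

theorem connMatrix_apply (e : E7 ≃L[ℝ] E7) (u' : E7 →L[ℝ] E7 →L[ℝ] E7) (v x : E7) :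
    connMatrix e u' v x = u' (e.symm v) (e.symm x) := rfl

theorem fderivComp_eq_act {k : ℕ} (σ : AltForm k) (e : E7 ≃L[ℝ] E7) (B : E7 →L[ℝ] E7) :
    σ.fderivCompContinuousLinearMap (e : E7 →L[ℝ] E7) B =
      (act (B ∘L (e.symm : E7 →L[ℝ] E7)) σ).compContinuousLinearMap (e : E7 →L[ℝ] E7) := by
  ext v
  rw [comp_apply, act_apply, fderivCompContinuousLinearMap_apply]
  refine Finset.sum_congr rfl fun i _ => ?_
  congr 1
  funext j
  by_cases h : j = i
  · subst h; simp
  · simp [h]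

theorem alternatize_comp {k : ℕ} (e : E7 ≃L[ℝ] E7) (f : E7 →L[ℝ] AltForm k) (g : E7 →L[ℝ] AltForm k)
    (h : ∀ v, g v = (f (e v)).compContinuousLinearMap (e : E7 →L[ℝ] E7)) :
    (alternatizeUncurryFin g : AltForm (k + 1)) =
      (alternatizeUncurryFin f).compContinuousLinearMap (e : E7 →L[ℝ] E7) := by
  ext v
  rw [comp_apply, alternatizeUncurryFin_apply, alternatizeUncurryFin_apply]
  refine Finset.sum_congr rfl fun i _ => ?_
  rw [h]
  rfl

/-- The product rule: one term differentiates the components in the frame, the other the frame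
itself, and both are read in the frame at `y`. -/
theorem extDeriv_comp_frame {k : ℕ} {σ : E7 → AltForm k} {σ' : E7 →L[ℝ] AltForm k}
    {u : E7 → E7 →L[ℝ] E7} {u' : E7 →L[ℝ] E7 →L[ℝ] E7} {y : E7} {e : E7 ≃L[ℝ] E7}
    (hσ : HasFDerivAt σ σ' y) (hu : HasFDerivAt u u' y) (he : u y = e) :
    extDeriv (fun z => (σ z).compContinuousLinearMap (u z)) y =
      (alternatizeUncurryFin (σ' ∘L (e.symm : E7 →L[ℝ] E7)) +
        torD (connMatrix e u') (σ y)).compContinuousLinearMap (e : E7 →L[ℝ] E7) := by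
  have h := HasFDerivAt.continuousAlternatingMapCompContinuousLinearMap hσ hu
  rw [extDeriv, h.fderiv, torD, ← alternatizeUncurryFin_add]
  refine alternatize_comp e _ _ fun v => ?_
  rw [he]
  ext x
  rw [comp_apply, add_fderivComp_apply]
  have h1 : (compContinuousLinearMapCLM (e : E7 →L[ℝ] E7) ∘L σ' +
      (σ y).fderivCompContinuousLinearMap (e : E7 →L[ℝ] E7) ∘L u') v x =
      σ' v (fun i => e (x i)) + (σ y).fderivCompContinuousLinearMap (e : E7 →L[ℝ] E7) (u' v) x := rfl
  rw [h1, fderivComp_eq_act, comp_apply]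
  have h2 : connMatrix e u' (e v) = u' v ∘L (e.symm : E7 →L[ℝ] E7) := by
    refine ContinuousLinearMap.ext fun z => ?_
    rw [connMatrix_apply, ContinuousLinearEquiv.symm_apply_apply]
    rfl
  have h3 : (σ' ∘L (e.symm : E7 →L[ℝ] E7)) (e v) = σ' v := by
    rw [ContinuousLinearMap.comp_apply, ContinuousLinearEquiv.coe_coe,
      ContinuousLinearEquiv.symm_apply_apply]
  rw [ContinuousLinearEquiv.coe_coe, h2, h3]

theorem extDeriv_const_comp_frame {k : ℕ} (α : AltForm k)
    {u : E7 → E7 →L[ℝ] E7} {u' : E7 →L[ℝ] E7 →L[ℝ] E7} {y : E7} {e : E7 ≃L[ℝ] E7}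
    (hu : HasFDerivAt u u' y) (he : u y = e) :
    extDeriv (fun z => α.compContinuousLinearMap (u z)) y =
      (torD (connMatrix e u') α).compContinuousLinearMap (e : E7 →L[ℝ] E7) := by
  have hα : HasFDerivAt (fun _ : E7 => α) (0 : E7 →L[ℝ] AltForm k) y := hasFDerivAt_const α y
  rw [extDeriv_comp_frame hα hu he, ContinuousLinearMap.zero_comp]
  have : (alternatizeUncurryFin (0 : E7 →L[ℝ] AltForm k)) = 0 :=
    map_zero (alternatizeUncurryFinCLM ℝ E7 ℝ)
  rw [this, zero_add]

/-! ### The dual `4`-form and the torsion form in coordinates -/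

theorem three_add_four : 3 + 4 = 7 := rfl
theorem five_add_two : 5 + 2 = 7 := rfl
theorem two_add_five : 2 + 5 = 7 := rfl

/-- The `4`-form `*w` of a positive `3`-form field on `ℝ⁷`. -/
def psiL (w : E7 → AltForm 3) (z : E7) : AltForm 4 := hodgeStar (w z) (k := 3) (l := 4) three_add_four (w z)

/-- The exterior derivative of a `4`-form. -/
def extDeriv4 (ψ : E7 → AltForm 4) (z : E7) : AltForm 5 := extDeriv ψ z

/-- The `2`-form `-*d*w` of a positive `3`-form field on `ℝ⁷`. -/
def thetaL (w : E7 → AltForm 3) (z : E7) : AltForm 2 :=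
  -hodgeStar (w z) (k := 5) (l := 2) five_add_two (extDeriv4 (psiL w) z)

theorem psiL_eq {w : E7 → AltForm 3} {z : E7} (e : E7 ≃L[ℝ] E7)
    (he : w z = phi0.compContinuousLinearMap (e : E7 →L[ℝ] E7)) :
    psiL w z = psi0.compContinuousLinearMap (e : E7 →L[ℝ] E7) := by
  rw [psiL, he, hodgeStar_comp, psi0_eq]

theorem neg_comp {k : ℕ} (α : AltForm k) (e : E7 →L[ℝ] E7) :
    (-α).compContinuousLinearMap e = -(α.compContinuousLinearMap e) := rfl

theorem zero_comp {k : ℕ} (e : E7 →L[ℝ] E7) :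
    (0 : AltForm k).compContinuousLinearMap e = 0 := rfl

theorem star0_neg {k l : ℕ} (h : k + l = 7) (α : AltForm k) : star0 h (-α) = -star0 h α := by
  rw [← star0L_apply, map_neg, star0L_apply]

theorem IsPositive.hodgeStar_two_five {ρ : AltForm 3} (hρ : IsPositive ρ) (τ : AltForm 2) :
    hodgeStar ρ (k := 5) (l := 2) five_add_two (hodgeStar ρ (k := 2) (l := 5) two_add_five τ) = τ := by
  obtain ⟨e, rfl⟩ := hρ
  rw [← comp_symm τ e, G2.hodgeStar_comp, G2.hodgeStar_comp, star0_two_five]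

/-- A smooth frame adapted to `w` near `y`, with `e` its value at `y`, and `B` a skew connection
matrix. -/
structure IsAdapted (w : E7 → AltForm 3) (y : E7) (e : E7 ≃L[ℝ] E7) (u : E7 → E7 →L[ℝ] E7)
    (B : E7 →L[ℝ] E7 →L[ℝ] E7) : Prop where
  smooth : ContDiffAt ℝ ∞ u y
  eq : u y = e
  frame : ∀ᶠ z in nhds y, w z = phi0.compContinuousLinearMap (u z)
  skew : ∀ v, IsSkew (B v)
  torD_eq : ∀ {k : ℕ} (α : AltForm k), torD (connMatrix e (fderiv ℝ u y)) α = torD B α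

theorem exists_isAdapted {w : E7 → AltForm 3} {y : E7} (hw : ContDiffAt ℝ ∞ w y)
    {e : E7 ≃L[ℝ] E7} (he : w y = phi0.compContinuousLinearMap (e : E7 →L[ℝ] E7)) :
    ∃ u B, IsAdapted w y e u B := by
  obtain ⟨u, hu, hue, hev⟩ := exists_local_frame hw he
  obtain ⟨B, S, hB, hS, h⟩ := exists_skew_add_symm (connMatrix e (fderiv ℝ u y))
  exact ⟨u, B, hu, hue, hev, hB, fun α => torD_eq_of_symm hS h α⟩

namespace IsAdapted

variable {w : E7 → AltForm 3} {y : E7} {e : E7 ≃L[ℝ] E7} {u : E7 → E7 →L[ℝ] E7}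
  {B : E7 →L[ℝ] E7 →L[ℝ] E7}

theorem hasFDerivAt (h : IsAdapted w y e u B) : HasFDerivAt u (fderiv ℝ u y) y :=
  (h.smooth.differentiableAt (by simp)).hasFDerivAt

theorem extDeriv_eq (h : IsAdapted w y e u B) :
    extDeriv w y = (torD B phi0).compContinuousLinearMap (e : E7 →L[ℝ] E7) := by
  rw [Filter.EventuallyEq.extDeriv_eq h.frame, extDeriv_const_comp_frame phi0 h.hasFDerivAt h.eq,
    h.torD_eq]

theorem psiL_eventuallyEq (h : IsAdapted w y e u B) :
    psiL w =ᶠ[nhds y] fun z => psi0.compContinuousLinearMap (u z) := by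
  obtain ⟨f, hf, -⟩ := eventually_equiv h.smooth h.eq
  filter_upwards [h.frame, hf] with z hz hfz
  rw [← hfz] at hz ⊢
  exact psiL_eq (f z) hz

theorem extDeriv4_psiL (h : IsAdapted w y e u B) :
    extDeriv4 (psiL w) y = (wedge23 (torForm B) phi0).compContinuousLinearMap (e : E7 →L[ℝ] E7) := by
  rw [extDeriv4, Filter.EventuallyEq.extDeriv_eq h.psiL_eventuallyEq,
    extDeriv_const_comp_frame psi0 h.hasFDerivAt h.eq, h.torD_eq, torD_psi0_of_skew h.skew]

theorem base_eq (h : IsAdapted w y e u B) : w y = phi0.compContinuousLinearMap (e : E7 →L[ℝ] E7) := by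
  rw [← h.eq]
  exact h.frame.self_of_nhds

theorem torD_phi0 (h : IsAdapted w y e u B) (hc : extDeriv w y = 0) : torD B phi0 = 0 := by
  rw [h.extDeriv_eq] at hc
  rw [← comp_symm' (torD B phi0) e, hc, zero_comp]

theorem isLambda14 (h : IsAdapted w y e u B) (hc : extDeriv w y = 0) : IsLambda14 (torForm B) :=
  (torsion_of_closed h.skew (h.torD_phi0 hc)).2

/-- Since `τ ∧ phi0 = -*τ` on `Λ²₁₄`, the form `-*dψ` is `**τ = τ`. -/
theorem thetaL_eq (h : IsAdapted w y e u B) (hc : extDeriv w y = 0) :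
    thetaL w y = (torForm B).compContinuousLinearMap (e : E7 →L[ℝ] E7) := by
  rw [thetaL, h.extDeriv4_psiL, h.base_eq, hodgeStar_comp, (h.isLambda14 hc).wedge_phi0,
    star0_neg, star0_two_five, neg_comp, neg_neg]

theorem extDeriv4_psiL_of_closed (h : IsAdapted w y e u B) (hc : extDeriv w y = 0) :
    extDeriv4 (psiL w) y = wedge (thetaL w y) (w y) ∧
    extDeriv4 (psiL w) y = -hodgeStar (w y) (k := 2) (l := 5) two_add_five (thetaL w y) := by
  have h1 := h.extDeriv4_psiL
  have h2 := h1
  rw [wedge23_apply, ← wedge_comp, ← h.thetaL_eq hc, ← h.base_eq] at h1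
  refine ⟨h1, ?_⟩
  rw [h2, (h.isLambda14 hc).wedge_phi0, h.thetaL_eq hc, h.base_eq, hodgeStar_comp, neg_comp]

end IsAdapted

variable {w : E7 → AltForm 3} {y : E7}

theorem contDiffAt_psiL (hw : ContDiffAt ℝ ∞ w y) (hp : IsPositive (w y)) :
    ContDiffAt ℝ ∞ (psiL w) y := contDiffAt_hodgeStar _ hw hp hw

theorem contDiffAt_extDeriv {k : ℕ} {α : E7 → AltForm k} (hα : ContDiffAt ℝ ∞ α y) :
    ContDiffAt ℝ ∞ (extDeriv α) y := by
  have h : ContDiffAt ℝ ∞ (fderiv ℝ α) y := hα.fderiv_right (m := ∞) (by simp)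
  exact (alternatizeUncurryFinCLM (n := k) ℝ E7 ℝ).contDiff.contDiffAt.comp y h

theorem contDiffAt_extDeriv4 {ψ : E7 → AltForm 4} (hψ : ContDiffAt ℝ ∞ ψ y) :
    ContDiffAt ℝ ∞ (extDeriv4 ψ) y := contDiffAt_extDeriv hψ

theorem contDiffAt_neg_hodgeStar {k l : ℕ} (h : k + l = 7) {β : E7 → AltForm k}
    (hw : ContDiffAt ℝ ∞ w y) (hp : IsPositive (w y)) (hβ : ContDiffAt ℝ ∞ β y) :
    ContDiffAt ℝ ∞ (fun z => -hodgeStar (w z) h (β z)) y :=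
  (contDiffAt_hodgeStar h hw hp hβ).neg

theorem contDiffAt_thetaL (hw : ContDiffAt ℝ ∞ w y) (hp : IsPositive (w y)) :
    ContDiffAt ℝ ∞ (thetaL w) y :=
  contDiffAt_neg_hodgeStar (k := 5) (l := 2) five_add_two hw hp (contDiffAt_extDeriv4 (contDiffAt_psiL hw hp))

/-- `Λ²₁₄` is the common kernel of fixed linear functionals, so a field of forms with values in it
has its derivative there too. -/
theorem IsLambda14.of_hasFDerivAt {σ : E7 → AltForm 2} {σ' : E7 →L[ℝ] AltForm 2}
    (h : HasFDerivAt σ σ' y) (hσ : ∀ᶠ z in nhds y, IsLambda14 (σ z)) (v : E7) :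
    IsLambda14 (σ' v) := by
  intro m
  let L : AltForm 2 →L[ℝ] ℝ := ∑ i, ∑ j, (phiI i j m : ℝ) •
    ContinuousAlternatingMap.apply ℝ E7 ℝ ![stdVec i, stdVec j]
  have hL : ∀ τ, L τ = ∑ i, ∑ j, τ ![stdVec i, stdVec j] * (phiI i j m : ℝ) := by
    intro τ
    simp only [L, _root_.sum_apply, _root_.smul_apply, ContinuousAlternatingMap.apply_apply,
      smul_eq_mul, mul_comm]
  have h1 : HasFDerivAt (fun z => L (σ z)) (L ∘L σ') y := L.hasFDerivAt.comp y h
  have h2 : (fun z => L (σ z)) =ᶠ[nhds y] fun _ => 0 := by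
    filter_upwards [hσ] with z hz
    rw [hL]
    exact hz m
  have h3 : HasFDerivAt (fun z => L (σ z)) (0 : E7 →L[ℝ] ℝ) y :=
    (hasFDerivAt_const (0 : ℝ) y).congr_of_eventuallyEq h2
  have h4 := h1.unique h3
  rw [← hL, ← ContinuousLinearMap.comp_apply, h4]
  rfl

theorem formInner_two_comp (e : E7 ≃L[ℝ] E7) (σ : AltForm 2) :
    formInner (phi0.compContinuousLinearMap (e : E7 →L[ℝ] E7))
      (σ.compContinuousLinearMap (e : E7 →L[ℝ] E7)) (σ.compContinuousLinearMap (e : E7 →L[ℝ] E7)) =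
      (1 / 2 : ℝ) * ∑ j, ∑ k, σ ![stdVec j, stdVec k] ^ 2 := by
  rw [formInner_comp]
  have h1 : ∑ I : Fin 2 → Fin 7, σ (fun a => stdVec (I a)) * σ (fun a => stdVec (I a)) =
      ∑ p : Fin 7 × Fin 7, σ ![stdVec p.1, stdVec p.2] ^ 2 := by
    refine Fintype.sum_equiv (finTwoArrowEquiv (Fin 7)) _ _ fun I => ?_
    rw [vec_two, sq]
    rfl
  rw [h1, Fintype.sum_prod_type]
  simp

/-- If `dθ = c w` for the torsion form `θ` of the closed form `w`, then `7 c = |θ|²`. -/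
theorem formInner_thetaL (hw : ∀ᶠ z in nhds y, ContDiffAt ℝ ∞ w z ∧ IsPositive (w z) ∧
    extDeriv w z = 0) {c : ℝ} (hc : extDeriv (thetaL w) y = c • w y) :
    7 * c = formInner (w y) (thetaL w y) (thetaL w y) := by
  obtain ⟨hwy, ⟨e, he⟩, hdy⟩ := hw.self_of_nhds
  obtain ⟨u, B, h⟩ := exists_isAdapted hwy he
  obtain ⟨f, hf, hfs⟩ := eventually_equiv h.smooth h.eq
  let σ : E7 → AltForm 2 := fun z => (thetaL w z).compContinuousLinearMap ((f z).symm : E7 →L[ℝ] E7)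
  have hσ : ContDiffAt ℝ ∞ σ y := contDiffAt_comp (contDiffAt_thetaL hwy ⟨e, he⟩) hfs
  have hσ14 : ∀ᶠ z in nhds y, IsLambda14 (σ z) := by
    filter_upwards [hw, h.frame, hf] with z hz hz' hfz
    rw [← hfz] at hz'
    -- A fresh adapted frame based at `z` with the same value `f z` there: `σ z` depends only on
    -- that value, so it is the torsion form of `B'`.
    obtain ⟨u', B', h'⟩ := exists_isAdapted hz.1 hz'
    have : σ z = torForm B' := by
      simp only [σ]
      rw [h'.thetaL_eq hz.2.2, comp_symm']
    rw [this]
    exact h'.isLambda14 hz.2.2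
  have hσd : HasFDerivAt σ (fderiv ℝ σ y) y := (hσ.differentiableAt (by simp)).hasFDerivAt
  have hfy : f y = e := by
    have := hf.self_of_nhds
    rw [h.eq] at this
    exact ContinuousLinearEquiv.coe_injective this
  have hσy : σ y = torForm B := by
    simp only [σ]
    rw [hfy, h.thetaL_eq hdy, comp_symm']
  have h1 : thetaL w =ᶠ[nhds y] fun z => (σ z).compContinuousLinearMap (u z) := by
    filter_upwards [hf] with z hfz
    simp only [σ]
    rw [← hfz, comp_symm]
  rw [Filter.EventuallyEq.extDeriv_eq h1, extDeriv_comp_frame hσd h.hasFDerivAt h.eq, hσy,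
    h.torD_eq, h.base_eq, ← smul_comp] at hc
  have h2 := congrArg (fun χ : AltForm 3 => χ.compContinuousLinearMap (e.symm : E7 →L[ℝ] E7)) hc
  simp only [comp_symm'] at h2
  rw [h.thetaL_eq hdy, h.base_eq, formInner_two_comp]
  refine torForm_norm h.skew (h.torD_phi0 hdy) (fun v => ?_) h2
  exact IsLambda14.of_hasFDerivAt hσd hσ14 _

end

end G2

namespace G2

noncomputable section

open ContinuousAlternatingMap hiding map_sum map_zero

/-! ### The Levi-Civita connection in a local frame -/

theorem eq_zero_of_std {f : E7 → ℝ} (hf : IsLinearMap ℝ f) (h : ∀ i, f (stdVec i) = 0) (x : E7) :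
    f x = 0 := by
  have h1 : hf.mk' f x = 0 := by
    rw [← sum_stdVec x, map_sum]
    refine Finset.sum_eq_zero fun i _ => ?_
    rw [map_smul, IsLinearMap.mk'_apply, h, smul_zero]
  exact h1

theorem act_comp {k : ℕ} (α : AltForm k) (e : E7 ≃L[ℝ] E7) (C : E7 →L[ℝ] E7) :
    act C (α.compContinuousLinearMap (e : E7 →L[ℝ] E7)) =
      (act ((e : E7 →L[ℝ] E7) ∘L C ∘L (e.symm : E7 →L[ℝ] E7)) α).compContinuousLinearMap
        (e : E7 →L[ℝ] E7) := by
  ext v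
  rw [act_apply, comp_apply, act_apply]
  refine Finset.sum_congr rfl fun i _ => ?_
  rw [comp_apply]
  congr 1
  funext j
  by_cases h : j = i
  · subst h; simp
  · simp [h]

theorem act_sub {k : ℕ} (α : AltForm k) (B C : E7 →L[ℝ] E7) :
    act (B - C) α = act B α - act C α :=
  map_sub (α.fderivCompContinuousLinearMap (.id ℝ E7)) B C

theorem act_eq_zero_of_std {k : ℕ} {α : AltForm k} {C : E7 →L[ℝ] E7 →L[ℝ] E7}
    {e : E7 ≃L[ℝ] E7} (h : ∀ i, act (C (e (stdVec i))) α = 0) (v : E7) : act (C v) α = 0 := by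
  have h1 : ∀ x, act (C x) α = (α.fderivCompContinuousLinearMap (.id ℝ E7) ∘L C) x := fun _ => rfl
  have h2 : v = e (∑ i, e.symm v i • stdVec i) := by
    rw [sum_stdVec, ContinuousLinearEquiv.apply_symm_apply]
  rw [h1, h2, map_sum, map_sum]
  refine Finset.sum_eq_zero fun i _ => ?_
  rw [map_smul, map_smul, ← h1, h, smul_zero]

theorem sum_update_eq_act {k : ℕ} (α : AltForm k) (C : E7 →L[ℝ] E7) (J : Fin k → Fin 7) :
    ∑ a, ∑ m, C (stdVec (J a)) m * α (fun b => stdVec (Function.update J a m b)) =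
      act C α (fun b => stdVec (J b)) := by
  rw [act_apply]
  refine Finset.sum_congr rfl fun a _ => ?_
  rw [map_update_eq_sum]
  refine Finset.sum_congr rfl fun m _ => ?_
  congr 2
  funext b
  by_cases h : b = a
  · subst h; simp
  · simp [h]

theorem g0_eq_inner (x y : E7) : g0 x y = inner ℝ x y := rfl

theorem g0_comm (x y : E7) : g0 x y = g0 y x := by
  rw [g0_eq_inner, g0_eq_inner, real_inner_comm]

theorem g0_std (x : E7) (m : Fin 7) : g0 x (stdVec m) = x m := by
  rw [g0_apply]
  simp

/-- The Christoffel symbols of a metric with components `G`. -/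
def christL (G : E7 → Fin 7 → Fin 7 → ℝ) (y : E7) (m i j : Fin 7) : ℝ :=
  (1 / 2 : ℝ) * ∑ l, (Matrix.of fun a b => G y a b)⁻¹ m l *
    (partialD (fun z => G z j l) y i + partialD (fun z => G z i l) y j
      - partialD (fun z => G z i j) y l)

theorem partialD_metric {u : E7 → E7 →L[ℝ] E7} {u' : E7 →L[ℝ] E7 →L[ℝ] E7} {y : E7}
    (hu : HasFDerivAt u u' y) {G : E7 → Fin 7 → Fin 7 → ℝ}
    (hG : ∀ᶠ z in nhds y, ∀ i j, G z i j = g0 (u z (stdVec i)) (u z (stdVec j))) (i j l : Fin 7) :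
    partialD (fun z => G z j l) y i =
      g0 (u' (stdVec i) (stdVec j)) (u y (stdVec l)) +
        g0 (u y (stdVec j)) (u' (stdVec i) (stdVec l)) := by
  have h1 : ∀ j : Fin 7, HasFDerivAt (fun z => u z (stdVec j))
      ((ContinuousLinearMap.apply ℝ E7 (stdVec j)) ∘L u') y := fun j =>
    (ContinuousLinearMap.apply ℝ E7 (stdVec j)).hasFDerivAt.comp y hu
  have h2 := (h1 j).inner ℝ (h1 l)
  have h3 : (fun z => G z j l) =ᶠ[nhds y] fun z => inner ℝ (u z (stdVec j)) (u z (stdVec l)) := by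
    filter_upwards [hG] with z hz
    rw [hz, g0_eq_inner]
  rw [partialD, h3.fderiv_eq, h2.fderiv]
  simp [fderivInnerCLM_apply, g0_eq_inner, add_comm]

theorem gram_det_isUnit (e : E7 ≃L[ℝ] E7) :
    IsUnit (Matrix.of fun a b => g0 (e (stdVec a)) (e (stdVec b))).det := by
  have h1 : (Matrix.of fun a b => g0 (e (stdVec a)) (e (stdVec b))) =
      (stdMatrix (e : E7 →L[ℝ] E7)).transpose * stdMatrix (e : E7 →L[ℝ] E7) := by
    ext i j
    simp [g0_apply, Matrix.mul_apply, stdMatrix]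
  have h2 : stdMatrix (e : E7 →L[ℝ] E7) * stdMatrix (e.symm : E7 →L[ℝ] E7) = 1 := by
    rw [← stdMatrix_mul]
    ext i j
    simp [stdMatrix, Matrix.one_apply]
  have h3 : IsUnit (stdMatrix (e : E7 →L[ℝ] E7)).det := by
    have := congrArg Matrix.det h2
    rw [Matrix.det_mul, Matrix.det_one] at this
    exact IsUnit.of_mul_eq_one _ this
  rw [h1, Matrix.det_mul, Matrix.det_transpose]
  exact h3.mul h3

theorem christL_lower {G : E7 → Fin 7 → Fin 7 → ℝ} {y : E7}
    (hG : IsUnit (Matrix.of fun a b => G y a b).det) (l i j : Fin 7) :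
    ∑ m, G y l m * christL G y m i j = (1 / 2 : ℝ) * (partialD (fun z => G z j l) y i +
      partialD (fun z => G z i l) y j - partialD (fun z => G z i j) y l) := by
  have h1 := Matrix.mul_nonsing_inv _ hG
  have h2 : ∀ k, ∑ m, G y l m * (Matrix.of fun a b => G y a b)⁻¹ m k = if l = k then 1 else 0 := by
    intro k
    have := congrFun (congrFun h1 l) k
    rw [Matrix.mul_apply, Matrix.one_apply] at this
    exact this
  have h3 : ∑ m, G y l m * christL G y m i j = ∑ k, (1 / 2 : ℝ) *
      ((∑ m, G y l m * (Matrix.of fun a b => G y a b)⁻¹ m k) *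
        (partialD (fun z => G z j k) y i + partialD (fun z => G z i k) y j
          - partialD (fun z => G z i j) y k)) := by
    simp only [christL, Finset.mul_sum, Finset.sum_mul]
    rw [Finset.sum_comm]
    exact Finset.sum_congr rfl fun k _ => Finset.sum_congr rfl fun m _ => by ring
  rw [h3]
  simp [h2]

/-- The connection matrix of the Levi-Civita connection in the frame `u`. -/
def leviMatrix (e : E7 ≃L[ℝ] E7) (u' Γ : E7 →L[ℝ] E7 →L[ℝ] E7) : E7 →L[ℝ] E7 →L[ℝ] E7 :=
  connMatrix e u' - connMatrix e (((e : E7 →L[ℝ] E7).postcomp E7) ∘L Γ)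

theorem leviMatrix_apply (e : E7 ≃L[ℝ] E7) (u' Γ : E7 →L[ℝ] E7 →L[ℝ] E7) (v x : E7) :
    leviMatrix e u' Γ v x = u' (e.symm v) (e.symm x) - e (Γ (e.symm v) (e.symm x)) := rfl

/-- For symmetric Christoffel symbols the last summand is invisible to `torD`, so `leviMatrix`
computes the same exterior derivatives as the connection matrix. -/
theorem connMatrix_eq (e : E7 ≃L[ℝ] E7) (u' Γ : E7 →L[ℝ] E7 →L[ℝ] E7) :
    connMatrix e u' = leviMatrix e u' Γ + connMatrix e (((e : E7 →L[ℝ] E7).postcomp E7) ∘L Γ) := by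
  refine ContinuousLinearMap.ext fun v => ContinuousLinearMap.ext fun x => ?_
  have h : (leviMatrix e u' Γ + connMatrix e (((e : E7 →L[ℝ] E7).postcomp E7) ∘L Γ)) v x =
    leviMatrix e u' Γ v x + e (Γ (e.symm v) (e.symm x)) := rfl
  rw [h, leviMatrix_apply, connMatrix_apply, sub_add_cancel]

theorem leviMatrix_apply_equiv (e : E7 ≃L[ℝ] E7) (u' Γ : E7 →L[ℝ] E7 →L[ℝ] E7) (v : E7) :
    leviMatrix e u' Γ (e v) = u' v ∘L (e.symm : E7 →L[ℝ] E7) -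
      (e : E7 →L[ℝ] E7) ∘L Γ v ∘L (e.symm : E7 →L[ℝ] E7) := by
  refine ContinuousLinearMap.ext fun x => ?_
  rw [leviMatrix_apply, ContinuousLinearEquiv.symm_apply_apply]
  rfl

theorem sub_comp_apply {k : ℕ} (α β : AltForm k) (e : E7 →L[ℝ] E7) (v : Fin k → E7) :
    (α - β).compContinuousLinearMap e v =
      α.compContinuousLinearMap e v - β.compContinuousLinearMap e v := rfl

theorem partialD_comp {k : ℕ} (α : AltForm k) {u : E7 → E7 →L[ℝ] E7}
    {u' : E7 →L[ℝ] E7 →L[ℝ] E7} {y : E7} {e : E7 ≃L[ℝ] E7} (hu : HasFDerivAt u u' y)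
    (he : u y = e) (v : Fin k → E7) (i : Fin 7) :
    partialD (fun z => α.compContinuousLinearMap (u z) v) y i =
      (act (u' (stdVec i) ∘L (e.symm : E7 →L[ℝ] E7)) α).compContinuousLinearMap
        (e : E7 →L[ℝ] E7) v := by
  have h3 : HasFDerivAt (fun z => α.compContinuousLinearMap (u z))
      (α.fderivCompContinuousLinearMap (u y) ∘L u') y := by
    have h0 : HasFDerivAt (fun _ : E7 => α) (0 : E7 →L[ℝ] AltForm k) y :=
      hasFDerivAt_const α y
    have := HasFDerivAt.continuousAlternatingMapCompContinuousLinearMap h0 hu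
    rwa [ContinuousLinearMap.comp_zero, zero_add] at this
  have h4 := ((ContinuousAlternatingMap.apply ℝ E7 ℝ v).hasFDerivAt
      (x := α.compContinuousLinearMap (u y))).comp y h3
  have h5 : (fun z => α.compContinuousLinearMap (u z) v) =
    (ContinuousAlternatingMap.apply ℝ E7 ℝ v) ∘ fun z => α.compContinuousLinearMap (u z) := rfl
  rw [partialD, h5, h4.fderiv, he, ← fderivComp_eq_act]
  rfl

/-- This is compatibility with the metric: in the frame `u` the metric is the standard one, and
lowering the Christoffel symbols turns `∇g = 0` into skewness. -/
theorem leviMatrix_skew {e : E7 ≃L[ℝ] E7} {u : E7 → E7 →L[ℝ] E7} {u' : E7 →L[ℝ] E7 →L[ℝ] E7}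
    {y : E7} (hu : HasFDerivAt u u' y) (he : u y = e) {G : E7 → Fin 7 → Fin 7 → ℝ}
    (hG : ∀ᶠ z in nhds y, ∀ i j, G z i j = g0 (u z (stdVec i)) (u z (stdVec j))) (v : E7) :
    IsSkew (leviMatrix e u' (ofComponents (christL G y)) v) := by
  have hGy : ∀ i j, G y i j = g0 (e (stdVec i)) (e (stdVec j)) := by
    intro i j
    rw [hG.self_of_nhds i j, he]
    rfl
  have hdet : IsUnit (Matrix.of fun a b => G y a b).det := by
    simp only [hGy]
    exact gram_det_isUnit e
  set Γ := ofComponents (christL G y) with hΓ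
  have hP := fun i j l => partialD_metric hu hG i j l
  have hΓg : ∀ i j l, g0 (e (Γ (stdVec i) (stdVec j))) (e (stdVec l)) =
      (1 / 2 : ℝ) * (partialD (fun z => G z j l) y i +
      partialD (fun z => G z i l) y j - partialD (fun z => G z i j) y l) := by
    intro i j l
    rw [← christL_lower hdet]
    conv_lhs => rw [← sum_stdVec (Γ (stdVec i) (stdVec j))]
    simp only [map_sum, map_smul, LinearMap.sum_apply, LinearMap.smul_apply, smul_eq_mul]
    refine Finset.sum_congr rfl fun m _ => ?_
    rw [hΓ, ofComponents_std, hGy, g0_comm (e (stdVec l))]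
    ring
  have key : ∀ i j l, g0 (u' (stdVec i) (stdVec j) - e (Γ (stdVec i) (stdVec j))) (e (stdVec l)) +
      g0 (e (stdVec j)) (u' (stdVec i) (stdVec l) - e (Γ (stdVec i) (stdVec l))) = 0 := by
    intro i j l
    have hc : (u y : E7 → E7) = e := by rw [he]; rfl
    rw [map_sub, map_sub, LinearMap.sub_apply, g0_comm (e (stdVec j)) (e (Γ _ _)), hΓg, hΓg]
    simp only [hP, hc]
    have e1 := g0_comm (u' (stdVec i) (stdVec l)) (e (stdVec j))
    have e2 := g0_comm (u' (stdVec j) (stdVec l)) (e (stdVec i))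
    have e3 := g0_comm (u' (stdVec l) (stdVec j)) (e (stdVec i))
    have e4 := g0_comm (u' (stdVec l) (stdVec i)) (e (stdVec j))
    have e5 := g0_comm (u' (stdVec j) (stdVec i)) (e (stdVec l))
    have e6 := g0_comm (u' (stdVec i) (stdVec j)) (e (stdVec l))
    linarith
  have key3 : ∀ v x z, g0 (u' v x - e (Γ v x)) (e z) + g0 (e x) (u' v z - e (Γ v z)) = 0 := by
    intro v x z
    refine eq_zero_of_std (f := fun v => g0 (u' v x - e (Γ v x)) (e z) +
      g0 (e x) (u' v z - e (Γ v z))) ⟨fun a b => ?_, fun c a => ?_⟩ (fun i => ?_) v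
    · simp only [map_add, _root_.add_apply, map_sub, LinearMap.sub_apply, LinearMap.add_apply]
      ring
    · simp only [map_smul, _root_.smul_apply, map_sub, LinearMap.sub_apply, LinearMap.smul_apply,
        smul_eq_mul]
      ring
    refine eq_zero_of_std (f := fun x => g0 (u' (stdVec i) x - e (Γ (stdVec i) x)) (e z) +
      g0 (e x) (u' (stdVec i) z - e (Γ (stdVec i) z))) ⟨fun a b => ?_, fun c a => ?_⟩
      (fun j => ?_) x
    · simp only [map_add, map_sub, LinearMap.sub_apply, LinearMap.add_apply]
      ring
    · simp only [map_smul, map_sub, LinearMap.sub_apply, LinearMap.smul_apply,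
        smul_eq_mul]
      ring
    refine eq_zero_of_std (f := fun z => g0 (u' (stdVec i) (stdVec j) - e (Γ (stdVec i) (stdVec j)))
      (e z) + g0 (e (stdVec j)) (u' (stdVec i) z - e (Γ (stdVec i) z)))
      ⟨fun a b => ?_, fun c a => ?_⟩ (fun l => key i j l) z
    · simp only [map_add, map_sub, LinearMap.sub_apply]
      ring
    · simp only [map_smul, map_sub, LinearMap.sub_apply,
        smul_eq_mul]
      ring
  intro j m
  have h1 := key3 (e.symm v) (e.symm (stdVec j)) (e.symm (stdVec m))
  rw [← leviMatrix_apply, ← leviMatrix_apply, ContinuousLinearEquiv.apply_symm_apply,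
    ContinuousLinearEquiv.apply_symm_apply, g0_std, g0_comm, g0_std] at h1
  linarith

theorem christL_symm {G : E7 → Fin 7 → Fin 7 → ℝ} {y : E7}
    (hG : ∀ᶠ z in nhds y, ∀ i j, G z i j = G z j i) (m i j : Fin 7) :
    christL G y m i j = christL G y m j i := by
  have h : ∀ l, partialD (fun z => G z i j) y l = partialD (fun z => G z j i) y l := by
    intro l
    have : (fun z => G z i j) =ᶠ[nhds y] fun z => G z j i := hG.mono fun z hz => hz i j
    rw [partialD, partialD, this.fderiv_eq]
  simp only [christL, h]
  congr 1
  exact Finset.sum_congr rfl fun l _ => by ring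

/-- A positive form is parallel at `y` if and only if it is closed and coclosed at `y`. -/
theorem parallel_iff {w : E7 → AltForm 3} {y : E7} (hw : ContDiffAt ℝ ∞ w y)
    (hp : IsPositive (w y)) {G : E7 → Fin 7 → Fin 7 → ℝ}
    (hG : ∀ᶠ z in nhds y, ∀ i j, G z i j = metric (w z) (stdVec i) (stdVec j)) :
    (∀ (i : Fin 7) (J : Fin 3 → Fin 7), partialD (fun z => w z (fun a => stdVec (J a))) y i -
      ∑ a, ∑ m, christL G y m i (J a) * w y (fun b => stdVec (Function.update J a m b)) = 0) ↔
    extDeriv w y = 0 ∧ extDeriv4 (psiL w) y = 0 := by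
  obtain ⟨e, he⟩ := hp
  obtain ⟨u, hu, hue, hev⟩ := exists_local_frame hw he
  obtain ⟨f, hf, -⟩ := eventually_equiv hu hue
  have hud : HasFDerivAt u (fderiv ℝ u y) y := (hu.differentiableAt (by simp)).hasFDerivAt
  have hG' : ∀ᶠ z in nhds y, ∀ i j, G z i j = g0 (u z (stdVec i)) (u z (stdVec j)) := by
    filter_upwards [hG, hev, hf] with z h1 h2 h3 i j
    rw [h1, h2, ← h3, metric_comp, pullMetric_apply]
  have hsymm : ∀ᶠ z in nhds y, ∀ i j, G z i j = G z j i := by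
    filter_upwards [hG'] with z h1 i j
    rw [h1, h1, g0_comm]
  set Γ := ofComponents (christL G y) with hΓ
  set C := leviMatrix e (fderiv ℝ u y) Γ with hC
  have hS : ∀ x z, connMatrix e (((e : E7 →L[ℝ] E7).postcomp E7) ∘L Γ) x z =
      connMatrix e (((e : E7 →L[ℝ] E7).postcomp E7) ∘L Γ) z x := by
    intro x z
    have h1 : ∀ a b, Γ a b = Γ b a := by
      intro a b
      rw [hΓ, ofComponents_apply, ofComponents_apply, Finset.sum_comm]
      refine Finset.sum_congr rfl fun i _ => Finset.sum_congr rfl fun j _ =>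
        Finset.sum_congr rfl fun m _ => ?_
      rw [christL_symm hsymm m j i, mul_comm (a j)]
    change e (Γ (e.symm x) (e.symm z)) = e (Γ (e.symm z) (e.symm x))
    rw [h1]
  -- The Levi-Civita matrix is an admissible skew representative, so the algebra of `torD` applies
  -- to it directly.
  have had : IsAdapted w y e u C := ⟨hu, hue, hev, leviMatrix_skew hud hue hG',
    fun α => torD_eq_of_symm hS (connMatrix_eq e _ Γ) α⟩
  -- The partial derivative contributes the action of `u' e⁻¹`, and the Christoffel term that of `e
  -- Γ e⁻¹` after passing to the frame; the difference is `C`.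
  have h1 : ∀ (i : Fin 7) (J : Fin 3 → Fin 7), partialD (fun z => w z (fun a => stdVec (J a))) y i -
      ∑ a, ∑ m, christL G y m i (J a) * w y (fun b => stdVec (Function.update J a m b)) =
      (act (C (e (stdVec i))) phi0).compContinuousLinearMap (e : E7 →L[ℝ] E7)
        (fun a => stdVec (J a)) := by
    intro i J
    have h2 : ∀ a m, christL G y m i (J a) = Γ (stdVec i) (stdVec (J a)) m := by
      intro a m
      rw [hΓ, ofComponents_std]
    simp only [h2]
    rw [sum_update_eq_act, he, act_comp]
    have h5 : (fun z => w z (fun a => stdVec (J a))) =ᶠ[nhds y]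
        fun z => phi0.compContinuousLinearMap (u z) (fun a => stdVec (J a)) := by
      filter_upwards [hev] with z hz
      rw [hz]
    have h6 : partialD (fun z => w z (fun a => stdVec (J a))) y i =
        partialD (fun z => phi0.compContinuousLinearMap (u z) (fun a => stdVec (J a))) y i := by
      rw [partialD, partialD, h5.fderiv_eq]
    rw [h6, partialD_comp phi0 hud hue, hC, leviMatrix_apply_equiv, act_sub, sub_comp_apply]
  have h2 : (∀ (i : Fin 7) (J : Fin 3 → Fin 7), partialD (fun z => w z (fun a => stdVec (J a))) y i -
      ∑ a, ∑ m, christL G y m i (J a) * w y (fun b => stdVec (Function.update J a m b)) = 0) ↔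
      ∀ i, act (C (stdVec i)) phi0 = 0 := by
    simp only [h1]
    constructor
    · intro h i
      refine act_eq_zero_of_std (e := e) (fun i => ?_) _
      have h3 : (act (C (e (stdVec i))) phi0).compContinuousLinearMap (e : E7 →L[ℝ] E7) = 0 :=
        altForm_ext fun J _ => h i J
      rw [← comp_symm' (act (C (e (stdVec i))) phi0) e, h3, zero_comp]
    · intro h i J
      rw [act_eq_zero_of_std (e := ContinuousLinearEquiv.refl ℝ E7) h, zero_comp, zero_form_apply]
  have h3 : extDeriv w y = 0 ↔ torD C phi0 = 0 := by
    refine ⟨had.torD_phi0, fun h => ?_⟩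
    rw [had.extDeriv_eq, h, zero_comp]
  have h4 : extDeriv4 (psiL w) y = 0 ↔ torD C psi0 = 0 := by
    rw [had.extDeriv4_psiL, torD_psi0_of_skew had.skew]
    refine ⟨fun h => ?_, fun h => ?_⟩
    · rw [← comp_symm' (wedge23 (torForm C) phi0) e, h, zero_comp]
    · rw [h, zero_comp]
  rw [h2, h3, h4]
  exact ⟨fun h => torD_eq_zero had.skew h, fun h i => act_phi0_eq_zero had.skew h.1 h.2 i⟩

end

end G2

namespace G2
noncomputable section
open ContinuousAlternatingMap hiding map_sum map_zero

/-! ### Changes of coordinates -/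

section Manifold

variable {M : Type*} [TopologicalSpace M] [ChartedSpace E7 M]

/-- The change of coordinates from the chart around `x` to the chart around `p`. -/
def coordChange (x p : M) (y : E7) : E7 := chartAt E7 p ((chartAt E7 x).symm y)

/-- The domain of the change of coordinates. -/
def overlap (x p : M) : Set E7 :=
  (chartAt E7 x).target ∩ (chartAt E7 x).symm ⁻¹' (chartAt E7 p).source

theorem isOpen_overlap (x p : M) : IsOpen (overlap x p) :=
  (chartAt E7 x).symm.isOpen_inter_preimage (chartAt E7 p).open_source

theorem coordChange_mem {x p : M} {y : E7} (hy : y ∈ overlap x p) :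
    coordChange x p y ∈ overlap p x := by
  refine ⟨(chartAt E7 p).map_source hy.2, ?_⟩
  rw [Set.mem_preimage, coordChange, (chartAt E7 p).left_inv hy.2]
  exact (chartAt E7 x).map_target hy.1

theorem chart_symm_coordChange {x p : M} {y : E7} (hy : y ∈ overlap x p) :
    (chartAt E7 p).symm (coordChange x p y) = (chartAt E7 x).symm y :=
  (chartAt E7 p).left_inv hy.2

theorem coordChange_coordChange {x p q : M} {y : E7} (hy : y ∈ overlap x p) :
    coordChange p q (coordChange x p y) = coordChange x q y := by
  rw [coordChange, chart_symm_coordChange hy, coordChange]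

theorem coordChange_self {x : M} {y : E7} (hy : y ∈ (chartAt E7 x).target) :
    coordChange x x y = y := (chartAt E7 x).right_inv hy

theorem mem_overlap_symm {x : M} {y : E7} (hy : y ∈ (chartAt E7 x).target) :
    y ∈ overlap x ((chartAt E7 x).symm y) := ⟨hy, mem_chart_source _ _⟩

theorem fderiv_coordChange_self {x : M} {y : E7} (hy : y ∈ (chartAt E7 x).target) :
    fderiv ℝ (coordChange x x) y = .id ℝ E7 := by
  have h2 : coordChange x x =ᶠ[nhds y] id := by
    filter_upwards [(chartAt E7 x).open_target.mem_nhds hy] with z hz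
    exact coordChange_self hz
  rw [h2.fderiv_eq, fderiv_id]

theorem IsSmoothForm.contDiffAt {k : ℕ} {α : DiffForm M k} (hα : IsSmoothForm α) {x : M} {y : E7}
    (hy : y ∈ (chartAt E7 x).target) : ContDiffAt ℝ ∞ (localForm α x) y :=
  (hα x).contDiffAt ((chartAt E7 x).open_target.mem_nhds hy)

variable [IsManifold (𝓡 7) ∞ M]

theorem contDiffAt_coordChange {x p : M} {y : E7} (hy : y ∈ overlap x p) :
    ContDiffAt ℝ ∞ (coordChange x p) y := by
  have h := contDiffWithinAt_ext_coord_change (I := 𝓡 7) (n := ∞) p x (y := y)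
    (by simpa [overlap, -modelWithCornersSelf_coe] using hy)
  rw [Set.range_eq_univ.mpr (by exact fun z => ⟨z, rfl⟩), contDiffWithinAt_univ] at h
  exact h

theorem differentiableAt_coordChange {x p : M} {y : E7} (hy : y ∈ overlap x p) :
    DifferentiableAt ℝ (coordChange x p) y :=
  (contDiffAt_coordChange hy).differentiableAt (by simp)

/-- The tangent space at the point with coordinates `y` is read in the preferred chart of that
point, so the inverse chart differentiates to a transition map. -/
theorem chartSymmDeriv_eq {x : M} {y : E7} (hy : y ∈ (chartAt E7 x).target) :
    chartSymmDeriv x y = fderiv ℝ (coordChange x ((chartAt E7 x).symm y)) y := by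
  have h : MDifferentiableAt (𝓡 7) (𝓡 7) (chartAt E7 x).symm y :=
    mdifferentiableAt_atlas_symm (chart_mem_atlas _ _) hy
  refine h.mfderiv.trans ?_
  rw [← fderivWithin_univ, ← (𝓡 7).range_eq_univ]
  rfl

theorem chartDeriv_eq (x : M) : chartDeriv x = .id ℝ E7 := by
  have h : MDifferentiableAt (𝓡 7) (𝓡 7) (chartAt E7 x) x :=
    mdifferentiableAt_atlas (chart_mem_atlas _ _) (mem_chart_source _ _)
  refine h.mfderiv.trans ?_
  rw [← fderiv_coordChange_self (mem_chart_target E7 x), ← fderivWithin_univ, ← (𝓡 7).range_eq_univ]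
  rfl

theorem fderiv_coordChange_comp {x p q : M} {y : E7} (hy : y ∈ overlap x p)
    (hq : (chartAt E7 x).symm y ∈ (chartAt E7 q).source) :
    fderiv ℝ (coordChange x q) y =
      fderiv ℝ (coordChange p q) (coordChange x p y) ∘L fderiv ℝ (coordChange x p) y := by
  have h : coordChange x q =ᶠ[nhds y] coordChange p q ∘ coordChange x p := by
    filter_upwards [(isOpen_overlap x p).mem_nhds hy] with z hz
    exact (coordChange_coordChange hz).symm
  rw [h.fderiv_eq]
  refine fderiv_comp _ (differentiableAt_coordChange ⟨(coordChange_mem hy).1, ?_⟩)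
    (differentiableAt_coordChange hy)
  rwa [Set.mem_preimage, chart_symm_coordChange hy]

theorem chartSymmDeriv_coordChange {x p : M} {y : E7} (hy : y ∈ overlap x p) :
    chartSymmDeriv x y = chartSymmDeriv p (coordChange x p y) ∘L fderiv ℝ (coordChange x p) y := by
  rw [chartSymmDeriv_eq hy.1, chartSymmDeriv_eq (coordChange_mem hy).1, chart_symm_coordChange hy]
  exact fderiv_coordChange_comp hy (mem_chart_source _ _)

theorem chartSymmDeriv_chart (x : M) : chartSymmDeriv x (chartAt E7 x x) = .id ℝ E7 := by
  have h := mem_chart_target E7 x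
  rw [chartSymmDeriv_eq h, (chartAt E7 x).left_inv (mem_chart_source _ _),
    fderiv_coordChange_self h]

theorem exists_equiv_fderiv_coordChange {x p : M} {y : E7} (hy : y ∈ overlap x p) :
    ∃ e : E7 ≃L[ℝ] E7, fderiv ℝ (coordChange x p) y = e := by
  have h1 := fderiv_coordChange_comp (q := x) hy ((chartAt E7 x).map_target hy.1)
  have hy' := coordChange_mem hy
  have h2 := fderiv_coordChange_comp (q := p) hy' ((chartAt E7 p).map_target hy'.1)
  rw [fderiv_coordChange_self hy.1] at h1
  rw [fderiv_coordChange_self hy'.1, coordChange_coordChange hy, coordChange_self hy.1] at h2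
  refine ⟨ContinuousLinearEquiv.equivOfInverse (fderiv ℝ (coordChange x p) y)
    (fderiv ℝ (coordChange p x) (coordChange x p y))
    (fun v => ?_) (fun v => ?_), ?_⟩
  · exact (DFunLike.congr_fun h1 v).symm
  · exact (DFunLike.congr_fun h2 v).symm
  · rfl

theorem exists_equiv_chartSymmDeriv {x : M} {y : E7} (hy : y ∈ (chartAt E7 x).target) :
    ∃ e : E7 ≃L[ℝ] E7, chartSymmDeriv x y = e := by
  rw [chartSymmDeriv_eq hy]
  exact exists_equiv_fderiv_coordChange (mem_overlap_symm hy)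

/-! ### Coordinate expressions of forms -/

theorem localForm_chart {k : ℕ} (α : DiffForm M k) (x : M) :
    localForm α x (chartAt E7 x x) = α x := by
  rw [localForm, chartSymmDeriv_chart, (chartAt E7 x).left_inv (mem_chart_source _ _), comp_id]

theorem localForm_coordChange {k : ℕ} (α : DiffForm M k) {x p : M} {y : E7} (hy : y ∈ overlap x p) :
    localForm α x y =
      (localForm α p (coordChange x p y)).compContinuousLinearMap (fderiv ℝ (coordChange x p) y) := by
  rw [localForm, localForm, chartSymmDeriv_coordChange hy, chart_symm_coordChange hy]
  rfl

theorem extd_apply {k : ℕ} (α : DiffForm M k) (x : M) :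
    extd α x = extDeriv (localForm α x) (chartAt E7 x x) := by
  rw [extd, chartDeriv_eq, comp_id]

/-- At each point `extd` is computed in that point's own preferred chart. Naturality of `extDeriv`
under the transition map brings it to the chart around `x`. -/
theorem localForm_extd {k : ℕ} {α : DiffForm M k} (hα : IsSmoothForm α) {x : M} {y : E7}
    (hy : y ∈ (chartAt E7 x).target) : localForm (extd α) x y = extDeriv (localForm α x) y := by
  have hm := mem_overlap_symm hy
  have h1 : localForm α x =ᶠ[nhds y] fun z =>
      (localForm α ((chartAt E7 x).symm y)
        (coordChange x ((chartAt E7 x).symm y) z)).compContinuousLinearMap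
          (fderiv ℝ (coordChange x ((chartAt E7 x).symm y)) z) := by
    filter_upwards [(isOpen_overlap x _).mem_nhds hm] with z hz
    exact localForm_coordChange α hz
  have h3 : coordChange x ((chartAt E7 x).symm y) y =
    chartAt E7 ((chartAt E7 x).symm y) ((chartAt E7 x).symm y) := rfl
  have h2 := extDeriv_pullback (𝕜 := ℝ) (r := ∞)
    ((hα.contDiffAt (coordChange_mem hm).1).differentiableAt (by simp))
    (contDiffAt_coordChange hm) 
    (by rw [minSmoothness_of_isRCLikeNormedField]; exact WithTop.coe_le_coe.2 le_top)
  rw [h1.extDeriv_eq, h2, localForm, extd_apply, chartSymmDeriv_eq hy, h3]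

theorem localForm_starF {φ : DiffForm M 3} (hφ : ∀ x, IsPositive (φ x)) {k l : ℕ} (h : k + l = 7)
    (α : DiffForm M k) {x : M} {y : E7} (hy : y ∈ (chartAt E7 x).target) :
    localForm (starF φ h α) x y = hodgeStar (localForm φ x y) h (localForm α x y) := by
  obtain ⟨e, he⟩ := exists_equiv_chartSymmDeriv hy
  rw [localForm, localForm, localForm, he, starF, (hφ _).hodgeStar_comp]

theorem isPositive_localForm {φ : DiffForm M 3} (hφ : ∀ x, IsPositive (φ x)) {x : M} {y : E7}
    (hy : y ∈ (chartAt E7 x).target) : IsPositive (localForm φ x y) := by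
  obtain ⟨e, he⟩ := exists_equiv_chartSymmDeriv hy
  obtain ⟨u, hu⟩ := hφ ((chartAt E7 x).symm y)
  refine ⟨e.trans u, ?_⟩
  rw [localForm, he, hu]
  rfl

end Manifold
end
end G2

namespace G2

noncomputable section

open ContinuousAlternatingMap hiding map_sum map_zero

/-! ### The torsion form of a closed `G₂` structure -/

theorem hodgeStar_neg (ρ : AltForm 3) {k l : ℕ} (h : k + l = 7) (α : AltForm k) :
    hodgeStar ρ h (-α) = -hodgeStar ρ h α := by
  have h1 : ∀ v, (-α) v = -α v := fun _ => rfl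
  have h2 : ∀ (a b : ℝ) (β : AltForm l), (-a * b) • β = -((a * b) • β) := fun a b β =>
    ContinuousAlternatingMap.ext fun v => by
      change -a * b * β v = -(a * b * β v)
      ring
  have h3 : ∀ f : (Fin k → Fin 7) → AltForm l, ∑ I, -f I = -∑ I, f I := fun f =>
    Finset.sum_neg_distrib _
  have h4 : ∀ (a : ℝ) (β : AltForm l), a • -β = -(a • β) := fun a β => smul_neg _ _
  simp only [hodgeStar, h1, h2, h3, h4]

theorem hodgeStar_zero (ρ : AltForm 3) {k l : ℕ} (h : k + l = 7) :
    hodgeStar ρ h (0 : AltForm k) = 0 := by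
  simp only [hodgeStar, zero_form_apply, zero_mul, zero_smul, Finset.sum_const_zero, smul_zero]

theorem intProd_zero {k : ℕ} (α : AltForm (k + 1)) : intProd 0 α = 0 :=
  map_zero (curryLeft α)

theorem IsPositive.formInner_two_nonneg {ρ : AltForm 3} (hρ : IsPositive ρ) (τ : AltForm 2) :
    0 ≤ formInner ρ τ τ := by
  obtain ⟨e, rfl⟩ := hρ
  rw [← comp_symm τ e, formInner_two_comp]
  positivity

theorem IsPositive.eq_zero_of_formInner_two {ρ : AltForm 3} (hρ : IsPositive ρ) {τ : AltForm 2}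
    (h : formInner ρ τ τ = 0) : τ = 0 := by
  obtain ⟨e, rfl⟩ := hρ
  rw [← comp_symm τ e, formInner_two_comp] at h
  rw [← comp_symm τ e]
  set σ := τ.compContinuousLinearMap (e.symm : E7 →L[ℝ] E7)
  have h0 : ∑ j, ∑ k, σ ![stdVec j, stdVec k] ^ 2 = 0 := by linarith
  have h1 : ∀ j k, σ ![stdVec j, stdVec k] = 0 := by
    intro j k
    have h2 := (Finset.sum_eq_zero_iff_of_nonneg (fun j _ => by positivity)).1 h0 j (Finset.mem_univ _)
    have h3 := (Finset.sum_eq_zero_iff_of_nonneg (fun j _ => by positivity)).1 h2 k (Finset.mem_univ _)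
    exact pow_eq_zero_iff (two_ne_zero) |>.1 h3
  have h4 : σ = 0 := by
    refine altForm_ext fun I _ => ?_
    rw [vec_two, h1, zero_form_apply]
  rw [h4, zero_comp]

theorem IsPositive.metric_comp {ρ : AltForm 3} (hρ : IsPositive ρ) (e : E7 ≃L[ℝ] E7) (u v : E7) :
    metric (ρ.compContinuousLinearMap (e : E7 →L[ℝ] E7)) u v = metric ρ (e u) (e v) := by
  obtain ⟨f, rfl⟩ := hρ
  have h := G2.metric_comp (e.trans f)
  rw [G2.metric_comp f, pullMetric_apply]
  exact (congrArg (fun g : LinearMap.BilinForm ℝ E7 => g u v) h).trans (pullMetric_apply _ _ _)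

theorem eq_neg_of_eq {k : ℕ} {α β γ : AltForm k} (h₁ : α = -β) (h₂ : β = γ) : α = -γ := h₂ ▸ h₁

theorem starF_zero {M : Type*} (φ : DiffForm M 3) {k l : ℕ} (h : k + l = 7) :
    starF φ h (0 : DiffForm M k) = 0 := funext fun _ => hodgeStar_zero _ h

theorem neg_one_pow_three_smul {M : Type*} {α β : DiffForm M 2} (h : α = β) :
    ((-1 : ℝ) ^ (2 + 1)) • α = -β := by
  subst h
  funext x
  refine ContinuousAlternatingMap.ext fun v => ?_
  change (-1 : ℝ) ^ (2 + 1) * α x v = -α x v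
  ring

section Manifold

variable {M : Type*} [TopologicalSpace M] [ChartedSpace E7 M]

/-- The exterior derivative of a `4`-form. -/
def extd4 (α : DiffForm M 4) : DiffForm M 5 := extd α

/-- The `2`-form `d*φ = -*d*φ`. -/
def torsionForm (φ : DiffForm M 3) : DiffForm M 2 :=
  -starF φ (k := 5) (l := 2) five_add_two (extd4 (psi φ))

theorem codiff_self (φ : DiffForm M 3) (h : 2 + 1 + 4 = 7) :
    codiff φ (m := 2) (l := 4) h φ = torsionForm φ := by
  rw [torsionForm, codiff]
  exact neg_one_pow_three_smul rfl

theorem localForm_neg {k : ℕ} (α : DiffForm M k) (x : M) (y : E7) :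
    localForm (-α) x y = -localForm α x y := rfl

theorem extDeriv_localForm_congr {k : ℕ} {α : DiffForm M k} {f : E7 → AltForm k} {x : M} {y : E7}
    (h : ∀ z ∈ (chartAt E7 x).target, localForm α x z = f z) (hy : y ∈ (chartAt E7 x).target) :
    extDeriv (localForm α x) y = extDeriv f y := by
  refine Filter.EventuallyEq.extDeriv_eq ?_
  filter_upwards [(chartAt E7 x).open_target.mem_nhds hy] with z hz
  exact h z hz

theorem localForm_zero {k : ℕ} (x : M) : localForm (0 : DiffForm M k) x = 0 := rfl

theorem torsionForm_eq_zero_of {φ : DiffForm M 3} (hψ : extd4 (psi φ) = 0) : torsionForm φ = 0 := by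
  rw [torsionForm, hψ, starF_zero, neg_zero]

/-- The two conditions combine to `dψ = -*τ`; applying `*` solves for `τ`. -/
theorem IsG2Structure.eq_torsionForm {φ : DiffForm M 3} (h : IsG2Structure φ) {τ : DiffForm M 2} (hτ : IsTorsionForm φ τ) :
    τ = torsionForm φ := by
  funext x
  have h1 : extd4 (psi φ) x = -hodgeStar (φ x) (k := 2) (l := 5) two_add_five (τ x) :=
    eq_neg_of_eq ((hτ.eq x).trans (hτ.mem x)) rfl
  rw [torsionForm, Pi.neg_apply, starF, h1, hodgeStar_neg, neg_neg, (h.positive x).hodgeStar_two_five]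

variable [IsManifold (𝓡 7) ∞ M]

theorem extd_zero {k : ℕ} : extd (0 : DiffForm M k) = 0 := by
  funext x
  rw [extd_apply, localForm_zero]
  have h := extDeriv_smul (𝕜 := ℝ) (0 : ℝ) (0 : E7 → AltForm k) (x := chartAt E7 x x)
  rw [zero_smul, zero_smul] at h
  exact h

theorem lieDeriv_zero {k : ℕ} (α : DiffForm M (k + 1)) : lieDeriv 0 α = 0 := by
  funext x
  have h1 : (fun y => intProd ((0 : VField M) y) (α y)) = 0 := funext fun y => intProd_zero _
  rw [lieDeriv, h1, extd_zero, Pi.zero_apply, Pi.zero_apply, intProd_zero, add_zero]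

/-- Closedness removes `d*d`, and `d*φ` is `torsionForm φ`, so the soliton equation with zero field
is a condition on `dτ`. -/
theorem hodgeLaplacian_of_closed {φ : DiffForm M 3} (hc : extd φ = 0) :
    hodgeLaplacian φ = extd (torsionForm φ) := by
  rw [hodgeLaplacian, codiff_self, hc, codiff, starF_zero, extd_zero, starF_zero, smul_zero, add_zero]

namespace IsG2Structure

variable {φ : DiffForm M 3}

theorem localForm_psi (h : IsG2Structure φ) {x : M} {y : E7} (hy : y ∈ (chartAt E7 x).target) :
    localForm (psi φ) x y = psiL (localForm φ x) y := localForm_starF h.positive _ _ hy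

theorem isSmoothForm_psi (h : IsG2Structure φ) : IsSmoothForm (psi φ) := fun _ _ hy =>
  ((contDiffAt_psiL (h.smooth.contDiffAt hy) (isPositive_localForm h.positive hy)).contDiffWithinAt).congr
    (fun _ hz => h.localForm_psi hz) (h.localForm_psi hy)

theorem localForm_extd4_psi (h : IsG2Structure φ) {x : M} {y : E7} (hy : y ∈ (chartAt E7 x).target) :
    localForm (extd4 (psi φ)) x y = extDeriv4 (psiL (localForm φ x)) y :=
  (localForm_extd h.isSmoothForm_psi hy).trans
    (extDeriv_localForm_congr (fun _ hz => h.localForm_psi hz) hy)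

theorem localForm_torsionForm (h : IsG2Structure φ) {x : M} {y : E7}
    (hy : y ∈ (chartAt E7 x).target) :
    localForm (torsionForm φ) x y = thetaL (localForm φ x) y := by
  rw [torsionForm, localForm_neg, localForm_starF h.positive five_add_two _ hy,
    h.localForm_extd4_psi hy, thetaL]

theorem isSmoothForm_torsionForm (h : IsG2Structure φ) : IsSmoothForm (torsionForm φ) := fun _ _ hy =>
  ((contDiffAt_thetaL (h.smooth.contDiffAt hy)
    (isPositive_localForm h.positive hy)).contDiffWithinAt).congr
    (fun _ hz => h.localForm_torsionForm hz) (h.localForm_torsionForm hy)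

theorem extDeriv_localForm_eq_zero (h : IsG2Structure φ) (hc : extd φ = 0) {x : M} {y : E7}
    (hy : y ∈ (chartAt E7 x).target) : extDeriv (localForm φ x) y = 0 := by
  rw [← localForm_extd h.smooth hy, hc]
  rfl

theorem extd4_psi_eq (h : IsG2Structure φ) (x : M) :
    extd4 (psi φ) x = extDeriv4 (psiL (localForm φ x)) (chartAt E7 x x) := by
  rw [← localForm_chart (extd4 (psi φ)) x]
  exact h.localForm_extd4_psi (mem_chart_target E7 x)

theorem torsionForm_eq (h : IsG2Structure φ) (x : M) :
    torsionForm φ x = thetaL (localForm φ x) (chartAt E7 x x) := by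
  rw [← localForm_chart (torsionForm φ) x]
  exact h.localForm_torsionForm (mem_chart_target E7 x)

theorem extd4_psi_of_closed (h : IsG2Structure φ) (hc : extd φ = 0) (x : M) :
    extd4 (psi φ) x = wedge (torsionForm φ x) (φ x) ∧
      extd4 (psi φ) x = -hodgeStar (φ x) (k := 2) (l := 5) two_add_five (torsionForm φ x) := by
  have hx := mem_chart_target E7 x
  obtain ⟨e, he⟩ := isPositive_localForm h.positive hx
  obtain ⟨u, B, hA⟩ := exists_isAdapted (h.smooth.contDiffAt hx) he
  have h1 := hA.extDeriv4_psiL_of_closed (h.extDeriv_localForm_eq_zero hc hx)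
  rw [← h.extd4_psi_eq, ← h.torsionForm_eq, localForm_chart] at h1
  exact h1

theorem isTorsionForm (h : IsG2Structure φ) (hc : extd φ = 0) :
    IsTorsionForm φ (torsionForm φ) where
  smooth := h.isSmoothForm_torsionForm
  mem x := eq_neg_of_eq (β := hodgeStar (φ x) (k := 2) (l := 5) two_add_five (torsionForm φ x))
    ((h.extd4_psi_of_closed hc x).1.symm.trans (h.extd4_psi_of_closed hc x).2) rfl
  eq x := (h.extd4_psi_of_closed hc x).1

theorem formInner_torsionForm (h : IsG2Structure φ) (hc : extd φ = 0) {c : ℝ}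
    (hΔ : hodgeLaplacian φ = c • φ) (x : M) :
    7 * c = formInner (φ x) (torsionForm φ x) (torsionForm φ x) := by
  have hx := mem_chart_target E7 x
  rw [hodgeLaplacian_of_closed hc] at hΔ
  have h1 : extDeriv (thetaL (localForm φ x)) (chartAt E7 x x) = c • localForm φ x (chartAt E7 x x) := by
    rw [← extDeriv_localForm_congr (fun _ hz => h.localForm_torsionForm hz) hx, ← extd_apply, hΔ,
      localForm_chart]
    rfl
  have h2 := formInner_thetaL (w := localForm φ x) (y := chartAt E7 x x) (c := c) ?_ h1
  · rwa [localForm_chart, ← h.torsionForm_eq] at h2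
  · filter_upwards [(chartAt E7 x).open_target.mem_nhds hx] with z hz
    exact ⟨h.smooth.contDiffAt hz, isPositive_localForm h.positive hz,
      h.extDeriv_localForm_eq_zero hc hz⟩

theorem isTorsionFree_iff (h : IsG2Structure φ) :
    IsTorsionFree φ ↔ extd φ = 0 ∧ extd4 (psi φ) = 0 := by
  have key : ∀ x : M, (∀ (i : Fin 7) (J : Fin 3 → Fin 7),
      covDeriv (fun y => metric (φ y)) φ x i J = 0) ↔ extd φ x = 0 ∧ extd4 (psi φ) x = 0 := by
    intro x
    have hx := mem_chart_target E7 x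
    have h1 := parallel_iff (h.smooth.contDiffAt hx) (isPositive_localForm h.positive hx)
      (G := localMetric (fun y => metric (φ y)) x) (by
        filter_upwards [(chartAt E7 x).open_target.mem_nhds hx] with z hz i j
        obtain ⟨e, he⟩ := exists_equiv_chartSymmDeriv hz
        rw [localMetric, localForm, he, (h.positive _).metric_comp]
        rfl)
    rw [extd_apply φ, h.extd4_psi_eq]
    exact h1
  constructor
  · intro ht
    exact ⟨funext fun x => ((key x).1 (ht x)).1, funext fun x => ((key x).1 (ht x)).2⟩
  · rintro ⟨h1, h2⟩ x
    exact (key x).2 ⟨congrFun h1 x, congrFun h2 x⟩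

/-- For closed `φ` one has `dψ = -*τ`, so coclosedness is the vanishing of `τ`. -/
theorem isTorsionFree_iff_torsionForm (h : IsG2Structure φ) (hc : extd φ = 0) :
    IsTorsionFree φ ↔ torsionForm φ = 0 := by
  rw [h.isTorsionFree_iff]
  refine ⟨fun ht => torsionForm_eq_zero_of ht.2, fun ht => ⟨hc, funext fun x => ?_⟩⟩
  rw [(h.extd4_psi_of_closed hc x).2, ht, Pi.zero_apply, hodgeStar_zero, neg_zero, Pi.zero_apply]

/-- Read off from `7c = |τ|²`; a point of `M` is needed to conclude `c = 0` from `τ = 0`. -/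
theorem eq_zero_iff (h : IsG2Structure φ) (hc : extd φ = 0) [Nonempty M] {c : ℝ}
    (hΔ : hodgeLaplacian φ = c • φ) : c = 0 ↔ IsTorsionFree φ := by
  rw [h.isTorsionFree_iff_torsionForm hc]
  constructor
  · rintro rfl
    funext x
    refine (h.positive x).eq_zero_of_formInner_two ?_
    rw [← h.formInner_torsionForm hc hΔ x, mul_zero]
  · intro ht
    obtain ⟨x⟩ := ‹Nonempty M›
    have h1 := h.formInner_torsionForm hc hΔ x
    rw [ht] at h1
    have h2 : formInner (φ x) ((0 : DiffForm M 2) x) ((0 : DiffForm M 2) x) = 0 := by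
      simp only [formInner, Pi.zero_apply, zero_form_apply, zero_mul, Finset.sum_const_zero, mul_zero]
    linarith

end IsG2Structure

theorem isStationary_iff [Nonempty M] (φ : DiffForm M 3) :
    IsStationary φ ↔ IsG2Structure φ ∧ IsTorsionFree φ := by
  constructor
  · intro h
    have h0 : (0 : ℝ) ∈ Set.Ici (0 : ℝ) := Set.self_mem_Ici
    have hg := h.isG2 0 h0
    have hc := h.closed 0 h0
    refine ⟨hg, (hg.eq_zero_iff hc (c := 0) ?_).1 rfl⟩
    rw [zero_smul]
    funext x
    -- The one-sided derivative at the end point 0 is unique, so the constant family forces `Δφ =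
    -- 0`, the soliton equation with constant 0.
    exact (uniqueDiffOn_Ici (0 : ℝ) 0 h0).eq_deriv _ (h.eq 0 h0 x) (hasDerivWithinAt_const _ _ _)
  · rintro ⟨hg, ht⟩
    obtain ⟨hc, hψ⟩ := hg.isTorsionFree_iff.1 ht
    refine ⟨fun _ _ => hg, fun _ _ => hc, fun t _ x => ?_⟩
    have h1 : hodgeLaplacian φ = 0 := by
      rw [hodgeLaplacian_of_closed hc, torsionForm_eq_zero_of hψ, extd_zero]
    rw [h1]
    exact hasDerivWithinAt_const _ _ _

theorem IsLaplacianSoliton.hodgeLaplacian_eq {φ : DiffForm M 3} {c : ℝ}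
    (h : IsLaplacianSoliton φ 0 c) : hodgeLaplacian φ = c • φ := by
  rw [h.eq, lieDeriv_zero, add_zero]

theorem IsLaplacianSoliton.properties [Nonempty M] {φ : DiffForm M 3} {c : ℝ}
    (h : IsLaplacianSoliton φ 0 c) :
    (∃! τ : DiffForm M 2, IsTorsionForm φ τ) ∧
      (∀ τ : DiffForm M 2, IsTorsionForm φ τ → ∀ x, c = formInner (φ x) (τ x) (τ x) / 7) ∧
      0 ≤ c ∧ (c = 0 ↔ IsTorsionFree φ) ∧ (0 < c ∨ IsTorsionFree φ) := by
  have hΔ := h.hodgeLaplacian_eq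
  have h0 : 0 ≤ c := by
    obtain ⟨x⟩ := ‹Nonempty M›
    have h1 := h.isG2.formInner_torsionForm h.closed hΔ x
    have h2 := (h.isG2.positive x).formInner_two_nonneg (torsionForm φ x)
    linarith
  have h3 := h.isG2.eq_zero_iff h.closed hΔ
  refine ⟨⟨torsionForm φ, h.isG2.isTorsionForm h.closed, fun τ hτ => h.isG2.eq_torsionForm hτ⟩,
    fun τ hτ x => ?_, h0, h3, ?_⟩
  · rw [h.isG2.eq_torsionForm hτ, ← h.isG2.formInner_torsionForm h.closed hΔ x]
    ring
  · exact h0.lt_or_eq.imp_right fun hc => h3.1 hc.symm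

end Manifold

end

end G2

namespace G2

noncomputable section

/-! ### A divergence theorem on compact manifolds -/

section Integral

open MeasureTheory

/-- Integration by parts against the constant function 1. -/
theorem integral_fderiv_eq_zero {g : E7 → ℝ} (hg : ContDiff ℝ 1 g) (hs : HasCompactSupport g)
    (v : E7) : ∫ z, fderiv ℝ g z v = 0 := by
  have h1 : Integrable (fun z => fderiv ℝ g z v) := by
    refine Continuous.integrable_of_hasCompactSupport ?_ ?_
    · exact (hg.continuous_fderiv (by simp)).clm_apply continuous_const
    · exact (hs.fderiv (𝕜 := ℝ)).comp_left (g := fun L : E7 →L[ℝ] ℝ => L v) rfl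
  have h2 := integral_mul_fderiv_eq_neg_fderiv_mul_of_integrable (μ := volume) (v := v)
    (f := fun _ : E7 => (1 : ℝ)) (g := g) (by simp) (by simpa using h1)
    (by simpa using hg.continuous.integrable_of_hasCompactSupport hs)
    (fun _ _ => differentiableAt_const _) (fun _ _ => hg.differentiable (by simp) _)
  simpa using h2

variable {U K : Set E7}

theorem integrableOn_of_compact (hU : IsOpen U) (hK : IsCompact K) (hKU : K ⊆ U) {g : E7 → ℝ}
    (hg : ContinuousOn g U) (h0 : ∀ z ∈ U \ K, g z = 0) : IntegrableOn g U := by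
  rw [← Set.union_sdiff_cancel hKU]
  refine IntegrableOn.union ((hg.mono hKU).integrableOn_compact hK) ?_
  exact integrableOn_zero.congr_fun (fun z hz => (h0 z hz).symm)
    (hU.measurableSet.diff hK.measurableSet)

/-- Extension by zero is `C¹` on all of `E7`, because `g` vanishes on `U` off the compact set `K`.
-/
theorem setIntegral_fderiv_eq_zero (hU : IsOpen U) (hK : IsCompact K) (hKU : K ⊆ U) {g : E7 → ℝ}
    (hg : ContDiffOn ℝ 1 g U) (h0 : ∀ z ∈ U \ K, g z = 0) (v : E7) :
    ∫ z in U, fderiv ℝ g z v = 0 := by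
  let G : E7 → ℝ := U.indicator g
  have hG0 : ∀ z ∉ K, G z = 0 := by
    intro z hz
    by_cases hzU : z ∈ U
    · exact (Set.indicator_of_mem hzU _).trans (h0 z ⟨hzU, hz⟩)
    · exact Set.indicator_of_notMem hzU _
  have hGU : ∀ z ∈ U, G =ᶠ[nhds z] g := fun z hz => by
    filter_upwards [hU.mem_nhds hz] with y hy
    exact Set.indicator_of_mem hy _
  have hGK : ∀ z ∉ K, G =ᶠ[nhds z] fun _ => 0 := fun z hz => by
    filter_upwards [hK.isClosed.isOpen_compl.mem_nhds hz] with y hy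
    exact hG0 y hy
  have hGs : ContDiff ℝ 1 G := by
    rw [contDiff_iff_contDiffAt]
    intro z
    by_cases hz : z ∈ K
    · exact (hg.contDiffAt (hU.mem_nhds (hKU hz))).congr_of_eventuallyEq (hGU z (hKU hz))
    · exact contDiffAt_const.congr_of_eventuallyEq (hGK z hz)
  have h1 := integral_fderiv_eq_zero hGs (HasCompactSupport.intro hK hG0) v
  have h2 : ∀ z ∉ U, fderiv ℝ G z v = 0 := fun z hz => by
    rw [(hGK z fun h => hz (hKU h)).fderiv_eq]
    simp
  rw [← h1, ← setIntegral_eq_integral_of_forall_compl_eq_zero h2]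
  refine setIntegral_congr_fun hU.measurableSet fun z hz => ?_
  beta_reduce
  rw [(hGU z hz).fderiv_eq]

end Integral

/-- The sign of `N`. -/
def sgn {M : Type*} (N : M → E7 → ℝ) (x : M) (z : E7) : ℝ := N x z / |N x z|

theorem sgn_mul_self {M : Type*} (N : M → E7 → ℝ) (x : M) (z : E7) : sgn N x z * N x z = |N x z| := by
  rw [sgn, div_mul_eq_mul_div, ← abs_mul_abs_self, mul_self_div_self]

section Manifold

open MeasureTheory

variable {M : Type*} [TopologicalSpace M] [ChartedSpace E7 M]

/-- `N` is a family of coordinate expressions of a nowhere vanishing `7`-form, `V` is one of a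
section of `Λ⁷ ⊗ TM`, and the divergence of `V` is `a N`. -/
structure IsDivergenceOf (N : M → E7 → ℝ) (V : M → E7 → E7) (a : ℝ) : Prop where
  continuousOn : ∀ x, ContinuousOn (N x) (chartAt E7 x).target
  contDiffOn : ∀ x, ContDiffOn ℝ ∞ (V x) (chartAt E7 x).target
  ne_zero : ∀ x, ∀ y ∈ (chartAt E7 x).target, N x y ≠ 0
  det_mul : ∀ x p, ∀ y ∈ overlap x p,
    N x y = (fderiv ℝ (coordChange x p) y).det * N p (coordChange x p y)
  det_smul : ∀ x p, ∀ y ∈ overlap x p, fderiv ℝ (coordChange x p) y (V x y) =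
    (fderiv ℝ (coordChange x p) y).det • V p (coordChange x p y)
  div_eq : ∀ x, ∀ y ∈ (chartAt E7 x).target,
    ∑ m, fderiv ℝ (fun z => V x z m) y (stdVec m) = a * N x y

/-- The coordinate expression of a function. -/
def localFun (f : M → ℝ) (x : M) (z : E7) : ℝ := f ((chartAt E7 x).symm z)

/-- The coordinate expression of the support of a function. -/
def localSupp (f : M → ℝ) (x : M) : Set E7 := chartAt E7 x '' tsupport f

theorem isCompact_localSupp [CompactSpace M] {f : M → ℝ} {x : M}
    (hf : tsupport f ⊆ (chartAt E7 x).source) : IsCompact (localSupp f x) :=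
  (isClosed_tsupport f).isCompact.image_of_continuousOn ((chartAt E7 x).continuousOn.mono hf)

theorem localSupp_subset {f : M → ℝ} {x : M}
    (hf : tsupport f ⊆ (chartAt E7 x).source) : localSupp f x ⊆ (chartAt E7 x).target := by
  rintro _ ⟨p, hp, rfl⟩
  exact (chartAt E7 x).map_source (hf hp)

theorem localFun_eq_zero {f : M → ℝ} {x : M} {z : E7} (hz : z ∈ (chartAt E7 x).target \ localSupp f x) :
    localFun f x z = 0 :=
  image_eq_zero_of_notMem_tsupport (f := f) fun h => hz.2 ⟨_, h, (chartAt E7 x).right_inv hz.1⟩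

theorem fderiv_localFun_eq_zero {f : M → ℝ} {x : M} {z : E7} (hz : z ∈ (chartAt E7 x).target)
    (hf : (chartAt E7 x).symm z ∉ tsupport f) : fderiv ℝ (localFun f x) z = 0 := by
  have h1 : localFun f x =ᶠ[nhds z] fun _ => 0 := by
    have h2 : {q | q ∉ tsupport f} ∈ nhds ((chartAt E7 x).symm z) :=
      (isClosed_tsupport f).isOpen_compl.mem_nhds hf
    filter_upwards [((chartAt E7 x).continuousAt_symm hz) h2] with y hy
    exact image_eq_zero_of_notMem_tsupport (f := f) hy
  rw [h1.fderiv_eq]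
  simp

theorem localFun_coordChange (f : M → ℝ) {x p : M} {y : E7} (hy : y ∈ overlap x p) :
    localFun f p (coordChange x p y) = localFun f x y := by
  rw [localFun, chart_symm_coordChange hy, localFun]

theorem fderiv_localFun_coordChange [IsManifold (𝓡 7) ∞ M] {f : M → ℝ} {x p : M} {y : E7}
    (hy : y ∈ overlap x p) (hf : DifferentiableAt ℝ (localFun f p) (coordChange x p y)) :
    fderiv ℝ (localFun f x) y =
      fderiv ℝ (localFun f p) (coordChange x p y) ∘L fderiv ℝ (coordChange x p) y := by
  have h : localFun f x =ᶠ[nhds y] localFun f p ∘ coordChange x p := by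
    filter_upwards [(isOpen_overlap x p).mem_nhds hy] with z hz
    exact (localFun_coordChange f hz).symm
  rw [h.fderiv_eq]
  exact fderiv_comp _ hf (differentiableAt_coordChange hy)

theorem contDiffOn_localFun [IsManifold (𝓡 7) ∞ M] {f : M → ℝ} (hf : ContMDiff (𝓡 7) 𝓘(ℝ) ∞ f)
    (x : M) : ContDiffOn ℝ ∞ (localFun f x) (chartAt E7 x).target := by
  rw [← contMDiffOn_iff_contDiffOn]
  exact hf.comp_contMDiffOn (contMDiffOn_chart_symm (I := 𝓡 7) (x := x))

namespace IsDivergenceOf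

variable {N : M → E7 → ℝ} {V : M → E7 → E7} {a : ℝ}

/-- `N` is continuous without zeros, so its sign is locally constant. It plays the role of an
orientation and passes through derivatives as a constant. -/
theorem sgn_eventuallyEq (h : IsDivergenceOf N V a) {x : M} {z : E7} (hz : z ∈ (chartAt E7 x).target) :
    sgn N x =ᶠ[nhds z] fun _ => sgn N x z := by
  have hc := (h.continuousOn x).continuousAt ((chartAt E7 x).open_target.mem_nhds hz)
  rcases (h.ne_zero x z hz).lt_or_gt with hn | hn
  · filter_upwards [hc.eventually_lt_const hn] with y hy
    rw [sgn, sgn, abs_of_neg hy, abs_of_neg hn, div_neg, div_neg, div_self hy.ne, div_self hn.ne]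
  · filter_upwards [hc.eventually_const_lt hn] with y hy
    rw [sgn, sgn, abs_of_pos hy, abs_of_pos hn, div_self hy.ne', div_self hn.ne']

theorem continuousOn_sgn (h : IsDivergenceOf N V a) (x : M) :
    ContinuousOn (sgn N x) (chartAt E7 x).target := fun _ hz =>
  (continuousAt_const.congr (h.sgn_eventuallyEq hz).symm).continuousWithinAt

/-- The coordinate expression of the density `f dh(V)`. -/
def flux (N : M → E7 → ℝ) (V : M → E7 → E7) (f h : M → ℝ) (x : M) (z : E7) : ℝ :=
  localFun f x z * (sgn N x z * fderiv ℝ (localFun h x) z (V x z))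

variable [IsManifold (𝓡 7) ∞ M]

theorem continuousOn_flux (H : IsDivergenceOf N V a) {f h : M → ℝ}
    (hf : ContMDiff (𝓡 7) 𝓘(ℝ) ∞ f) (hh : ContMDiff (𝓡 7) 𝓘(ℝ) ∞ h) (x : M) :
    ContinuousOn (flux N V f h x) (chartAt E7 x).target :=
  (contDiffOn_localFun hf x).continuousOn.mul ((H.continuousOn_sgn x).mul
    (((contDiffOn_localFun hh x).continuousOn_fderiv_of_isOpen (chartAt E7 x).open_target
      (by simp)).clm_apply (H.contDiffOn x).continuousOn))

/-- `V` contributes the determinant of the transition map and `sgn N` contributes its sign. The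
product is the absolute value, so `flux` is a density. -/
theorem flux_coordChange (H : IsDivergenceOf N V a) (f : M → ℝ) {h : M → ℝ}
    (hh : ContMDiff (𝓡 7) 𝓘(ℝ) ∞ h) {x p : M} {y : E7} (hy : y ∈ overlap x p) :
    flux N V f h x y = |(fderiv ℝ (coordChange x p) y).det| *
      flux N V f h p (coordChange x p y) := by
  have hy' := coordChange_mem hy
  have h1 : DifferentiableAt ℝ (localFun h p) (coordChange x p y) :=
    ((contDiffOn_localFun hh p).contDiffAt ((chartAt E7 p).open_target.mem_nhds hy'.1)).differentiableAt
      (by simp)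
  have hN := H.det_mul x p y hy
  have hx := H.ne_zero x y hy.1
  have hp := H.ne_zero p _ hy'.1
  rw [flux, flux, localFun_coordChange f hy, fderiv_localFun_coordChange hy h1,
    ContinuousLinearMap.comp_apply, H.det_smul x p y hy, map_smul, smul_eq_mul, sgn, sgn, hN]
  generalize (fderiv ℝ (coordChange x p) y).det = d at hN
  have hd : d ≠ 0 := by
    rintro rfl
    exact hx (by rw [hN, zero_mul])
  rw [abs_mul]
  have h2 : |d| * |d| = d * d := abs_mul_abs_self d
  field_simp
  rw [sq_abs]

/-- The density lives on the supports of `f` and `h`, so both integrals reduce to the overlap of the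
charts, where the change of variables formula identifies them. -/
theorem setIntegral_flux (H : IsDivergenceOf N V a) {f h : M → ℝ}
    (hh : ContMDiff (𝓡 7) 𝓘(ℝ) ∞ h) {x p : M}
    (hfp : tsupport f ⊆ (chartAt E7 p).source) (hhx : tsupport h ⊆ (chartAt E7 x).source) :
    ∫ z in (chartAt E7 x).target, flux N V f h x z =
      ∫ z in (chartAt E7 p).target, flux N V f h p z := by
  have himg : coordChange x p '' overlap x p = overlap p x := by
    ext z
    constructor
    · rintro ⟨y, hy, rfl⟩
      exact coordChange_mem hy
    · intro hz
      exact ⟨coordChange p x z, coordChange_mem hz, by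
        rw [coordChange_coordChange hz, coordChange_self hz.1]⟩
  have hinj : Set.InjOn (coordChange x p) (overlap x p) := by
    intro y hy z hz hyz
    have := congrArg (coordChange p x) hyz
    rwa [coordChange_coordChange hy, coordChange_coordChange hz, coordChange_self hy.1,
      coordChange_self hz.1] at this
  have h1 : ∫ z in (chartAt E7 x).target, flux N V f h x z = ∫ z in overlap x p, flux N V f h x z := by
    refine (setIntegral_eq_of_subset_of_forall_sdiff_eq_zero
      (chartAt E7 x).open_target.measurableSet Set.inter_subset_left fun z hz => ?_)
    have h2 : localFun f x z = 0 := image_eq_zero_of_notMem_tsupport (f := f) fun hm => hz.2 ⟨hz.1, hfp hm⟩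
    rw [flux, h2, zero_mul]
  have h2 : ∫ z in (chartAt E7 p).target, flux N V f h p z = ∫ z in overlap p x, flux N V f h p z := by
    refine (setIntegral_eq_of_subset_of_forall_sdiff_eq_zero
      (chartAt E7 p).open_target.measurableSet Set.inter_subset_left fun z hz => ?_)
    rw [flux, fderiv_localFun_eq_zero hz.1 fun hm => hz.2 ⟨hz.1, hhx hm⟩]
    simp
  rw [h1, h2, ← himg, integral_image_eq_integral_abs_det_fderiv_smul volume
    (isOpen_overlap x p).measurableSet
    (fun y hy => (differentiableAt_coordChange hy).hasFDerivAt.hasFDerivWithinAt) hinj]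
  exact setIntegral_congr_fun (isOpen_overlap x p).measurableSet fun y hy =>
    H.flux_coordChange f hh hy

theorem fderiv_sgn_mul (H : IsDivergenceOf N V a) {f : M → ℝ} (hf : ContMDiff (𝓡 7) 𝓘(ℝ) ∞ f)
    {x : M} {z : E7} (hz : z ∈ (chartAt E7 x).target) (m : Fin 7) :
    fderiv ℝ (fun y => sgn N x y * (localFun f x y * V x y m)) z (stdVec m) =
      sgn N x z * (V x z m * fderiv ℝ (localFun f x) z (stdVec m) +
        localFun f x z * fderiv ℝ (fun y => V x y m) z (stdVec m)) := by
  have hU := (chartAt E7 x).open_target.mem_nhds hz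
  have h1 : DifferentiableAt ℝ (localFun f x) z :=
    ((contDiffOn_localFun hf x).contDiffAt hU).differentiableAt (by simp)
  have h2 : DifferentiableAt ℝ (fun y => V x y m) z :=
    (contDiffAt_coord ((H.contDiffOn x).contDiffAt hU) m).differentiableAt (by simp)
  have h3 : (fun y => sgn N x y * (localFun f x y * V x y m)) =ᶠ[nhds z]
      fun y => sgn N x z * (localFun f x y * V x y m) := by
    filter_upwards [H.sgn_eventuallyEq hz] with y hy
    rw [hy]
  rw [h3.fderiv_eq, fderiv_const_mul (h1.fun_mul h2), fderiv_fun_mul h1 h2]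
  simp only [_root_.smul_apply, _root_.add_apply, smul_eq_mul]
  ring

/-- The divergence of `sgn N · f · V` integrates to zero by compact support; expand it with `div V =
a N` and `sgn N · N = |N|`. -/
theorem setIntegral_green [CompactSpace M] (H : IsDivergenceOf N V a) {f : M → ℝ}
    (hf : ContMDiff (𝓡 7) 𝓘(ℝ) ∞ f) {x : M} (hfx : tsupport f ⊆ (chartAt E7 x).source) :
    ∫ z in (chartAt E7 x).target, sgn N x z * fderiv ℝ (localFun f x) z (V x z) =
      -(a * ∫ z in (chartAt E7 x).target, localFun f x z * |N x z|) := by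
  have hU := (chartAt E7 x).open_target
  have hK := isCompact_localSupp hfx
  have hKU := localSupp_subset hfx
  have hf' := contDiffOn_localFun hf x
  have hd0 : ∀ z ∈ (chartAt E7 x).target \ localSupp f x, fderiv ℝ (localFun f x) z = 0 :=
    fun z hz => fderiv_localFun_eq_zero hz.1 fun h => hz.2 ⟨_, h, (chartAt E7 x).right_inv hz.1⟩
  have hV : ∀ m, ContDiffOn ℝ ∞ (fun y => V x y m) (chartAt E7 x).target := fun m y hy =>
    (contDiffAt_coord ((H.contDiffOn x).contDiffAt (hU.mem_nhds hy)) m).contDiffWithinAt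
  have hdV : ∀ m, ContinuousOn (fun z => fderiv ℝ (fun y => V x y m) z (stdVec m))
      (chartAt E7 x).target := fun m =>
    ((hV m).continuousOn_fderiv_of_isOpen hU (by simp)).clm_apply continuousOn_const
  have hdf : ∀ m, ContinuousOn (fun z => fderiv ℝ (localFun f x) z (stdVec m))
      (chartAt E7 x).target := fun m =>
    (hf'.continuousOn_fderiv_of_isOpen hU (by simp)).clm_apply continuousOn_const
  have h0 : ∀ m, ∫ z in (chartAt E7 x).target,
      sgn N x z * (V x z m * fderiv ℝ (localFun f x) z (stdVec m) +
        localFun f x z * fderiv ℝ (fun y => V x y m) z (stdVec m)) = 0 := by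
    intro m
    have h1 := setIntegral_fderiv_eq_zero hU hK hKU
      (g := fun y => sgn N x y * (localFun f x y * V x y m)) (fun z hz => ?_) (fun z hz => ?_)
      (stdVec m)
    · rw [← h1]
      exact setIntegral_congr_fun hU.measurableSet fun z hz => (H.fderiv_sgn_mul hf hz m).symm
    · refine ContDiffAt.contDiffWithinAt (ContDiffAt.mul ?_ ?_)
      · exact contDiffAt_const.congr_of_eventuallyEq (H.sgn_eventuallyEq hz)
      · exact ((hf'.mul (hV m)).contDiffAt (hU.mem_nhds hz)).of_le (by simp)
    · rw [localFun_eq_zero hz, zero_mul, mul_zero]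
  have h1 : ∫ z in (chartAt E7 x).target, ∑ m,
      sgn N x z * (V x z m * fderiv ℝ (localFun f x) z (stdVec m) +
        localFun f x z * fderiv ℝ (fun y => V x y m) z (stdVec m)) = 0 := by
    rw [integral_finsetSum]
    · exact Finset.sum_eq_zero fun m _ => h0 m
    · intro m _
      refine integrableOn_of_compact hU hK hKU ?_ fun z hz => ?_
      · exact (H.continuousOn_sgn x).mul (((hV m).continuousOn.mul (hdf m)).add
          (hf'.continuousOn.mul (hdV m)))
      · rw [hd0 z hz, localFun_eq_zero hz]
        simp
  have h2 : ∫ z in (chartAt E7 x).target, (sgn N x z * fderiv ℝ (localFun f x) z (V x z) +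
      a * (localFun f x z * |N x z|)) = 0 := by
    rw [← h1]
    refine setIntegral_congr_fun hU.measurableSet fun z hz => ?_
    beta_reduce
    rw [← Finset.mul_sum, Finset.sum_add_distrib, ← Finset.mul_sum, H.div_eq x z hz,
      ← sgn_mul_self]
    have h3 : fderiv ℝ (localFun f x) z (V x z) =
        ∑ m, V x z m * fderiv ℝ (localFun f x) z (stdVec m) := by
      conv_lhs => rw [← sum_stdVec (V x z)]
      rw [map_sum]
      simp only [map_smul, smul_eq_mul]
    rw [h3]
    ring
  rw [integral_add, integral_const_mul] at h2
  · linarith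
  · refine integrableOn_of_compact hU hK hKU ?_ fun z hz => ?_
    · exact (H.continuousOn_sgn x).mul ((hf'.continuousOn_fderiv_of_isOpen hU
        (by simp)).clm_apply (H.contDiffOn x).continuousOn)
    · rw [hd0 z hz]
      simp
  · refine Integrable.const_mul (integrableOn_of_compact hU hK hKU ?_ fun z hz => ?_) a
    · exact hf'.continuousOn.mul (H.continuousOn x).abs
    · rw [localFun_eq_zero hz, zero_mul]

theorem integral_pos [CompactSpace M] (H : IsDivergenceOf N V a) {f : M → ℝ}
    (hf : ContMDiff (𝓡 7) 𝓘(ℝ) ∞ f) {x : M} (hfx : tsupport f ⊆ (chartAt E7 x).source)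
    (h0 : ∀ p, 0 ≤ f p) {q : M} (hq : 0 < f q) :
    0 < ∫ z in (chartAt E7 x).target, localFun f x z * |N x z| := by
  have hU := (chartAt E7 x).open_target
  have hc : ContinuousOn (fun z => localFun f x z * |N x z|) (chartAt E7 x).target :=
    (contDiffOn_localFun hf x).continuousOn.mul (H.continuousOn x).abs
  rw [setIntegral_pos_iff_support_of_nonneg_ae]
  · have h1 : IsOpen ((chartAt E7 x).target ∩
        (fun z => localFun f x z * |N x z|) ⁻¹' {0}ᶜ) :=
      hc.isOpen_inter_preimage hU isOpen_compl_singleton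
    rw [Set.inter_comm]
    refine h1.measure_pos _ ⟨chartAt E7 x q, ?_⟩
    have hqx : q ∈ (chartAt E7 x).source := hfx (subset_tsupport f (Function.mem_support.2 hq.ne'))
    refine ⟨(chartAt E7 x).map_source hqx, ?_⟩
    have h2 : localFun f x (chartAt E7 x q) = f q := by
      rw [localFun, (chartAt E7 x).left_inv hqx]
    refine mul_ne_zero ?_ (abs_ne_zero.2 (H.ne_zero x _ ((chartAt E7 x).map_source hqx)))
    rw [h2]
    exact hq.ne'
  · exact ae_of_all _ fun z => mul_nonneg (h0 _) (abs_nonneg _)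
  · exact integrableOn_of_compact hU (isCompact_localSupp hfx) (localSupp_subset hfx) hc
      fun z hz => by rw [localFun_eq_zero hz, zero_mul]

/-- On a compact manifold the divergence has no constant sign. -/
theorem eq_zero [CompactSpace M] [T2Space M] [Nonempty M] (H : IsDivergenceOf N V a) : a = 0 := by
  obtain ⟨t, ht⟩ := isCompact_univ.elim_finite_subcover (fun x : M => (chartAt E7 x).source)
    (fun x => (chartAt E7 x).open_source) (fun x _ => Set.mem_iUnion.2 ⟨x, mem_chart_source E7 x⟩)
  obtain ⟨ρ, hρ⟩ := SmoothPartitionOfUnity.exists_isSubordinate (𝓡 7) isClosed_univ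
    (fun x : t => (chartAt E7 (x : M)).source) (fun x => (chartAt E7 (x : M)).open_source)
    (fun x hx => by
      obtain ⟨i, hi, hxi⟩ := Set.mem_iUnion₂.1 (ht hx)
      exact Set.mem_iUnion.2 ⟨⟨i, hi⟩, hxi⟩)
  have hs : ∀ i, ContMDiff (𝓡 7) 𝓘(ℝ) ∞ (ρ i) := fun i => (ρ i).contMDiff
  have hsum : ∀ q, ∑ i, ρ i q = 1 := fun q => by
    rw [← finsum_eq_sum_of_fintype]
    exact ρ.sum_eq_one (Set.mem_univ q)
  have hflux : ∀ i j (x : M), (tsupport (ρ i) ⊆ (chartAt E7 x).source ∨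
      tsupport (ρ j) ⊆ (chartAt E7 x).source) →
      IntegrableOn (flux N V (ρ i) (ρ j) x) (chartAt E7 x).target := by
    intro i j x hx
    rcases hx with hx | hx
    · refine integrableOn_of_compact (chartAt E7 x).open_target (isCompact_localSupp hx)
        (localSupp_subset hx) (H.continuousOn_flux (hs i) (hs j) x) fun z hz => ?_
      rw [flux, localFun_eq_zero hz, zero_mul]
    · refine integrableOn_of_compact (chartAt E7 x).open_target (isCompact_localSupp hx)
        (localSupp_subset hx) (H.continuousOn_flux (hs i) (hs j) x) fun z hz => ?_
      rw [flux, fderiv_localFun_eq_zero hz.1 fun h => hz.2 ⟨_, h, (chartAt E7 x).right_inv hz.1⟩]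
      simp
  -- In the chart of `j` the sum over `i` collapses by `∑ ρ i = 1`, leaving the integral of
  -- `dρ_j(V)`.
  have h1 : ∀ j : t, ∑ i, ∫ z in (chartAt E7 (j : M)).target, flux N V (ρ i) (ρ j) j z =
      -(a * ∫ z in (chartAt E7 (j : M)).target, localFun (ρ j) j z * |N j z|) := by
    intro j
    rw [← H.setIntegral_green (hs j) (hρ j), ← integral_finsetSum _ fun i _ => hflux i j j (.inr (hρ j))]
    refine setIntegral_congr_fun (chartAt E7 (j : M)).open_target.measurableSet fun z _ => ?_
    beta_reduce
    simp only [flux, localFun]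
    rw [← Finset.sum_mul, hsum, one_mul]
  -- In the chart of `i` the sum over `j` vanishes, since `∑ dρ_j = d 1 = 0`.
  have h2 : ∀ i : t, ∑ j, ∫ z in (chartAt E7 (i : M)).target, flux N V (ρ i) (ρ j) i z = 0 := by
    intro i
    rw [← integral_finsetSum _ fun j _ => hflux i j i (.inl (hρ i))]
    refine setIntegral_eq_zero_of_forall_eq_zero fun z hz => ?_
    simp only [flux]
    have h3 : ∀ j, DifferentiableAt ℝ (localFun (ρ j) (i : M)) z := fun j =>
      ((contDiffOn_localFun (hs j) (i : M)).contDiffAt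
        ((chartAt E7 (i : M)).open_target.mem_nhds hz)).differentiableAt (by simp)
    have h4 : ∑ j, fderiv ℝ (localFun (ρ j) (i : M)) z = 0 := by
      rw [← fderiv_fun_sum fun j _ => h3 j]
      have h5 : (fun z => ∑ j, localFun (ρ j) (i : M) z) = fun _ => (1 : ℝ) :=
        funext fun z => hsum _
      rw [h5]
      simp
    rw [← Finset.mul_sum, ← Finset.mul_sum, ← _root_.sum_apply, h4]
    simp
  have h3 : ∑ j : t, a * ∫ z in (chartAt E7 (j : M)).target, localFun (ρ j) j z * |N j z| = 0 := by
    have h4 : ∑ j : t, -(a * ∫ z in (chartAt E7 (j : M)).target, localFun (ρ j) j z * |N j z|) = 0 := by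
      rw [← Finset.sum_congr rfl fun j _ => h1 j, Finset.sum_comm]
      refine Finset.sum_eq_zero fun i _ => ?_
      rw [← h2 i]
      -- Each double term may be integrated in either chart, which makes the two summations
      -- comparable.
      exact Finset.sum_congr rfl fun j _ => H.setIntegral_flux (hs j) (hρ i) (hρ j)
    rwa [Finset.sum_neg_distrib, neg_eq_zero] at h4
  rw [← Finset.mul_sum] at h3
  refine (mul_eq_zero.1 h3).resolve_right (ne_of_gt ?_)
  obtain ⟨q⟩ := ‹Nonempty M›
  obtain ⟨j, hj⟩ : ∃ j, 0 < ρ j q := by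
    by_contra! hcon
    have := Finset.sum_nonpos fun j (_ : j ∈ Finset.univ) => hcon j
    rw [hsum] at this
    linarith
  refine Finset.sum_pos' (fun i _ => ?_) ⟨j, Finset.mem_univ _, H.integral_pos (hs j) (hρ j)
    (fun p => ρ.nonneg j p) hj⟩
  exact integral_nonneg fun z => mul_nonneg (ρ.nonneg i _) (abs_nonneg _)

end IsDivergenceOf

end Manifold

end

end G2

namespace G2

noncomputable section

open ContinuousAlternatingMap hiding map_sum map_zero

/-! ### The cube of the torsion form -/

/-- Makes algebraically defined linear and trilinear maps of forms continuous, hence smooth. -/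
instance finiteDimensional_altForm (k : ℕ) : FiniteDimensional ℝ (AltForm k) := by
  classical
  refine Module.Finite.of_surjective (Fintype.linearCombination ℝ (eform : (Fin k → Fin 7) → AltForm k))
    fun α => ⟨fun I => if StrictMono I then α (fun a => stdVec (I a)) else 0, ?_⟩
  rw [Fintype.linearCombination_apply]
  conv_rhs => rw [altForm_eq_sum α]
  rw [Finset.sum_filter]
  refine Finset.sum_congr rfl fun I _ => ?_
  split_ifs
  · rfl
  · exact zero_smul ℝ _

/-! ### Smoothness and the Leibniz rule for trilinear maps. -/

section Trilinear

variable {E F G : Type*} [NormedAddCommGroup E] [NormedSpace ℝ E] [FiniteDimensional ℝ E]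
  [NormedAddCommGroup F] [NormedSpace ℝ F] [FiniteDimensional ℝ F]
  [NormedAddCommGroup G] [NormedSpace ℝ G] [FiniteDimensional ℝ G]
  {f : E7 → E} {g : E7 → F} {h : E7 → G} {y : E7}

theorem exists_continuous_trilinear (T : E →ₗ[ℝ] F →ₗ[ℝ] G →ₗ[ℝ] ℝ) :
    ∃ S : E →L[ℝ] F →L[ℝ] G →L[ℝ] ℝ, ∀ a b c, S a b c = T a b c :=
  ⟨(T.compr₂ (LinearMap.toContinuousLinearMap :
    (G →ₗ[ℝ] ℝ) ≃ₗ[ℝ] (G →L[ℝ] ℝ)).toLinearMap).toContinuousBilinearMap, fun _ _ _ => rfl⟩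

theorem contDiffAt_trilinear_map (T : E →ₗ[ℝ] F →ₗ[ℝ] G →ₗ[ℝ] ℝ)
    (hf : ContDiffAt ℝ ∞ f y) (hg : ContDiffAt ℝ ∞ g y) (hh : ContDiffAt ℝ ∞ h y) :
    ContDiffAt ℝ ∞ (fun z => T (f z) (g z) (h z)) y := by
  obtain ⟨S, hS⟩ := exists_continuous_trilinear T
  simp only [← hS]
  exact ((S.contDiff.contDiffAt.comp y hf).clm_apply hg).clm_apply hh

theorem fderiv_trilinear_map (T : E →ₗ[ℝ] F →ₗ[ℝ] G →ₗ[ℝ] ℝ)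
    (hf : DifferentiableAt ℝ f y) (hg : DifferentiableAt ℝ g y)
    (hh : DifferentiableAt ℝ h y) (v : E7) : fderiv ℝ (fun z => T (f z) (g z) (h z)) y v =
      T (fderiv ℝ f y v) (g y) (h y) + T (f y) (fderiv ℝ g y v) (h y) +
        T (f y) (g y) (fderiv ℝ h y v) := by
  obtain ⟨S, hS⟩ := exists_continuous_trilinear T
  simp only [← hS]
  have h1 := S.hasFDerivAt_of_bilinear hf.hasFDerivAt hg.hasFDerivAt
  rw [(h1.clm_apply hh.hasFDerivAt).fderiv]
  change S (f y) (g y) (fderiv ℝ h y v) +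
    (S (f y) (fderiv ℝ g y v) + S (fderiv ℝ f y v) (g y)) (h y) = _
  rw [_root_.add_apply]
  ring

end Trilinear

section Forms

variable {k l n : ℕ} {f : E7 → AltForm k} {g : E7 → AltForm l} {h : E7 → AltForm n} {y : E7}

theorem contDiffAt_linear (L : AltForm k →ₗ[ℝ] AltForm n) (hf : ContDiffAt ℝ ∞ f y) :
    ContDiffAt ℝ ∞ (fun z => L (f z)) y :=
  L.toContinuousLinearMap.contDiff.contDiffAt.comp y hf

theorem fderiv_linear (L : AltForm k →ₗ[ℝ] AltForm n) (hf : DifferentiableAt ℝ f y) (v : E7) :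
    fderiv ℝ (fun z => L (f z)) y v = L (fderiv ℝ f y v) := by
  have h := (L.toContinuousLinearMap.hasFDerivAt.comp y hf.hasFDerivAt).fderiv
  exact congrArg (fun L : E7 →L[ℝ] AltForm n => L v) h

theorem contDiffAt_trilinear (T : AltForm k →ₗ[ℝ] AltForm l →ₗ[ℝ] AltForm n →ₗ[ℝ] ℝ)
    (hf : ContDiffAt ℝ ∞ f y) (hg : ContDiffAt ℝ ∞ g y)
    (hh : ContDiffAt ℝ ∞ h y) : ContDiffAt ℝ ∞ (fun z => T (f z) (g z) (h z)) y :=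
  contDiffAt_trilinear_map T hf hg hh

theorem fderiv_trilinear (T : AltForm k →ₗ[ℝ] AltForm l →ₗ[ℝ] AltForm n →ₗ[ℝ] ℝ)
    (hf : DifferentiableAt ℝ f y) (hg : DifferentiableAt ℝ g y)
    (hh : DifferentiableAt ℝ h y) (v : E7) : fderiv ℝ (fun z => T (f z) (g z) (h z)) y v =
      T (fderiv ℝ f y v) (g y) (h y) + T (f y) (fderiv ℝ g y v) (h y) +
        T (f y) (g y) (fderiv ℝ h y v) :=
  fderiv_trilinear_map T hf hg hh v

end Forms

variable {t : E7 → AltForm 2} {y : E7}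

theorem wedge223_eform_eq (I J : Fin 2 → Fin 7) (K : Fin 3 → Fin 7) :
    wedge223 (eform I) (eform J) (eform K) =
      vol0 (fun i => stdVec (![I 0, I 1, J 0, J 1, K 0, K 1, K 2] i)) := by
  have hI : I = ![I 0, I 1] := by funext i; fin_cases i <;> rfl
  have hJ : J = ![J 0, J 1] := by funext i; fin_cases i <;> rfl
  have hK : K = ![K 0, K 1, K 2] := by funext i; fin_cases i <;> rfl
  rw [vol0_std, hI, hJ, hK, wedge223_eform]
  rfl

theorem seven_perm (ν : AltForm 7) (v : Fin 7 → E7) (σ : Equiv.Perm (Fin 7))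
    (hσ : Equiv.Perm.sign σ = 1) : ν (fun i => v (σ i)) = ν v := by
  have h := ν.toAlternatingMap.map_perm v σ
  rw [hσ, one_smul] at h
  exact h

/-- Exchanging two blocks of two indices is an even permutation. The same holds across the covector
`eᵐ` in `wedge223_extTwo_comm`. -/
theorem wedge223_comm (a b : AltForm 2) (χ : AltForm 3) : wedge223 a b χ = wedge223 b a χ := by
  have h : (wedge223 : AltForm 2 →ₗ[ℝ] AltForm 2 →ₗ[ℝ] AltForm 3 →ₗ[ℝ] ℝ) = wedge223.flip := by
    refine form_induction fun I => form_induction fun J => form_induction fun K => ?_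
    rw [LinearMap.flip_apply, wedge223_eform_eq, wedge223_eform_eq]
    rw [← seven_perm vol0 _ (Equiv.swap 0 2 * Equiv.swap 1 3) (by decide)]
    congr 1
    funext i
    fin_cases i <;> rfl
  exact congrArg (fun L : AltForm 2 →ₗ[ℝ] AltForm 2 →ₗ[ℝ] AltForm 3 →ₗ[ℝ] ℝ => L a b χ) h

/-- The map `c ↦ eᵐ ∧ c` on `2`-forms. -/
def extTwo (m : Fin 7) : AltForm 2 →ₗ[ℝ] AltForm 3 := ext1 (k := 2) m

theorem extTwo_eform (m : Fin 7) (I : Fin 2 → Fin 7) :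
    ∃ K : Fin 3 → Fin 7, (K 0 = m ∧ K 1 = I 0 ∧ K 2 = I 1) ∧ extTwo m (eform I) = eform K :=
  ⟨Fin.cons m I, ⟨rfl, rfl, rfl⟩, ext1_eform m I⟩

/-- The coefficient of `a ∧ b ∧ eᵐ ∧ c`. -/
def wedge222 (m : Fin 7) : AltForm 2 →ₗ[ℝ] AltForm 2 →ₗ[ℝ] AltForm 2 →ₗ[ℝ] ℝ :=
  wedge223.compr₂ (LinearMap.lcomp ℝ ℝ (extTwo m))

theorem wedge222_apply (m : Fin 7) (a b c : AltForm 2) :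
    wedge222 m a b c = wedge223 a b (extTwo m c) := by
  rw [wedge222, LinearMap.compr₂_apply, LinearMap.lcomp_apply]

theorem wedge222_eform (m : Fin 7) (I J K : Fin 2 → Fin 7) :
    wedge222 m (eform I) (eform J) (eform K) =
      vol0 (fun i => stdVec (![I 0, I 1, J 0, J 1, m, K 0, K 1] i)) := by
  obtain ⟨L, ⟨h0, h1, h2⟩, hL⟩ := extTwo_eform m K
  rw [wedge222_apply, hL, wedge223_eform_eq, h0, h1, h2]

theorem wedge223_extTwo_comm (m : Fin 7) (a b c : AltForm 2) :
    wedge223 a b (extTwo m c) = wedge223 a c (extTwo m b) := by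
  have h : ∀ a, wedge222 m a = (wedge222 m a).flip := by
    have h1 : wedge222 m = LinearMap.lflip.toLinearMap ∘ₗ wedge222 m := by
      refine form_induction fun I => form_induction fun J => form_induction fun K => ?_
      rw [LinearMap.comp_apply]
      change _ = (wedge222 m (eform I)).flip (eform J) (eform K)
      rw [LinearMap.flip_apply, wedge222_eform, wedge222_eform]
      rw [← seven_perm vol0 _ (Equiv.swap 2 5 * Equiv.swap 3 6) (by decide)]
      congr 1
      funext i
      fin_cases i <;> rfl
    exact fun a => congrArg (fun L => L a) h1
  rw [← wedge222_apply, h, LinearMap.flip_apply, wedge222_apply]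

theorem seven_comp_std {ν ν' : AltForm 7} {u : E7 →L[ℝ] E7} (h : ν' = ν.compContinuousLinearMap u) :
    ν' stdVec = u.det * ν stdVec := by
  rw [h, seven_comp]
  rfl

theorem wedge223_comp (a b : AltForm 2) (χ : AltForm 3) (u : E7 →L[ℝ] E7) :
    wedge223 (a.compContinuousLinearMap u) (b.compContinuousLinearMap u)
      (χ.compContinuousLinearMap u) = u.det * wedge223 a b χ := by
  rw [wedge223_apply, wedge223_apply, wedge_comp]
  exact seven_comp_std (wedge_comp (k := 4) (l := 3) (wedge a b) χ u)

/-- The `3`-form `ξ ∧ t`. -/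
def covWedge (ξ : E7 →L[ℝ] ℝ) (t : AltForm 2) : AltForm 3 := alternatizeUncurryFin (ξ.smulRight t)

theorem extTwo_apply (m : Fin 7) (t : AltForm 2) : extTwo m t = covWedge (EuclideanSpace.proj m) t :=
  rfl

/-- The antisymmetrisation of `f`. -/
def altTwo (f : E7 →L[ℝ] AltForm 2) : AltForm 3 := alternatizeUncurryFin f

theorem altTwo_eq_sum (f : E7 →L[ℝ] AltForm 2) : altTwo f = ∑ m, extTwo m (f (stdVec m)) :=
  alternatize_eq_sum_ext1 f

theorem covWedge_eq_sum (ξ : E7 →L[ℝ] ℝ) (t : AltForm 2) :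
    covWedge ξ t = ∑ m, extTwo m (ξ (stdVec m) • t) := altTwo_eq_sum (ξ.smulRight t)

theorem covWedge_comp (ξ : E7 →L[ℝ] ℝ) (t : AltForm 2) (e : E7 ≃L[ℝ] E7) :
    covWedge (ξ ∘L (e : E7 →L[ℝ] E7)) (t.compContinuousLinearMap (e : E7 →L[ℝ] E7)) =
      (covWedge ξ t).compContinuousLinearMap (e : E7 →L[ℝ] E7) :=
  alternatize_comp e (ξ.smulRight t) _ fun _ => rfl

/-- The vector `v` with `v ⌟ vol₀ = t ∧ t ∧ t`. -/
def cubeVec (t : AltForm 2) : E7 := WithLp.toLp 2 fun m => wedge223 t t (extTwo m t)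

theorem cubeVec_apply (t : AltForm 2) (m : Fin 7) : cubeVec t m = wedge223 t t (extTwo m t) := rfl

theorem covector_cubeVec (t : AltForm 2) (ξ : E7 →L[ℝ] ℝ) :
    ξ (cubeVec t) = wedge223 t t (covWedge ξ t) := by
  rw [covWedge_eq_sum, map_sum]
  conv_lhs => rw [← sum_stdVec (cubeVec t)]
  rw [map_sum]
  refine Finset.sum_congr rfl fun m _ => ?_
  rw [map_smul, map_smul, map_smul, cubeVec_apply, smul_eq_mul, smul_eq_mul, mul_comm]

/-- Tested on coordinate covectors: pulling back a top form multiplies it by the determinant, and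
`covector_cubeVec` transfers this to the vector. -/
theorem cubeVec_comp (t : AltForm 2) (e : E7 ≃L[ℝ] E7) :
    e (cubeVec (t.compContinuousLinearMap (e : E7 →L[ℝ] E7))) =
      (e : E7 →L[ℝ] E7).det • cubeVec t := by
  ext q
  have h1 := covector_cubeVec (t.compContinuousLinearMap (e : E7 →L[ℝ] E7))
    ((EuclideanSpace.proj q : E7 →L[ℝ] ℝ) ∘L (e : E7 →L[ℝ] E7))
  rw [covWedge_comp, wedge223_comp, ← extTwo_apply, ← cubeVec_apply] at h1
  exact h1

/-- This is `d(t³) = 3 t ∧ t ∧ dt`: the three Leibniz terms agree because forms of even degree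
commute. -/
theorem sum_fderiv_cubeVec (ht : ContDiffAt ℝ ∞ t y) :
    ∑ m, fderiv ℝ (fun z => cubeVec (t z) m) y (stdVec m) =
      3 * wedge223 (t y) (t y) (altTwo (fderiv ℝ t y)) := by
  rw [altTwo_eq_sum, map_sum, Finset.mul_sum]
  refine Finset.sum_congr rfl fun m _ => ?_
  simp only [cubeVec_apply]
  have hd : DifferentiableAt ℝ t y := ht.differentiableAt (by simp)
  rw [fderiv_trilinear wedge223 hd hd ((contDiffAt_linear (extTwo m) ht).differentiableAt (by simp)),
    fderiv_linear (extTwo m) hd, wedge223_comm (fderiv ℝ t y (stdVec m)), wedge223_extTwo_comm m _ (fderiv ℝ t y (stdVec m))]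
  ring

/-- The eigenvalue -2 turns `¼ σ_{kl} σ_{ij} ψ_{klij}` into `-½ σ_{kl} σ_{kl}`, that is `-|σ|²` in
the norm of 2-forms. In particular `σ ∧ σ ∧ φ` vanishes only with `σ`. -/
theorem IsLambda14.wedge223_phi0 {σ : AltForm 2} (hσ : IsLambda14 σ) :
    wedge223 σ σ phi0 = -(1 / 2 : ℝ) * ∑ k, ∑ l, σ ![stdVec k, stdVec l] ^ 2 := by
  have h1 : ∀ i j, ∑ k, ∑ l, σ ![stdVec k, stdVec l] * σ ![stdVec i, stdVec j] * (psiI k l i j : ℝ) =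
      -2 * σ ![stdVec i, stdVec j] ^ 2 := by
    intro i j
    have h2 := hσ.sum_psiI i j
    calc _ = σ ![stdVec i, stdVec j] * ∑ k, ∑ l, σ ![stdVec k, stdVec l] * (psiI k l i j : ℝ) := by
          simp only [Finset.mul_sum]
          exact Finset.sum_congr rfl fun k _ => Finset.sum_congr rfl fun l _ => by ring
      _ = _ := by rw [h2]; ring
  rw [G2.wedge223_phi0, sum_comm_pairs]
  simp only [h1, ← Finset.mul_sum]
  ring

section Manifold

variable {M : Type*} [TopologicalSpace M] [ChartedSpace E7 M] [IsManifold (𝓡 7) ∞ M]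
  {φ : DiffForm M 3}

theorem IsG2Structure.wedge223_torsionForm_ne_zero (h : IsG2Structure φ) (hc : extd φ = 0) {p : M}
    (hp : torsionForm φ p ≠ 0) : wedge223 (torsionForm φ p) (torsionForm φ p) (φ p) ≠ 0 := by
  have hx := mem_chart_target E7 p
  obtain ⟨e, he⟩ := isPositive_localForm h.positive hx
  obtain ⟨u, B, hA⟩ := exists_isAdapted (h.smooth.contDiffAt hx) he
  have h0 := h.extDeriv_localForm_eq_zero hc hx
  have h1 := hA.thetaL_eq h0
  rw [← h.torsionForm_eq] at h1
  rw [localForm_chart] at he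
  have h14 := hA.isLambda14 h0
  intro hN
  rw [h1, he, wedge223_comp, h14.wedge223_phi0] at hN
  have hdet : (e : E7 →L[ℝ] E7).det ≠ 0 := by
    have := e.toLinearEquiv.isUnit_det'
    exact this.ne_zero
  have h2 := (mul_eq_zero.1 hN).resolve_left hdet
  refine hp ((h.positive p).eq_zero_of_formInner_two ?_)
  rw [h1, he, formInner_two_comp]
  linarith

/-- `N` is `τ ∧ τ ∧ φ` and `V` encodes `τ³`. The divergence is `3 τ ∧ τ ∧ dτ = 3c N` since `dτ =
cφ`. `N` has no zeros because `|τ|² = 7c ≠ 0` at every point. -/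
theorem IsG2Structure.isDivergenceOf (h : IsG2Structure φ) (hc : extd φ = 0) {c : ℝ} (hc0 : c ≠ 0)
    (hΔ : hodgeLaplacian φ = c • φ) :
    IsDivergenceOf (fun x z => wedge223 (localForm (torsionForm φ) x z)
      (localForm (torsionForm φ) x z) (localForm φ x z))
      (fun x z => cubeVec (localForm (torsionForm φ) x z)) (3 * c) := by
  have hτ := h.isSmoothForm_torsionForm
  have hdet : ∀ x p, ∀ y ∈ overlap x p, wedge223 (localForm (torsionForm φ) x y)
      (localForm (torsionForm φ) x y) (localForm φ x y) =
      (fderiv ℝ (coordChange x p) y).det * wedge223 (localForm (torsionForm φ) p (coordChange x p y))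
      (localForm (torsionForm φ) p (coordChange x p y)) (localForm φ p (coordChange x p y)) := by
    intro x p y hy
    rw [localForm_coordChange (torsionForm φ) hy, localForm_coordChange φ hy, wedge223_comp]
  refine ⟨fun x y hy => ?_, fun x y hy => ?_, fun x y hy => ?_, hdet, fun x p y hy => ?_,
    fun x y hy => ?_⟩
  · exact (contDiffAt_trilinear wedge223 (hτ.contDiffAt hy) (hτ.contDiffAt hy)
      (h.smooth.contDiffAt hy)).continuousAt.continuousWithinAt
  · refine ContDiffAt.contDiffWithinAt ?_
    rw [contDiffAt_euclidean]
    intro m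
    exact contDiffAt_trilinear wedge223 (hτ.contDiffAt hy) (hτ.contDiffAt hy)
      (contDiffAt_linear (extTwo m) (hτ.contDiffAt hy))
  · have hm := mem_overlap_symm hy
    beta_reduce
    have h3 : coordChange x ((chartAt E7 x).symm y) y =
      chartAt E7 ((chartAt E7 x).symm y) ((chartAt E7 x).symm y) := rfl
    obtain ⟨e, he⟩ := exists_equiv_fderiv_coordChange hm
    rw [hdet x _ y hm, h3, localForm_chart, localForm_chart, he]
    refine mul_ne_zero e.toLinearEquiv.isUnit_det'.ne_zero
      (h.wedge223_torsionForm_ne_zero hc fun h0 => hc0 ?_)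
    have h4 := h.formInner_torsionForm hc hΔ ((chartAt E7 x).symm y)
    have h5 : formInner (φ ((chartAt E7 x).symm y)) (0 : AltForm 2) 0 = 0 := by
      simp only [formInner, zero_form_apply, zero_mul, Finset.sum_const_zero, mul_zero]
    rw [h0, h5] at h4
    linarith
  · obtain ⟨e, he⟩ := exists_equiv_fderiv_coordChange hy
    beta_reduce
    rw [localForm_coordChange (torsionForm φ) hy, he]
    exact cubeVec_comp _ e
  · have hd : altTwo (fderiv ℝ (localForm (torsionForm φ) x) y) = c • localForm φ x y := by
      have h1 := localForm_extd hτ hy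
      rw [← hodgeLaplacian_of_closed hc, hΔ] at h1
      exact h1.symm
    beta_reduce
    rw [sum_fderiv_cubeVec (hτ.contDiffAt hy), hd, map_smul, smul_eq_mul]
    ring

theorem IsLaplacianSoliton.isTorsionFree_of_compactSpace [CompactSpace M] [T2Space M] [Nonempty M]
    {c : ℝ} (h : IsLaplacianSoliton φ 0 c) : IsTorsionFree φ := by
  have hΔ := h.hodgeLaplacian_eq
  refine (h.isG2.eq_zero_iff h.closed hΔ).1 ?_
  by_contra hc0
  have h1 := (h.isG2.isDivergenceOf h.closed hc0 hΔ).eq_zero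
  exact hc0 (by linarith)

end Manifold

end

end G2

theorem proposition1p7 {M : Type*} [TopologicalSpace M] [ChartedSpace G2.E7 M]
    [IsManifold (𝓡 7) ∞ M] [T2Space M] [SecondCountableTopology M] [Nonempty M] :
    (∀ (φ : G2.DiffForm M 3) (c : ℝ), G2.IsLaplacianSoliton φ 0 c →
      (∃! τ : G2.DiffForm M 2, G2.IsTorsionForm φ τ) ∧
      (∀ τ : G2.DiffForm M 2, G2.IsTorsionForm φ τ →
        ∀ x, c = G2.formInner (φ x) (τ x) (τ x) / 7) ∧
      0 ≤ c ∧
      (c = 0 ↔ G2.IsTorsionFree φ) ∧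
      (0 < c ∨ G2.IsTorsionFree φ)) ∧
    (∀ φ : G2.DiffForm M 3,
      G2.IsStationary φ ↔ G2.IsG2Structure φ ∧ G2.IsTorsionFree φ) ∧
    (CompactSpace M → ∀ (φ : G2.DiffForm M 3) (c : ℝ), G2.IsLaplacianSoliton φ 0 c →
      G2.IsTorsionFree φ) :=
  ⟨fun _ _ h => h.properties, fun φ => G2.isStationary_iff φ,
    fun _ _ _ h => h.isTorsionFree_of_compactSpace⟩
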